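/- Let $N,m\in\mathbb N$, $T>0$. Consider the nonlocal system, for $k=1,\dots,N$, $$\partial_t\rho^k+\partial_x F_k(\rho^k,\omega*\boldsymbol\rho)=S_k(\boldsymbol\rho,\omega*\boldsymbol\rho),\qquad \boldsymbol\rho(0,\cdot)=\boldsymbol\rho_0,\qquad (\omega*\boldsymbol\rho)_\ell(t,x)=\sum_{k=1}^N\int_{\mathbb R}\omega^{\ell,k}(y-x)\rho^k(t,y)\,dy,\quad \ell=1,\dots,m.$$ **Assumptions.** Let $\rho_M>0$, $I=[-\tfrac{\rho_M}8,\rho_M+\tfrac{\rho_M}8]$ and $J=[-\tfrac{\rho_M}8,N\rho_M+\tfrac{\rho_M}8]$. For all $k$, $\ell$: - $F_k(\rho,\boldsymbol R)=g_k(\rho)V_k(\boldsymbol R)$ on $\mathbb R\times\mathbb R^m$, $F_k(0,\boldsymbol R)=0$ for all $\boldsymbol R\in\mathbb R^m$, $g_k$ is Lipschitz on $I$, $V_k\in C^2(J^m)$, and $|F_k(r,\boldsymbol R)-F_k(r',\boldsymbol R')|\le L_F\big(|r-r'|+\sum_\ell|R_\ell-R'_\ell|\big)$ on $I\times J^m$;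 - $S_k:\mathbb R^N\times\mathbb R^m\to\mathbb R$ is Lipschitz on $I^N\times J^m$ and $S_k(0,\boldsymbol R)=0$ for all $\boldsymbol R\in\mathbb R^m$; - $\rho_0^k\in L^1\cap BV(\mathbb R)$ with values in $[0,\rho_M)$; - $\omega^{\ell,k}\ge0$, $\int_{\mathbb R}\omega^{\ell,k}=1$, the support of $\omega^{\ell,k}$ is an interval $[\eta_1^{\ell,k},\eta_2^{\ell,k}]$ with $\eta_1^{\ell,k}\le0\le\eta_2^{\ell,k}$, $\eta_1^{\ell,k}\ne\eta_2^{\ell,k}$, and $\omega^{\ell,k}\in C^1([\eta_1^{\ell,k},\eta_2^{\ell,k}])$. **Scheme.** A step $\Delta x>0$ is admissible if $N_1^{\ell,k}=|\eta_1^{\ell,k}|/\Delta x$ and $N_2^{\ell,k}=\eta_2^{\ell,k}/\Delta x$ are nonnegative integers for all $\ell,k$. Let $\Delta t=\lambda\Delta x$ with a fixed $\lambda>0$, $x_j=j\Delta x$, $t^n=n\Delta t$, and $\rho_j^{k,0}=\frac1{\Delta x}\int_{x_{j-1/2}}^{x_{j+1/2}}\rho^k_0\,dx$. Let $\operatorname{minmod}(a,b)$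 be $0$ if $ab\le0$, and otherwise the one of $a,b$ of smaller modulus. For a grid function $u$ put $s_j(u)=\operatorname{minmod}\big(\frac{u_j-u_{j-1}}{\Delta x},\frac{u_{j+1}-u_j}{\Delta x}\big)$; $s_j^{k,n}=s_j(\rho^{k,n})$. For a weight $w$ and grid functions $a,b,c$ put $$Q_j^{\ell,k}[w;a,b,c]=\tfrac{\Delta x}2a_{j-N_1^{\ell,k}}w\big(\tfrac{\Delta x}4-N_1^{\ell,k}\Delta x\big)+\Delta x\sum_{l=-N_1^{\ell,k}}^{N_2^{\ell,k}-2}b_{j+l+1}w((l+1)\Delta x)+\tfrac{\Delta x}2c_{j+N_2^{\ell,k}}w\big(N_2^{\ell,k}\Delta x-\tfrac{\Delta x}4\big).$$ With $a^{k}=\rho^{k,n}+\frac{\Delta x}4s^{k,n}$ and $c^{k}=\rho^{k,n}-\frac{\Delta x}4s^{k,n}$ set $R_j^{\ell,k,n}=Q_j^{\ell,k}[\omega^{\ell,k};a^k,\rho^{k,n},c^k]$, $R_j^{\ell,n}=\sum_kR_j^{\ell,k,n}$, and $$\partial_xR_j^{\ell,n}=\sum_k\Big(-\omega^{\ell,k}(\eta_1^{\ell,k})\rho^{k,n}_{j-N_1^{\ell,k}}+\omega^{\ell,k}(\eta_2^{\ell,k})\rho^{k,n}_{j+N_2^{\ell,k}}-Q_j^{\ell,k}[(\omega^{\ell,k})';a^k,\rho^{k,n},c^k]\Big),$$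 $$\sigma_j^{k,n}=\operatorname{minmod}\Big(\tfrac{g_k(\rho_{j+1}^{k,n})-g_k(\rho_j^{k,n})}{\Delta x},\tfrac{g_k(\rho_j^{k,n})-g_k(\rho_{j-1}^{k,n})}{\Delta x}\Big)V_k(\boldsymbol R_j^n)+g_k(\rho_j^{k,n})\sum_{\ell=1}^m\partial_{R_\ell}V_k(\boldsymbol R_j^n)\,\partial_xR_j^{\ell,n}.$$ With $d_j^{k}=S_k(\boldsymbol\rho_j^n,\boldsymbol R_j^n)-\sigma_j^{k,n}$ set $\rho_j^{k,n+1/2}=\rho_j^{k,n}+\frac{\Delta t}2d_j^k$ and $R_j^{\ell,n+1/2}=\sum_k\big(R_j^{\ell,k,n}+\frac{\Delta t}2Q_j^{\ell,k}[\omega^{\ell,k};d^k,d^k,d^k]\big)$, write $F_j^k,S_j^k$ for $F_k(\rho_j^{k,n+1/2},\boldsymbol R_j^{n+1/2})$, $S_k(\boldsymbol\rho_j^{n+1/2},\boldsymbol R_j^{n+1/2})$, and define $$\rho_{j+1/2}^{k,n+1}=\tfrac12(\rho_j^{k,n}+\rho_{j+1}^{k,n})+\tfrac{\Delta x}8(s_j^{k,n}-s_{j+1}^{k,n})-\lambda(F_{j+1}^k-F_j^k)+\tfrac{\Delta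 t}2(S_{j+1}^k+S_j^k),$$ $$\rho_j^{k,n+1}=\tfrac12(\rho_{j-1/2}^{k,n+1}+\rho_{j+1/2}^{k,n+1})-\tfrac{\Delta x}8(s_{j+1/2}^{k,n+1}-s_{j-1/2}^{k,n+1}),$$ where $s_{j+1/2}^{k,n+1}$ is the minmod slope of the staggered values. The approximate solution is $\rho_\Delta^k(t,x)=\rho_j^{k,n}+s_j^{k,n}(x-x_j)$ for $(t,x)\in[t^n,t^{n+1})\times[x_{j-1/2},x_{j+1/2})$. **Claim.** If the CFL condition $\lambda L_F\le\frac{\sqrt2-1}2$ holds, then there is $T^*\in(0,T]$ such that for every sequence of admissible steps $\Delta x\to0$ (with $\Delta t=\lambda\Delta x$) a subsequence of $\boldsymbol\rho_\Delta$ converges in $L^1((0,T^*)\times(-r,r))$ for every $r>0$ to a weak solution $\boldsymbol\rho$ of the system on $(0,T^*)$, that is, to some $\boldsymbol\rho\in L^\infty((0,T^*)\times\mathbb R;\mathbb R^N)$ such that for all $k$ and all $\phi\in C^1_c((-42,T^*)\times\mathbb R)$ $$\int_{\mathbb R}\rho_0^k\,\phi(0,x)\,dx+\int_0^{T^*}\!\!\int_{\mathbb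 R}\big(\rho^k\phi_t+F_k(\rho^k,\omega*\boldsymbol\rho)\,\phi_x+S_k(\boldsymbol\rho,\omega*\boldsymbol\rho)\,\phi\big)\,dx\,dt=0,$$ all integrals being absolutely convergent. -/

import Mathlib

open MeasureTheory Set Filter Topology

noncomputable section

namespace NT

/-- The input data of the system of `N` nonlocal balance laws
`∂ₜρᵏ + ∂ₓ(gₖ(ρᵏ) Vₖ(ω * ρ)) = Sₖ(ρ, ω * ρ)`, `ρ(0, ·) = ρ₀`, with `m` nonlocal terms.
The kernel `ω ℓ k` has support `[η₁ ℓ k, η₂ ℓ k]`. -/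
structure Data (N m : ℕ) where
  g : Fin N → ℝ → ℝ
  V : Fin N → (Fin m → ℝ) → ℝ
  S : Fin N → (Fin N → ℝ) → (Fin m → ℝ) → ℝ
  ω : Fin m → Fin N → ℝ → ℝ
  η₁ : Fin m → Fin N → ℝ
  η₂ : Fin m → Fin N → ℝ
  ρ₀ : Fin N → ℝ → ℝ

/-- The minmod function. (If `a` and `b` have the same sign and the same modulus, they agree.) -/
def minmod (a b : ℝ) : ℝ :=
  if a * b ≤ 0 then 0 else if |a| ≤ |b| then a else b

/-- The minmod slope of a grid function `u`, for cells of length `h`. -/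
def slope (h : ℝ) (u : ℤ → ℝ) (j : ℤ) : ℝ :=
  minmod ((u j - u (j - 1)) / h) ((u (j + 1) - u j) / h)

/-- The quadrature rule for `∫ f(y) w(y - xⱼ) dy` over `[x_{j-n₁}, x_{j+n₂}]`: two boundary half
cells, on which `f` is represented by `a` and `c`, and full inner cells, on which it is
represented by `b`; the weight `w` is evaluated at the midpoints. -/
def quad (h : ℝ) (n₁ n₂ : ℤ) (w : ℝ → ℝ) (a b c : ℤ → ℝ) (j : ℤ) : ℝ :=
  h / 2 * a (j - n₁) * w (h / 4 - n₁ * h)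
    + h * ∑ l ∈ Finset.Icc (-n₁) (n₂ - 2), b (j + l + 1) * w ((l + 1) * h)
    + h / 2 * c (j + n₂) * w (n₂ * h - h / 4)

/-- A function on `ℝ` that is integrable and has bounded variation, as a class of functions up to
equality almost everywhere. -/
def IsL1BV (f : ℝ → ℝ) : Prop :=
  Integrable f ∧ ∃ f' : ℝ → ℝ, f =ᵐ[volume] f' ∧ BoundedVariationOn f' univ

/-- The range of densities on which the flux and the source are assumed to be regular. -/
def densityRange (ρM : ℝ) : Set ℝ := Icc (-(ρM / 8)) (ρM + ρM / 8)

/-- The range of values of the nonlocal term on which the flux and the source are assumed to be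
regular. (A nonlocal term is a sum of `N` averages of densities.) -/
def nonlocalRange (N m : ℕ) (ρM : ℝ) : Set (Fin m → ℝ) :=
  {R | ∀ ℓ, R ℓ ∈ Icc (-(ρM / 8)) (N * ρM + ρM / 8)}

namespace Data

variable {N m : ℕ} (D : Data N m)

/-- The flux functions `Fₖ(r, R) = gₖ(r) Vₖ(R)`. -/
def F (k : Fin N) (r : ℝ) (R : Fin m → ℝ) : ℝ := D.g k r * D.V k R

/-- The assumptions on the input data. `LF` is a Lipschitz constant of the flux functions.
Integrability and bounded variation of the kernels follow from `ω_support` and `ω_C1`. -/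
structure Assumption (ρM LF : ℝ) : Prop where
  ρM_pos : 0 < ρM
  F_zero : ∀ k R, D.F k 0 R = 0
  F_lip : ∀ k, ∀ r ∈ densityRange ρM, ∀ r' ∈ densityRange ρM,
    ∀ R ∈ nonlocalRange N m ρM, ∀ R' ∈ nonlocalRange N m ρM,
      |D.F k r R - D.F k r' R'| ≤ LF * (|r - r'| + ∑ ℓ, |R ℓ - R' ℓ|)
  g_lip : ∀ k, ∃ Lg : ℝ, ∀ r ∈ densityRange ρM, ∀ r' ∈ densityRange ρM,
    |D.g k r - D.g k r'| ≤ Lg * |r - r'|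
  V_C2 : ∀ k, ContDiffOn ℝ 2 (D.V k) (nonlocalRange N m ρM)
  S_zero : ∀ k R, D.S k 0 R = 0
  S_lip : ∃ LS : ℝ, ∀ k, ∀ u u' : Fin N → ℝ,
    (∀ i, u i ∈ densityRange ρM) → (∀ i, u' i ∈ densityRange ρM) →
    ∀ R ∈ nonlocalRange N m ρM, ∀ R' ∈ nonlocalRange N m ρM,
      |D.S k u R - D.S k u' R'| ≤ LS * (∑ i, |u i - u' i| + ∑ ℓ, |R ℓ - R' ℓ|)
  ρ₀_range : ∀ k, ∀ᵐ x, D.ρ₀ k x ∈ Ico 0 ρM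
  ρ₀_L1BV : ∀ k, IsL1BV (D.ρ₀ k)
  η₁_nonpos : ∀ ℓ k, D.η₁ ℓ k ≤ 0
  η₂_nonneg : ∀ ℓ k, 0 ≤ D.η₂ ℓ k
  η_ne : ∀ ℓ k, D.η₁ ℓ k ≠ D.η₂ ℓ k
  ω_nonneg : ∀ ℓ k x, 0 ≤ D.ω ℓ k x
  ω_support : ∀ ℓ k, tsupport (D.ω ℓ k) = Icc (D.η₁ ℓ k) (D.η₂ ℓ k)
  ω_C1 : ∀ ℓ k, ContDiffOn ℝ 1 (D.ω ℓ k) (Icc (D.η₁ ℓ k) (D.η₂ ℓ k))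
  ω_integral : ∀ ℓ k, ∫ x, D.ω ℓ k x = 1

/-! ### Weak solutions -/

/-- The nonlocal term `(ω * ρ)_ℓ(t,x) = ∑ₖ ∫ ω^{ℓ,k}(y - x) ρᵏ(t,y) dy`. -/
def nonlocal (ρ : ℝ × ℝ → Fin N → ℝ) (p : ℝ × ℝ) : Fin m → ℝ :=
  fun ℓ => ∑ k, ∫ y, D.ω ℓ k (y - p.2) * ρ (p.1, y) k

/-- `ρ` is a weak solution of the system on `(0,T) × ℝ` with initial datum `ρ₀`. Points of the
domain are pairs `(t, x)`; the test functions are `C¹` with compact support in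
`(-42, T) × ℝ`. -/
def IsWeakSolution (T : ℝ) (ρ : ℝ × ℝ → Fin N → ℝ) : Prop :=
  MemLp ρ ⊤ (volume.restrict (Ioo 0 T ×ˢ univ)) ∧
  ∀ (k : Fin N) (φ : ℝ × ℝ → ℝ), ContDiff ℝ 1 φ → HasCompactSupport φ →
    tsupport φ ⊆ Ioo (-42) T ×ˢ univ →
    IntegrableOn (fun p => D.F k (ρ p k) (D.nonlocal ρ p) * fderiv ℝ φ p (0, 1))
      (Ioo 0 T ×ˢ univ) ∧
    IntegrableOn (fun p => φ p * D.S k (ρ p) (D.nonlocal ρ p)) (Ioo 0 T ×ˢ univ) ∧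
    (∫ x, D.ρ₀ k x * φ (0, x))
      + (∫ p in Ioo 0 T ×ˢ univ, ρ p k * fderiv ℝ φ p (1, 0))
      + (∫ p in Ioo 0 T ×ˢ univ, D.F k (ρ p k) (D.nonlocal ρ p) * fderiv ℝ φ p (0, 1))
      + (∫ p in Ioo 0 T ×ˢ univ, φ p * D.S k (ρ p) (D.nonlocal ρ p)) = 0

/-! ### The Nessyahu–Tadmor scheme

Throughout, `h` is the space step, `τ` the time step, and a grid function `u` has the value `u k j`
for the component `k` in the cell `[(j - 1/2) h, (j + 1/2) h)`. -/

/-- Number of cells to the left that a kernel reaches. -/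
def N₁ (h : ℝ) (ℓ : Fin m) (k : Fin N) : ℤ := ⌈|D.η₁ ℓ k| / h⌉

/-- Number of cells to the right that a kernel reaches. -/
def N₂ (h : ℝ) (ℓ : Fin m) (k : Fin N) : ℤ := ⌈D.η₂ ℓ k / h⌉

/-- A space step is admissible if it is positive and the end points of the support of every kernel
are grid points. -/
def AdmissibleStep (h : ℝ) : Prop :=
  0 < h ∧ ∀ ℓ k, (D.N₁ h ℓ k : ℝ) = |D.η₁ ℓ k| / h ∧ (D.N₂ h ℓ k : ℝ) = D.η₂ ℓ k / h

/-- The derivative of a kernel on its support (one-sided at the end points). -/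
def dω (ℓ : Fin m) (k : Fin N) (x : ℝ) : ℝ :=
  derivWithin (D.ω ℓ k) (Icc (D.η₁ ℓ k) (D.η₂ ℓ k)) x

/-- Discrete nonlocal terms `R_j^{ℓ,k}`. -/
def discR (h : ℝ) (u : Fin N → ℤ → ℝ) (ℓ : Fin m) (k : Fin N) (j : ℤ) : ℝ :=
  quad h (D.N₁ h ℓ k) (D.N₂ h ℓ k) (D.ω ℓ k)
    (fun i => u k i + h / 4 * slope h (u k) i) (u k)
    (fun i => u k i - h / 4 * slope h (u k) i) j

/-- The vector `R_j` of discrete nonlocal terms. -/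
def vecR (h : ℝ) (u : Fin N → ℤ → ℝ) (j : ℤ) : Fin m → ℝ :=
  fun ℓ => ∑ k, D.discR h u ℓ k j

/-- The approximation of `∂ₓ R^ℓ` at `x_j`. -/
def dxR (h : ℝ) (u : Fin N → ℤ → ℝ) (ℓ : Fin m) (j : ℤ) : ℝ :=
  ∑ k, (-(D.ω ℓ k (D.η₁ ℓ k) * u k (j - D.N₁ h ℓ k))
    + D.ω ℓ k (D.η₂ ℓ k) * u k (j + D.N₂ h ℓ k)
    - quad h (D.N₁ h ℓ k) (D.N₂ h ℓ k) (D.dω ℓ k)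
        (fun i => u k i + h / 4 * slope h (u k) i) (u k)
        (fun i => u k i - h / 4 * slope h (u k) i) j)

/-- The approximation `σᵏ` of `∂ₓ(gₖ(ρᵏ) Vₖ(R))` at `x_j`: the minmod limiter for `∂ₓ gₖ(ρᵏ)`, and
the kernel derivatives for `∂ₓ R`. -/
def σ (h : ℝ) (u : Fin N → ℤ → ℝ) (k : Fin N) (j : ℤ) : ℝ :=
  minmod ((D.g k (u k (j + 1)) - D.g k (u k j)) / h)
      ((D.g k (u k j) - D.g k (u k (j - 1))) / h) * D.V k (D.vecR h u j)
    + D.g k (u k j) *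
      ∑ ℓ, fderiv ℝ (D.V k) (D.vecR h u j) (Pi.single ℓ 1) * D.dxR h u ℓ j

/-- The approximation `Sₖ - σᵏ` of `∂ₜ ρᵏ` at `x_j`. -/
def dtU (h : ℝ) (u : Fin N → ℤ → ℝ) (k : Fin N) (j : ℤ) : ℝ :=
  D.S k (fun i => u i j) (D.vecR h u j) - D.σ h u k j

/-- The densities at the half time step. -/
def halfU (τ h : ℝ) (u : Fin N → ℤ → ℝ) (k : Fin N) (j : ℤ) : ℝ :=
  u k j + τ / 2 * D.dtU h u k j

/-- The nonlocal terms at the half time step. -/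
def halfR (τ h : ℝ) (u : Fin N → ℤ → ℝ) (j : ℤ) : Fin m → ℝ :=
  fun ℓ => ∑ k, (D.discR h u ℓ k j
    + τ / 2 * quad h (D.N₁ h ℓ k) (D.N₂ h ℓ k) (D.ω ℓ k)
        (D.dtU h u k) (D.dtU h u k) (D.dtU h u k) j)

/-- The flux at the half time step. -/
def halfF (τ h : ℝ) (u : Fin N → ℤ → ℝ) (k : Fin N) (j : ℤ) : ℝ :=
  D.F k (D.halfU τ h u k j) (D.halfR τ h u j)

/-- The source at the half time step. -/
def halfS (τ h : ℝ) (u : Fin N → ℤ → ℝ) (k : Fin N) (j : ℤ) : ℝ :=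
  D.S k (fun i => D.halfU τ h u i j) (D.halfR τ h u j)

/-- The staggered cell averages after one time step; `stag τ h u k j` belongs to the cell
`[x_j, x_{j+1}]` with centre `x_{j+1/2}`. -/
def stag (τ h : ℝ) (u : Fin N → ℤ → ℝ) (k : Fin N) (j : ℤ) : ℝ :=
  (u k j + u k (j + 1)) / 2 + h / 8 * (slope h (u k) j - slope h (u k) (j + 1))
    - τ / h * (D.halfF τ h u k (j + 1) - D.halfF τ h u k j)
    + τ / 2 * (D.halfS τ h u k (j + 1) + D.halfS τ h u k j)

/-- One time step on the non-staggered grid: the piecewise linear minmod interpolant of the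
staggered values is averaged over `[x_{j-1/2}, x_{j+1/2}]`. -/
def step (τ h : ℝ) (u : Fin N → ℤ → ℝ) (k : Fin N) (j : ℤ) : ℝ :=
  (D.stag τ h u k (j - 1) + D.stag τ h u k j) / 2
    - h / 8 * (slope h (D.stag τ h u k) j - slope h (D.stag τ h u k) (j - 1))

/-- The cell averages of the initial datum. -/
def init (h : ℝ) (k : Fin N) (j : ℤ) : ℝ :=
  1 / h * ∫ x in ((j - 1 / 2 : ℝ) * h)..((j + 1 / 2 : ℝ) * h), D.ρ₀ k x

/-- The discrete solution `ρ_j^{k,n}`. -/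
def sol (τ h : ℝ) : ℕ → Fin N → ℤ → ℝ
  | 0 => D.init h
  | n + 1 => D.step τ h (sol τ h n)

/-- The approximate solution `ρ_Δ`, equal to `ρ_j^{k,n} + s_j^{k,n} (x - x_j)` for
`(t,x)` in `[tⁿ, tⁿ⁺¹) × [x_{j-1/2}, x_{j+1/2})`, `t ≥ 0`. -/
def approx (τ h : ℝ) (p : ℝ × ℝ) : Fin N → ℝ := fun k =>
  let u := D.sol τ h ⌊p.1 / τ⌋₊ k
  let j := ⌊p.2 / h + 1 / 2⌋
  u j + slope h u j * (p.2 - j * h)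

end Data

end NT

end

/-!
The theorem is proved by compactness: the discrete solutions are bounded in `L^∞` and in `BV` on a
time interval `[0, Ts]` that does not depend on the step, hence have limit points in `L¹`, and the
scheme is consistent, so that limit points are weak solutions.

*Uniform bounds* (`exists_uniform`). The staggered value `stag j` is the average of `u j` and
`u (j + 1)`, corrected by the slopes, by the difference of the fluxes, and by terms of order `h`.
The slopes change the average by at most `1/4 |u (j + 1) - u j|` (`abs_slope_diff_le`). In the
difference of the fluxes, the part in which the nonlocal term is frozen is at most
`1/4 |u (j + 1) - u j|` up to `O(h)`: at the half time step, differences of `u` grow at most by the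
factor `1 + λ L_F + O(h)`, and the CFL condition says exactly that `λ L_F (1 + λ L_F) ≤ 1/4`
(`cfl_quadratic`). So up to `O(h)` the staggered values are convex combinations of neighbouring
values, which increases neither the range nor the total variation (`tv_convex`). The remaining part
of the flux difference comes from the nonlocal term. Summation by parts in the quadrature rule puts
its differences on the kernel, which gains a factor `h` (`QuadLip.abs_diff_quad_le`), and this
part is thereby `O(h)`, with total variation `O(h)` times that of `u`, because `V` is `C²`.
Altogether one step multiplies the total variation by `1 + C h` and enlarges the range by `C h`
(`Bounds.stag_bounds`). The variation is therefore bounded on every bounded time interval, and the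
range remains in the interval on which flux and source are regular up to a time `Ts` of the order
of `ρM`. The discrete nonlocal terms remain in their range since, for small steps, the quadrature
rule has almost the mass `1` of the kernel (`Assumption.eventually_mass`).

*Compactness* (`exists_limit`). The bound on the variation makes the discrete solutions Lipschitz
in time with values in `L¹`, with respect to a finite weight in space
(`exists_time_bound`). Hence sampling at the points of a fixed countable grid is a good
approximation in `L¹` of the strip, uniformly in the step (`exists_sample_bound`). A diagonal
subsequence that converges at all sampling points is then a Cauchy sequence in `L¹`
(`exists_subseq_tendsto_L1`).

*Consistency* (`isWeakSolution_of_tendsto`). In viscous form (`step_sub_eq`) the scheme consists of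
centred differences of fluxes and averages of sources at the half time step, and of the difference
of a viscosity that is summable over the grid. Summation by parts against a test function
(`discrete_weak`) makes the viscous term `O(h)`. Almost everywhere, the densities, also at half time
steps, converge to the limit, and the discrete nonlocal terms to its nonlocal terms
(`ae_convergesAt`, `tendsto_quad`), and dominated convergence applies to the remaining sums
(`tendsto_sum_strip`).
-/

noncomputable section

namespace NT

/-! ### Summable sequences on the grid and total variation -/

/-- `a` is a nonnegative sequence on `ℤ` all of whose finite sums are at most `K`. -/
def SumLE (a : ℤ → ℝ) (K : ℝ) : Prop :=
  (∀ j, 0 ≤ a j) ∧ ∀ s : Finset ℤ, ∑ j ∈ s, a j ≤ K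

/-- The forward difference of a grid function. -/
def diff (u : ℤ → ℝ) (j : ℤ) : ℝ := u (j + 1) - u j

/-- The total variation of the grid function `u` is at most `A`. -/
def TVLE (u : ℤ → ℝ) (A : ℝ) : Prop := SumLE (fun j => |diff u j|) A

namespace SumLE

variable {a b : ℤ → ℝ} {K L : ℝ}

lemma nonneg (h : SumLE a K) : 0 ≤ K := by simpa using h.2 ∅

lemma le (h : SumLE a K) (j : ℤ) : a j ≤ K := by simpa using h.2 {j}

lemma mono (h : SumLE a K) (h0 : ∀ j, 0 ≤ b j) (hb : ∀ j, b j ≤ a j) : SumLE b K :=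
  ⟨h0, fun s => (Finset.sum_le_sum fun j _ => hb j).trans (h.2 s)⟩

lemma weaken (h : SumLE a K) (hK : K ≤ L) : SumLE a L := ⟨h.1, fun s => (h.2 s).trans hK⟩

lemma add (ha : SumLE a K) (hb : SumLE b L) : SumLE (fun j => a j + b j) (K + L) :=
  ⟨fun j => add_nonneg (ha.1 j) (hb.1 j), fun s => by
    rw [Finset.sum_add_distrib]; exact add_le_add (ha.2 s) (hb.2 s)⟩

lemma const_mul (ha : SumLE a K) {c : ℝ} (hc : 0 ≤ c) : SumLE (fun j => c * a j) (c * K) :=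
  ⟨fun j => mul_nonneg hc (ha.1 j), fun s => by
    rw [← Finset.mul_sum]; exact mul_le_mul_of_nonneg_left (ha.2 s) hc⟩

lemma shift (ha : SumLE a K) (c : ℤ) : SumLE (fun j => a (j + c)) K :=
  ⟨fun j => ha.1 _, fun s => by
    have := ha.2 (s.map (Equiv.addRight c).toEmbedding)
    simpa [Finset.sum_map] using this⟩

lemma sum {ι : Type*} (s : Finset ι) {f : ι → ℤ → ℝ} {M : ι → ℝ}
    (hf : ∀ i ∈ s, SumLE (f i) (M i)) : SumLE (fun j => ∑ i ∈ s, f i j) (∑ i ∈ s, M i) :=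
  ⟨fun j => Finset.sum_nonneg fun i hi => (hf i hi).1 j, fun t => by
    rw [Finset.sum_comm]; exact Finset.sum_le_sum fun i hi => (hf i hi).2 t⟩

lemma sum_const {ι : Type*} (s : Finset ι) {f : ι → ℤ → ℝ}
    (hf : ∀ i ∈ s, SumLE (f i) K) : SumLE (fun j => ∑ i ∈ s, f i j) (s.card * K) := by
  simpa using SumLE.sum s hf

end SumLE

namespace TVLE

variable {u v : ℤ → ℝ} {A B : ℝ}

lemma nonneg (h : TVLE u A) : 0 ≤ A := SumLE.nonneg h

lemma weaken (h : TVLE u A) (hK : A ≤ B) : TVLE u B := SumLE.weaken h hK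

lemma of_le {a : ℤ → ℝ} (h : SumLE a A) (hu : ∀ j, |diff u j| ≤ a j) : TVLE u A :=
  h.mono (fun _ => abs_nonneg _) hu

lemma shift (h : TVLE u A) (c : ℤ) : TVLE (fun j => u (j + c)) A := by
  refine of_le (SumLE.shift h c) fun j => le_of_eq ?_
  simp only [diff]; rw [add_right_comm]

lemma add (hu : TVLE u A) (hv : TVLE v B) : TVLE (fun j => u j + v j) (A + B) := by
  refine of_le (SumLE.add hu hv) fun j => ?_
  have : diff (fun j => u j + v j) j = diff u j + diff v j := by simp only [diff]; ring
  rw [this]; exact abs_add_le _ _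

lemma const_mul (hu : TVLE u A) (c : ℝ) : TVLE (fun j => c * u j) (|c| * A) := by
  refine of_le (SumLE.const_mul hu (abs_nonneg c)) fun j => ?_
  have : diff (fun j => c * u j) j = c * diff u j := by simp only [diff]; ring
  rw [this, abs_mul]

lemma sub (hu : TVLE u A) (hv : TVLE v B) : TVLE (fun j => u j - v j) (A + B) := by
  have := hu.add (hv.const_mul (-1))
  simp only [abs_neg, abs_one, one_mul, neg_mul] at this
  simpa [sub_eq_add_neg] using this

lemma sum {ι : Type*} (s : Finset ι) {f : ι → ℤ → ℝ} {M : ι → ℝ}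
    (hf : ∀ i ∈ s, TVLE (f i) (M i)) : TVLE (fun j => ∑ i ∈ s, f i j) (∑ i ∈ s, M i) := by
  refine of_le (SumLE.sum s hf) fun j => ?_
  have : diff (fun j => ∑ i ∈ s, f i j) j = ∑ i ∈ s, diff (f i) j := by
    simp only [diff, Finset.sum_sub_distrib]
  rw [this]; exact Finset.abs_sum_le_sum_abs _ _

lemma sum_const {ι : Type*} (s : Finset ι) {f : ι → ℤ → ℝ}
    (hf : ∀ i ∈ s, TVLE (f i) A) : TVLE (fun j => ∑ i ∈ s, f i j) (s.card * A) := by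
  simpa using TVLE.sum s hf

lemma mul {M P : ℝ} (hu : TVLE u A) (hv : TVLE v B) (hM : ∀ j, |u j| ≤ M) (hP : ∀ j, |v j| ≤ P) :
    TVLE (fun j => u j * v j) (P * A + M * B) := by
  have hM0 : 0 ≤ M := (abs_nonneg _).trans (hM 0)
  have hP0 : 0 ≤ P := (abs_nonneg _).trans (hP 0)
  refine of_le ((SumLE.const_mul hu hP0).add (SumLE.const_mul hv hM0)) fun j => ?_
  have : diff (fun j => u j * v j) j = v (j + 1) * diff u j + u j * diff v j := by
    simp only [diff]; ring
  rw [this]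
  refine (abs_add_le _ _).trans ?_
  rw [abs_mul, abs_mul]
  gcongr
  · exact hP _
  · exact hM _

/-- A summable sequence has bounded variation. -/
lemma of_sumLE (h : SumLE (fun j => |u j|) A) : TVLE u (2 * A) := by
  rw [two_mul]
  refine of_le ((h.shift 1).add h) fun j => ?_
  simp only [diff]; exact abs_sub _ _

end TVLE

/-! ### The minmod limiter -/

lemma abs_minmod_le_left (a b : ℝ) : |minmod a b| ≤ |a| := by
  unfold minmod; split_ifs <;> simp_all [le_of_lt]

lemma abs_minmod_le_right (a b : ℝ) : |minmod a b| ≤ |b| := by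
  unfold minmod; split_ifs <;> simp_all

lemma minmod_mul_left_nonneg (a b : ℝ) : 0 ≤ minmod a b * a := by
  unfold minmod; split_ifs
  · simp
  · exact mul_self_nonneg a
  · push Not at *; rw [mul_comm]; linarith

lemma minmod_mul_right_nonneg (a b : ℝ) : 0 ≤ minmod a b * b := by
  unfold minmod; split_ifs
  · simp
  · push Not at *; linarith
  · exact mul_self_nonneg b

section slope

variable {h : ℝ}

lemma abs_mul_slope_le_right (hh : 0 < h) (u : ℤ → ℝ) (j : ℤ) : |h * slope h u j| ≤ |diff u j| := by
  have := abs_minmod_le_right ((u j - u (j - 1)) / h) ((u (j + 1) - u j) / h)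
  rw [abs_div, abs_of_pos hh, le_div_iff₀ hh] at this
  rw [abs_mul, abs_of_pos hh, mul_comm]; exact this

lemma abs_mul_slope_le_left (hh : 0 < h) (u : ℤ → ℝ) (j : ℤ) :
    |h * slope h u (j + 1)| ≤ |diff u j| := by
  have := abs_minmod_le_left ((u (j + 1) - u (j + 1 - 1)) / h) ((u (j + 1 + 1) - u (j + 1)) / h)
  rw [abs_div, abs_of_pos hh, le_div_iff₀ hh, add_sub_cancel_right] at this
  rw [abs_mul, abs_of_pos hh, mul_comm]
  simpa [slope, diff] using this

/-- The slopes use up half of the margin `1/2 |u_{j+1} - u_j|` within which a correction of the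
average of `u_j` and `u_{j+1}` leaves it a convex combination of them. -/
lemma abs_slope_diff_le (hh : 0 < h) (u : ℤ → ℝ) (j : ℤ) :
    |h / 8 * (slope h u j - slope h u (j + 1))| ≤ 1 / 4 * |diff u j| := by
  have h1 := abs_mul_slope_le_right hh u j
  have h2 := abs_mul_slope_le_left hh u j
  have : h / 8 * (slope h u j - slope h u (j + 1))
      = 1 / 8 * (h * slope h u j - h * slope h u (j + 1)) := by ring
  rw [this, abs_mul, abs_of_pos (by norm_num : (0 : ℝ) < 1 / 8)]
  have := abs_sub (h * slope h u j) (h * slope h u (j + 1))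
  linarith

/-- A limited slope points towards the neighbouring value `b`, and a quarter of it does not lead
beyond `b`. -/
lemma add_quarter_mem {a b s lo hi : ℝ} (ha : a ∈ Icc lo hi) (hb : b ∈ Icc lo hi)
    (h1 : |s| ≤ |b - a|) (h2 : 0 ≤ s * (b - a)) : a + 1 / 4 * s ∈ Icc lo hi := by
  simp only [mem_Icc] at *
  rcases le_total 0 (b - a) with hs | hs
  · rw [abs_of_nonneg hs] at h1
    have := abs_le.1 h1
    rcases hs.eq_or_lt with h0 | h0
    · constructor <;> linarith
    · have := nonneg_of_mul_nonneg_left h2 h0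
      constructor <;> linarith
  · rw [abs_of_nonpos hs] at h1
    have := abs_le.1 h1
    rcases hs.eq_or_lt with h0 | h0
    · constructor <;> linarith
    · have : s ≤ 0 := by nlinarith
      constructor <;> linarith

lemma add_slope_mem (hh : 0 < h) (u : ℤ → ℝ) (j : ℤ) {lo hi : ℝ} (hu : ∀ i, u i ∈ Icc lo hi) :
    u j + h / 4 * slope h u j ∈ Icc lo hi := by
  have h1 := abs_mul_slope_le_right hh u j
  have h2 := mul_nonneg (mul_nonneg hh.le hh.le)
    (minmod_mul_right_nonneg ((u j - u (j - 1)) / h) ((u (j + 1) - u j) / h))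
  have e : h / 4 * slope h u j = 1 / 4 * (h * slope h u j) := by ring
  rw [e]
  refine add_quarter_mem (hu j) (hu (j + 1)) h1 (h2.trans_eq ?_)
  unfold slope; field_simp

lemma sub_slope_mem (hh : 0 < h) (u : ℤ → ℝ) (j : ℤ) {lo hi : ℝ} (hu : ∀ i, u i ∈ Icc lo hi) :
    u j - h / 4 * slope h u j ∈ Icc lo hi := by
  have h1 := abs_mul_slope_le_left hh u (j - 1)
  have h2 := mul_nonneg (mul_nonneg hh.le hh.le)
    (minmod_mul_left_nonneg ((u j - u (j - 1)) / h) ((u (j + 1) - u j) / h))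
  have e : u j - h / 4 * slope h u j = u j + 1 / 4 * -(h * slope h u j) := by ring
  rw [e]
  simp only [sub_add_cancel, diff] at h1
  refine add_quarter_mem (hu j) (hu (j - 1)) (by rwa [abs_neg, abs_sub_comm (u (j - 1))])
    (h2.trans_eq ?_)
  unfold slope; field_simp; ring

lemma tv_add_slope (hh : 0 < h) (u : ℤ → ℝ) {A : ℝ} (hu : TVLE u A) (c : ℝ) (hc : |c| ≤ 1 / 4) :
    TVLE (fun i => u i + c * (h * slope h u i)) (2 * A) := by
  refine TVLE.of_le (SumLE.const_mul hu zero_le_two) fun j => ?_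
  have h1 := abs_mul_slope_le_right hh u j
  have h2 := abs_mul_slope_le_left hh u j
  have e : diff (fun i => u i + c * (h * slope h u i)) j
      = diff u j + c * (h * slope h u (j + 1) - h * slope h u j) := by simp only [diff]; ring
  rw [e]
  refine (abs_add_le _ _).trans ?_
  rw [abs_mul]
  have h3 := (abs_sub (h * slope h u (j + 1)) (h * slope h u j)).trans (add_le_add h2 h1)
  have := mul_le_mul hc h3 (abs_nonneg _) (by norm_num)
  linarith [abs_nonneg (diff u j)]

end slope

/-! ### Averages with limited corrections diminish the variation -/

/-- If `w_j` is a convex combination of `u_j` and `u_{j+1}`, then the variation of `w` is at most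
that of `u`. -/
lemma tv_convex {u θ : ℤ → ℝ} {A : ℝ} (hu : TVLE u A) (hθ : ∀ j, |θ j| ≤ 1 / 2 * |diff u j|) :
    TVLE (fun j => (u j + u (j + 1)) / 2 + θ j) A := by
  -- `|w_{j+1} - w_j| ≤ a_j + b_{j+1}`, where `a_j + b_j = |u_{j+1} - u_j|`
  let σ : ℤ → ℝ := fun j => θ j * SignType.sign (diff u j)
  have hσ : ∀ j, |σ j| ≤ 1 / 2 * |diff u j| := fun j => by
    refine le_trans ?_ (hθ j)
    simp only [σ, abs_mul]
    refine mul_le_of_le_one_right (abs_nonneg _) ?_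
    rcases lt_trichotomy (diff u j) 0 with h | h | h <;> simp [h]
  let a : ℤ → ℝ := fun j => 1 / 2 * |diff u j| - σ j
  let b : ℤ → ℝ := fun j => 1 / 2 * |diff u j| + σ j
  have ha : ∀ j, 0 ≤ a j := fun j => by have := abs_le.1 (hσ j); simp only [a]; linarith
  have hb : ∀ j, 0 ≤ b j := fun j => by have := abs_le.1 (hσ j); simp only [b]; linarith
  have habs : ∀ j, |1 / 2 * diff u j - θ j| = a j ∧ |1 / 2 * diff u j + θ j| = b j := fun j => by
    have h1 := hθ j
    simp only [a, b, σ]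
    rcases lt_trichotomy (diff u j) 0 with h | h | h
    · rw [abs_of_neg h] at h1 ⊢
      have := abs_le.1 h1
      rw [abs_of_nonpos (by linarith), abs_of_nonpos (by linarith)]
      simp [h]; constructor <;> ring
    · have : θ j = 0 := by simpa [h] using h1
      simp [h, this]
    · rw [abs_of_pos h] at h1 ⊢
      have := abs_le.1 h1
      rw [abs_of_nonneg (by linarith), abs_of_nonneg (by linarith)]
      simp [h]
  refine ⟨fun j => abs_nonneg _, fun s => ?_⟩
  let t : Finset ℤ := s.map (Equiv.addRight 1).toEmbedding
  calc ∑ j ∈ s, |diff (fun j => (u j + u (j + 1)) / 2 + θ j) j|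
      ≤ ∑ j ∈ s, (a j + b (j + 1)) := Finset.sum_le_sum fun j _ => by
        have e : diff (fun j => (u j + u (j + 1)) / 2 + θ j) j
            = (1 / 2 * diff u j - θ j) + (1 / 2 * diff u (j + 1) + θ (j + 1)) := by
          simp only [diff]; ring
        rw [e, ← (habs j).1, ← (habs (j + 1)).2]
        exact abs_add_le _ _
    _ = ∑ j ∈ s, a j + ∑ j ∈ t, b j := by simp [Finset.sum_add_distrib, t, Finset.sum_map]
    _ ≤ ∑ j ∈ s ∪ t, a j + ∑ j ∈ s ∪ t, b j := by
        gcongr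
        · exact fun j _ _ => ha j
        · exact Finset.subset_union_left
        · exact fun j _ _ => hb j
        · exact Finset.subset_union_right
    _ = ∑ j ∈ s ∪ t, |diff u j| := by
        rw [← Finset.sum_add_distrib]
        exact Finset.sum_congr rfl fun j _ => by simp only [a, b]; ring
    _ ≤ A := hu.2 _

/-- A number that exceeds a bound by at most `e` is within `e` of a number satisfying it. -/
lemma exists_clamp {x d e : ℝ} (hd : 0 ≤ d) (he : 0 ≤ e) (hx : |x| ≤ d + e) :
    ∃ y, |y| ≤ d ∧ |x - y| ≤ e := by
  rw [abs_le] at hx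
  rcases le_total d x with h | h
  · exact ⟨d, by rw [abs_of_nonneg hd], abs_le.2 ⟨by linarith, by linarith⟩⟩
  rcases le_total x (-d) with h' | h'
  · exact ⟨-d, by rw [abs_neg, abs_of_nonneg hd], abs_le.2 ⟨by linarith, by linarith⟩⟩
  · exact ⟨x, abs_le.2 ⟨h', h⟩, by simpa using he⟩

/-- The variation of averages whose corrections satisfy the total variation condition up to a
summable error `e` and an additional term `E` of bounded variation. -/
lemma tv_perturbed {u θ e E : ℤ → ℝ} {A B G : ℝ} (hu : TVLE u A)
    (hθ : ∀ j, |θ j| ≤ 1 / 2 * |diff u j| + e j) (he : SumLE e B) (hE : TVLE E G) :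
    TVLE (fun j => (u j + u (j + 1)) / 2 + θ j + E j) (A + 2 * B + G) := by
  choose y hy hxy using fun j => exists_clamp (by positivity) (he.1 j) (hθ j)
  have h1 := tv_convex hu hy
  have h2 : TVLE (fun j => θ j - y j) (2 * B) :=
    TVLE.of_sumLE (he.mono (fun _ => abs_nonneg _) hxy)
  refine ((h1.add h2).add hE).mono (fun _ => abs_nonneg _) fun j => le_of_eq ?_
  congr 2; funext j; ring

/-- The range of averages with corrections as in `tv_perturbed`. -/
lemma mem_Icc_perturbed {u θ e E : ℤ → ℝ} {lo hi B : ℝ} (hu : ∀ j, u j ∈ Icc lo hi) (j : ℤ)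
    (hθ : |θ j| ≤ 1 / 2 * |diff u j| + e j) (hE : |E j| + e j ≤ B) :
    (u j + u (j + 1)) / 2 + θ j + E j ∈ Icc (lo - B) (hi + B) := by
  have h1 := hu j
  have h2 := hu (j + 1)
  have h3 := abs_le.1 hθ
  have h4 := abs_le.1 (le_refl |E j|)
  have hd : diff u j = u (j + 1) - u j := rfl
  simp only [mem_Icc] at *
  rcases abs_cases (diff u j) with ⟨h, _⟩ | ⟨h, _⟩ <;> rw [h] at h3 <;> constructor <;> linarith

end NT

namespace NT

/-! ### The quadrature rule -/

/-- The quadrature rule with the inner cells numbered from `0`. -/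
lemma quad_eq (h : ℝ) (n₁ n₂ : ℤ) (w : ℝ → ℝ) (a b c : ℤ → ℝ) (j : ℤ) :
    quad h n₁ n₂ w a b c j = h / 2 * a (j - n₁) * w (h / 4 - n₁ * h)
      + h * ∑ i ∈ Finset.range (n₁ + n₂ - 1).toNat,
          b (j - n₁ + 1 + i) * w (((i : ℝ) + 1 - n₁) * h)
      + h / 2 * c (j + n₂) * w (n₂ * h - h / 4) := by
  unfold quad
  congr 3
  refine (Finset.sum_nbij (fun i : ℕ => -n₁ + (i : ℤ)) ?_ ?_ ?_ ?_).symm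
  · intro i hi
    simp only [Finset.mem_range, Finset.mem_Icc] at *
    omega
  · intro i _ i' _ hii
    simpa using hii
  · intro l hl
    simp only [Finset.coe_Icc, mem_Icc, Finset.coe_range, mem_image, mem_Iio] at *
    exact ⟨(l + n₁).toNat, by omega, by omega⟩
  · intro i _
    have e : j - n₁ + 1 + (i : ℤ) = j + (-n₁ + i) + 1 := by ring
    rw [e]; push_cast; congr 2; ring

lemma quad_add (h : ℝ) (n₁ n₂ : ℤ) (w : ℝ → ℝ) (a b c a' b' c' : ℤ → ℝ) (j : ℤ) :
    quad h n₁ n₂ w (fun i => a i + a' i) (fun i => b i + b' i) (fun i => c i + c' i) j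
      = quad h n₁ n₂ w a b c j + quad h n₁ n₂ w a' b' c' j := by
  simp only [quad, add_mul, Finset.sum_add_distrib]; ring

lemma quad_const_mul (h : ℝ) (n₁ n₂ : ℤ) (w : ℝ → ℝ) (a b c : ℤ → ℝ) (r : ℝ) (j : ℤ) :
    quad h n₁ n₂ w (fun i => r * a i) (fun i => r * b i) (fun i => r * c i) j
      = r * quad h n₁ n₂ w a b c j := by
  simp only [quad, mul_assoc, ← Finset.mul_sum]; ring

lemma diff_quad (h : ℝ) (n₁ n₂ : ℤ) (w : ℝ → ℝ) (a b c : ℤ → ℝ) (j : ℤ) :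
    diff (quad h n₁ n₂ w a b c) j = quad h n₁ n₂ w (diff a) (diff b) (diff c) j := by
  simp only [quad, diff, sub_mul, mul_sub, Finset.sum_sub_distrib]
  have e1 : j + 1 - n₁ = j - n₁ + 1 := by ring
  have e2 : ∀ l, j + 1 + l + 1 = j + l + 1 + 1 := fun l => by ring
  have e3 : j + 1 + n₂ = j + n₂ + 1 := by ring
  simp only [e1, e2, e3]; ring

/-- The hypotheses on a weight and a step that the size estimates of quadrature rules use: `w` is
bounded by `K`, and the rule extends over an interval of length at most `K`. -/
structure QuadBound (h : ℝ) (n₁ n₂ : ℤ) (w : ℝ → ℝ) (K : ℝ) : Prop where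
  h_pos : 0 < h
  h_le : h ≤ 1
  one_le : 1 ≤ n₁ + n₂
  len_le : (n₁ + n₂) * h ≤ K
  w_le : ∀ x, |w x| ≤ K

/-- The hypotheses under which the difference of a quadrature rule is of the order of the step: in
addition, the weight is Lipschitz on the interval of the rule. (It may jump at the end points.) -/
structure QuadLip (h : ℝ) (n₁ n₂ : ℤ) (w : ℝ → ℝ) (K : ℝ) : Prop extends
    QuadBound h n₁ n₂ w K where
  w_lip : ∀ x ∈ Icc (-(n₁ * h)) (n₂ * h), ∀ y ∈ Icc (-(n₁ * h)) (n₂ * h),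
    |w x - w y| ≤ K * |x - y|

section quad

variable {h K : ℝ} {n₁ n₂ : ℤ} {w : ℝ → ℝ} {a b c : ℤ → ℝ}

lemma QuadBound.K_nonneg (q : QuadBound h n₁ n₂ w K) : 0 ≤ K := (abs_nonneg _).trans (q.w_le 0)

lemma QuadBound.card_le (q : QuadBound h n₁ n₂ w K) :
    h * ((n₁ + n₂ - 1).toNat : ℝ) ≤ K := by
  have h1 : (((n₁ + n₂ - 1).toNat : ℤ) : ℝ) = ((n₁ + n₂ - 1 : ℤ) : ℝ) := by
    rw [Int.toNat_of_nonneg (by linarith [q.one_le])]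
  push_cast at h1
  have := q.len_le
  have := q.h_pos
  rw [h1]; nlinarith

lemma QuadBound.abs_quad_le (q : QuadBound h n₁ n₂ w K) (a b c : ℤ → ℝ) (j : ℤ) :
    |quad h n₁ n₂ w a b c j| ≤ K * (h * (|a (j - n₁)|
      + ∑ i ∈ Finset.range (n₁ + n₂ - 1).toNat, |b (j - n₁ + 1 + i)| + |c (j + n₂)|)) := by
  have hh := q.h_pos
  have hK := q.K_nonneg
  rw [quad_eq]
  have h1 : |h / 2 * a (j - n₁) * w (h / 4 - n₁ * h)| ≤ K * (h * |a (j - n₁)|) := by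
    rw [abs_mul, abs_mul, abs_of_pos (by positivity : 0 < h / 2)]
    have := q.w_le (h / 4 - n₁ * h)
    have h2 : h / 2 * |a (j - n₁)| ≤ h * |a (j - n₁)| := by gcongr; linarith
    rw [mul_comm K]
    exact mul_le_mul h2 this (abs_nonneg _) (by positivity)
  have h2 : |h / 2 * c (j + n₂) * w (n₂ * h - h / 4)| ≤ K * (h * |c (j + n₂)|) := by
    rw [abs_mul, abs_mul, abs_of_pos (by positivity : 0 < h / 2)]
    have := q.w_le (n₂ * h - h / 4)
    have h2 : h / 2 * |c (j + n₂)| ≤ h * |c (j + n₂)| := by gcongr; linarith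
    rw [mul_comm K]
    exact mul_le_mul h2 this (abs_nonneg _) (by positivity)
  have h3 : |h * ∑ i ∈ Finset.range (n₁ + n₂ - 1).toNat,
          b (j - n₁ + 1 + i) * w (((i : ℝ) + 1 - n₁) * h)|
      ≤ K * (h * ∑ i ∈ Finset.range (n₁ + n₂ - 1).toNat, |b (j - n₁ + 1 + i)|) := by
    rw [abs_mul, abs_of_pos hh, mul_left_comm]
    gcongr
    rw [Finset.mul_sum]
    refine (Finset.abs_sum_le_sum_abs _ _).trans (Finset.sum_le_sum fun i _ => ?_)
    rw [abs_mul, mul_comm]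
    gcongr
    exact q.w_le _
  refine (abs_add_le _ _).trans ?_
  refine (add_le_add ((abs_add_le _ _).trans (add_le_add h1 h3)) h2).trans (le_of_eq ?_)
  ring

/-- The two boundary cells and the inner cells contribute `2h + (n₁ + n₂ - 1)h ≤ 2 + K`. -/
lemma QuadBound.sup (q : QuadBound h n₁ n₂ w K) {M : ℝ} (ha : ∀ j, |a j| ≤ M)
    (hb : ∀ j, |b j| ≤ M) (hc : ∀ j, |c j| ≤ M) (j : ℤ) :
    |quad h n₁ n₂ w a b c j| ≤ K * (2 + K) * M := by
  have hh := q.h_pos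
  have hK := q.K_nonneg
  have hM : 0 ≤ M := (abs_nonneg _).trans (ha 0)
  refine (q.abs_quad_le a b c j).trans ?_
  rw [mul_assoc]
  refine mul_le_mul_of_nonneg_left ?_ hK
  have h1 : ∑ i ∈ Finset.range (n₁ + n₂ - 1).toNat, |b (j - n₁ + 1 + i)|
      ≤ (n₁ + n₂ - 1).toNat * M := by
    simpa using Finset.sum_le_sum (s := Finset.range (n₁ + n₂ - 1).toNat)
      (fun i _ => hb (j - n₁ + 1 + i))
  calc h * (|a (j - n₁)| + ∑ i ∈ Finset.range (n₁ + n₂ - 1).toNat, |b (j - n₁ + 1 + i)|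
        + |c (j + n₂)|) ≤ h * (M + (n₁ + n₂ - 1).toNat * M + M) := by
        gcongr
        · exact ha _
        · exact hc _
    _ = (2 * h + h * (n₁ + n₂ - 1).toNat) * M := by ring
    _ ≤ (2 + K) * M := by
        have := q.card_le
        have := q.h_le
        gcongr; linarith

lemma QuadBound.sumLE (q : QuadBound h n₁ n₂ w K) {A : ℝ} (ha : SumLE (fun j => |a j|) A)
    (hb : SumLE (fun j => |b j|) A) (hc : SumLE (fun j => |c j|) A) :
    SumLE (fun j => |quad h n₁ n₂ w a b c j|) (K * (2 + K) * A) := by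
  have hh := q.h_pos
  have hK := q.K_nonneg
  have h1 : SumLE (fun j => ∑ i ∈ Finset.range (n₁ + n₂ - 1).toNat, |b (j - n₁ + 1 + i)|)
      ((n₁ + n₂ - 1).toNat * A) := by
    have := SumLE.sum_const (Finset.range (n₁ + n₂ - 1).toNat)
      (f := fun (i : ℕ) j => |b (j - n₁ + 1 + i)|) (K := A) fun i _ => by
        refine (hb.shift (-n₁ + 1 + i)).mono (fun _ => abs_nonneg _) fun j => ?_
        have e : j + (-n₁ + 1 + (i : ℤ)) = j - n₁ + 1 + i := by ring
        simp only [e, le_refl]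
    simpa using this
  have h2 := (((ha.shift (-n₁)).add h1).add (hc.shift n₂)).const_mul hh.le |>.const_mul hK
  refine (h2.mono (fun _ => abs_nonneg _) (q.abs_quad_le a b c)).weaken ?_
  rw [mul_assoc]
  refine mul_le_mul_of_nonneg_left ?_ hK
  have hA := ha.nonneg
  calc h * (A + (n₁ + n₂ - 1).toNat * A + A) = (2 * h + h * (n₁ + n₂ - 1).toNat) * A := by ring
    _ ≤ (2 + K) * A := by
        have := q.card_le
        have := q.h_le
        gcongr; linarith

lemma QuadBound.tv (q : QuadBound h n₁ n₂ w K) {A : ℝ} (ha : TVLE a A) (hb : TVLE b A)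
    (hc : TVLE c A) : TVLE (quad h n₁ n₂ w a b c) (K * (2 + K) * A) := by
  unfold TVLE
  simp only [diff_quad]
  exact q.sumLE ha hb hc

/-- A quadrature rule applied to a summable sequence is of the order of the step. -/
lemma QuadBound.abs_quad_le_of_sumLE (q : QuadBound h n₁ n₂ w K) {A : ℝ}
    (hb : SumLE (fun j => |b j|) A) (j : ℤ) :
    |quad h n₁ n₂ w b b b j| ≤ 3 * K * A * h := by
  have hh := q.h_pos
  have hK := q.K_nonneg
  refine (q.abs_quad_le b b b j).trans ?_
  have h1 : ∑ i ∈ Finset.range (n₁ + n₂ - 1).toNat, |b (j - n₁ + 1 + i)| ≤ A := by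
    have := hb.2 ((Finset.range (n₁ + n₂ - 1).toNat).map
      ⟨fun i : ℕ => j - n₁ + 1 + (i : ℤ), fun x y hxy => by simpa using hxy⟩)
    rwa [Finset.sum_map] at this
  calc _ ≤ K * (h * (A + A + A)) := by
        gcongr
        · exact hb.le _
        · exact hb.le _
    _ = 3 * K * A * h := by ring

lemma sum_range_diff_mul (β w : ℕ → ℝ) (n : ℕ) :
    ∑ i ∈ Finset.range n, (β (i + 1) - β i) * w i
      = β n * w n - β 0 * w 0 - ∑ i ∈ Finset.range n, β (i + 1) * (w (i + 1) - w i) := by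
  induction n with
  | zero => simp
  | succ n ih => rw [Finset.sum_range_succ, ih, Finset.sum_range_succ]; ring

/-- Summation by parts puts the inner differences on the Lipschitz weight, so that the difference of
a quadrature rule gains a factor `h`. -/
lemma QuadLip.abs_diff_quad_le (q : QuadLip h n₁ n₂ w K) (a b c : ℤ → ℝ) (j : ℤ) :
    |diff (quad h n₁ n₂ w a b c) j| ≤ K * (h * (|a (j - n₁ + 1)| + |a (j - n₁)|
      + (|b (j + n₂)| + |b (j - n₁ + 1)|
        + h * ∑ i ∈ Finset.range (n₁ + n₂ - 1).toNat, |b (j - n₁ + 2 + i)|)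
      + (|c (j + n₂ + 1)| + |c (j + n₂)|))) := by
  have hh := q.h_pos
  have hK := q.K_nonneg
  rw [diff_quad, quad_eq]
  have key : ∀ (d : ℤ → ℝ) (i : ℤ) (x : ℝ), |h / 2 * diff d i * w x|
      ≤ K * (h * (|d (i + 1)| + |d i|)) := fun d i x => by
    rw [abs_mul, abs_mul, abs_of_pos (by positivity : 0 < h / 2), mul_comm K]
    have h1 := q.w_le x
    have h2 : |diff d i| ≤ |d (i + 1)| + |d i| := abs_sub _ _
    have h3 : h / 2 * |diff d i| ≤ h * (|d (i + 1)| + |d i|) :=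
      mul_le_mul (by linarith) h2 (abs_nonneg _) hh.le
    exact mul_le_mul h3 h1 (abs_nonneg _) (by positivity)
  set n := (n₁ + n₂ - 1).toNat with hn
  have hnz : (n : ℤ) = n₁ + n₂ - 1 := Int.toNat_of_nonneg (by linarith [q.one_le])
  have hnr : (n : ℝ) = n₁ + n₂ - 1 := by exact_mod_cast congrArg (Int.cast (R := ℝ)) hnz
  have h3 : |h * ∑ i ∈ Finset.range n, diff b (j - n₁ + 1 + i) * w (((i : ℝ) + 1 - n₁) * h)|
      ≤ K * (h * (|b (j + n₂)| + |b (j - n₁ + 1)|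
        + h * ∑ i ∈ Finset.range n, |b (j - n₁ + 2 + i)|)) := by
    rw [abs_mul, abs_of_pos hh, mul_left_comm]
    gcongr
    have := sum_range_diff_mul (fun i : ℕ => b (j - n₁ + 1 + i))
      (fun i : ℕ => w (((i : ℝ) + 1 - n₁) * h)) n
    have e : ∀ i : ℕ, diff b (j - n₁ + 1 + i)
        = b (j - n₁ + 1 + ((i + 1 : ℕ) : ℤ)) - b (j - n₁ + 1 + i) := fun i => by
      simp only [diff]; push_cast; rw [add_assoc _ (i : ℤ) 1]
    simp only [e]
    rw [this, show j - n₁ + 1 + (n : ℤ) = j + n₂ by rw [hnz]; ring]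
    have s1 : |b (j + n₂) * w (((n : ℝ) + 1 - n₁) * h)| ≤ K * |b (j + n₂)| := by
      rw [abs_mul, mul_comm]; gcongr; exact q.w_le _
    have s2 : |b (j - n₁ + 1 + ((0 : ℕ) : ℤ)) * w (((0 : ℕ) + 1 - (n₁ : ℝ)) * h)|
        ≤ K * |b (j - n₁ + 1)| := by
      rw [abs_mul, mul_comm]; simp only [Nat.cast_zero, add_zero]
      gcongr; exact q.w_le _
    have s3 : |∑ i ∈ Finset.range n, b (j - n₁ + 1 + ((i + 1 : ℕ) : ℤ))
          * (w ((((i + 1 : ℕ) : ℝ) + 1 - n₁) * h) - w (((i : ℝ) + 1 - n₁) * h))|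
        ≤ K * (h * ∑ i ∈ Finset.range n, |b (j - n₁ + 2 + i)|) := by
      rw [Finset.mul_sum, Finset.mul_sum]
      refine (Finset.abs_sum_le_sum_abs _ _).trans (Finset.sum_le_sum fun i hi => ?_)
      have hi' : (i : ℝ) + 1 ≤ n := by exact_mod_cast Finset.mem_range.1 hi
      have hi0 : (0 : ℝ) ≤ i := Nat.cast_nonneg i
      have e1 : j - n₁ + 1 + ((i + 1 : ℕ) : ℤ) = j - n₁ + 2 + i := by push_cast; ring
      have hw : |w ((((i + 1 : ℕ) : ℝ) + 1 - n₁) * h) - w (((i : ℝ) + 1 - n₁) * h)| ≤ K * h := by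
        refine (q.w_lip _ ⟨?_, ?_⟩ _ ⟨?_, ?_⟩).trans_eq ?_
        · push_cast; nlinarith
        · push_cast; refine mul_le_mul_of_nonneg_right ?_ hh.le; linarith
        · nlinarith
        · refine mul_le_mul_of_nonneg_right ?_ hh.le; linarith
        · congr 1; rw [abs_of_nonneg (by push_cast; nlinarith)]; push_cast; ring
      rw [e1, abs_mul]
      calc _ ≤ |b (j - n₁ + 2 + i)| * (K * h) := by gcongr
        _ = _ := by ring
    refine (abs_sub _ _).trans ((add_le_add ((abs_sub _ _).trans (add_le_add s1 s2)) s3).trans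
      (le_of_eq ?_))
    ring
  refine (abs_add_le _ _).trans ?_
  refine (add_le_add ((abs_add_le _ _).trans (add_le_add (key a _ _) h3)) (key c _ _)).trans
    (le_of_eq ?_)
  ring

lemma QuadLip.diff_sup (q : QuadLip h n₁ n₂ w K) {M : ℝ} (ha : ∀ j, |a j| ≤ M)
    (hb : ∀ j, |b j| ≤ M) (hc : ∀ j, |c j| ≤ M) (j : ℤ) :
    |diff (quad h n₁ n₂ w a b c) j| ≤ K * (6 + K) * M * h := by
  have hh := q.h_pos
  have hK := q.K_nonneg
  have hM : 0 ≤ M := (abs_nonneg _).trans (ha 0)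
  refine (q.abs_diff_quad_le a b c j).trans ?_
  have h1 : h * ∑ i ∈ Finset.range (n₁ + n₂ - 1).toNat, |b (j - n₁ + 2 + i)| ≤ K * M := by
    have := Finset.sum_le_sum (s := Finset.range (n₁ + n₂ - 1).toNat)
      (fun i _ => hb (j - n₁ + 2 + i))
    simp only [Finset.sum_const, Finset.card_range, nsmul_eq_mul] at this
    calc _ ≤ h * ((n₁ + n₂ - 1).toNat * M) := by gcongr
      _ = h * ((n₁ + n₂ - 1).toNat) * M := by ring
      _ ≤ K * M := by gcongr; exact q.card_le
  calc _ ≤ K * (h * (M + M + (M + M + K * M) + (M + M))) := by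
        gcongr <;> first | exact ha _ | exact hb _ | exact hc _
    _ = _ := by ring

lemma QuadLip.diff_tv (q : QuadLip h n₁ n₂ w K) {A : ℝ} (ha : TVLE a A) (hb : TVLE b A)
    (hc : TVLE c A) : TVLE (diff (quad h n₁ n₂ w a b c)) (K * (6 + K) * A * h) := by
  have hh := q.h_pos
  have hK := q.K_nonneg
  have hA := ha.nonneg
  have h1 : SumLE (fun j => ∑ i ∈ Finset.range (n₁ + n₂ - 1).toNat, |diff b (j - n₁ + 2 + i)|)
      ((n₁ + n₂ - 1).toNat * A) := by
    have := SumLE.sum_const (Finset.range (n₁ + n₂ - 1).toNat)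
      (f := fun (i : ℕ) j => |diff b (j - n₁ + 2 + i)|) (K := A) fun i _ => by
        refine (SumLE.shift hb (-n₁ + 2 + i)).mono (fun _ => abs_nonneg _) fun j => ?_
        have e : j + (-n₁ + 2 + (i : ℤ)) = j - n₁ + 2 + i := by ring
        simp only [e, le_refl]
    simpa using this
  have e1 : ∀ j, j + (-n₁ + 1) = j - n₁ + 1 := fun j => by ring
  have e2 : ∀ j, j + -n₁ = j - n₁ := fun j => by ring
  have e3 : ∀ j, j + (n₂ + 1) = j + n₂ + 1 := fun j => by ring
  have ha1 := SumLE.shift ha (-n₁ + 1)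
  have ha2 := SumLE.shift ha (-n₁)
  have hb1 := SumLE.shift hb n₂
  have hb2 := SumLE.shift hb (-n₁ + 1)
  have hc1 := SumLE.shift hc (n₂ + 1)
  have hc2 := SumLE.shift hc n₂
  simp only [e1, e2, e3] at ha1 ha2 hb1 hb2 hc1 hc2
  have H := (((ha1.add ha2).add ((hb1.add hb2).add (h1.const_mul hh.le))).add
    (hc1.add hc2)).const_mul hh.le |>.const_mul hK
  refine SumLE.weaken (TVLE.of_le H fun j => ?_) ?_
  · have : diff (diff (quad h n₁ n₂ w a b c)) j
        = diff (quad h n₁ n₂ w (diff a) (diff b) (diff c)) j := by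
      conv_lhs => rw [diff, diff_quad, diff_quad]
      rfl
    rw [this]
    exact q.abs_diff_quad_le _ _ _ j
  · have : h * ((n₁ + n₂ - 1).toNat * A) ≤ K * A := by
      rw [← mul_assoc]; gcongr; exact q.card_le
    calc _ ≤ K * (h * (A + A + (A + A + K * A) + (A + A))) := by gcongr
      _ = _ := by ring

/-- For a nonnegative weight, the values of a quadrature rule lie between multiples of its total
mass. -/
lemma quad_mem (hh : 0 < h) (hw : ∀ x, 0 ≤ w x) {lo hi : ℝ} (ha : ∀ j, a j ∈ Icc lo hi)
    (hb : ∀ j, b j ∈ Icc lo hi) (hc : ∀ j, c j ∈ Icc lo hi) (j : ℤ) :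
    quad h n₁ n₂ w a b c j ∈ Icc (lo * quad h n₁ n₂ w 1 1 1 0) (hi * quad h n₁ n₂ w 1 1 1 0) := by
  have e : ∀ r : ℝ, r * quad h n₁ n₂ w 1 1 1 0
      = quad h n₁ n₂ w (fun _ => r) (fun _ => r) (fun _ => r) j := fun r => by
    simp only [quad, Pi.one_apply, one_mul, mul_one, ← Finset.mul_sum]; ring
  rw [e, e]
  unfold quad
  constructor
  · gcongr
    · exact hw _
    · exact (ha _).1
    · exact hw _
    · exact (hb _).1
    · exact hw _
    · exact (hc _).1
  · gcongr
    · exact hw _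
    · exact (ha _).2
    · exact hw _
    · exact (hb _).2
    · exact hw _
    · exact (hc _).2

end quad

end NT

namespace NT

/-! ### Quantitative form of the assumptions -/

/-- A `C²` function on a compact convex set with interior: bounds in the interior for the first
derivative, its Lipschitz constant, and second differences. -/
lemma eventually_C2_bounds {E : Type*} [NormedAddCommGroup E] [NormedSpace ℝ E] {s : Set E}
    (hs : Convex ℝ s) (hc : IsCompact s) (hi : (interior s).Nonempty) {f : E → ℝ}
    (hf : ContDiffOn ℝ 2 f s) :
    ∀ᶠ K : ℝ in atTop, (∀ x ∈ s, ∀ y ∈ s, |f x - f y| ≤ K * ‖x - y‖) ∧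
      (∀ x ∈ interior s, ‖fderiv ℝ f x‖ ≤ K) ∧
      (∀ x ∈ interior s, ∀ y ∈ interior s, ‖fderiv ℝ f x - fderiv ℝ f y‖ ≤ K * ‖x - y‖) ∧
      (∀ x ∈ s, ∀ y ∈ s, ∀ z ∈ s, |(f z - f y) - (f y - f x)|
        ≤ K * (‖(z - y) - (y - x)‖ + (‖z - y‖ * ‖z - y‖ + ‖y - x‖ * ‖y - x‖))) := by
  have hu : UniqueDiffOn ℝ s := uniqueDiffOn_convex hs hi
  have hd : DifferentiableOn ℝ f s := hf.differentiableOn (by norm_num)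
  have hf1 : ContDiffOn ℝ 1 (fderivWithin ℝ f s) s := hf.fderivWithin hu (by norm_num)
  have hd1 : DifferentiableOn ℝ (fderivWithin ℝ f s) s := hf1.differentiableOn (by norm_num)
  have hf2 : ContinuousOn (fderivWithin ℝ (fderivWithin ℝ f s) s) s :=
    hf1.continuousOn_fderivWithin hu (by norm_num)
  obtain ⟨C1, hC1⟩ := hc.exists_bound_of_continuousOn hf1.continuousOn
  obtain ⟨C2, hC2⟩ := hc.exists_bound_of_continuousOn
    (f := fderivWithin ℝ (fderivWithin ℝ f s) s) hf2
  have hfw : ∀ x ∈ interior s, fderivWithin ℝ f s x = fderiv ℝ f x := fun x hx =>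
    fderivWithin_of_mem_nhds (mem_interior_iff_mem_nhds.1 hx)
  have l2 : ∀ x ∈ s, ∀ y ∈ s, ‖fderivWithin ℝ f s x - fderivWithin ℝ f s y‖ ≤ C2 * ‖x - y‖ :=
    fun x hx y hy => hs.norm_image_sub_le_of_norm_fderivWithin_le hd1 hC2 hy hx
  filter_upwards [eventually_ge_atTop C1, eventually_ge_atTop C2, eventually_ge_atTop 0]
    with K h1 h2 h0
  -- the first order Taylor formula with quadratic remainder
  have taylor : ∀ y ∈ s, ∀ z ∈ s,
      |f z - f y - fderivWithin ℝ f s y (z - y)| ≤ K * (‖z - y‖ * ‖z - y‖) := fun y hy z hz => by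
    have hseg : segment ℝ y z ⊆ s := hs.segment_subset hy hz
    have := (convex_segment y z).norm_image_sub_le_of_norm_hasFDerivWithin_le'
      (f := f) (f' := fderivWithin ℝ f s) (φ := fderivWithin ℝ f s y) (C := K * ‖z - y‖)
      (fun x hx => ((hd x (hseg hx)).hasFDerivWithinAt).mono hseg) (fun x hx => by
        refine (l2 x (hseg hx) y hy).trans ?_
        have : ‖x - y‖ ≤ ‖z - y‖ := by
          obtain ⟨t, ht, rfl⟩ := (segment_eq_image' ℝ y z) ▸ hx
          simp only [add_sub_cancel_left, norm_smul]
          exact mul_le_of_le_one_left (norm_nonneg _) (by rw [Real.norm_of_nonneg ht.1]; exact ht.2)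
        exact mul_le_mul h2 this (norm_nonneg _) h0)
      (left_mem_segment ℝ y z) (right_mem_segment ℝ y z)
    rwa [Real.norm_eq_abs, mul_assoc] at this
  refine ⟨fun x hx y hy => ?_, fun x hx => ?_, fun x hx y hy => ?_, fun x hx y hy z hz => ?_⟩
  · exact hs.norm_image_sub_le_of_norm_fderivWithin_le hd (fun x hx => (hC1 x hx).trans h1) hy hx
  · rw [← hfw x hx]; exact (hC1 x (interior_subset hx)).trans h1
  · rw [← hfw x hx, ← hfw y hy]
    exact (l2 x (interior_subset hx) y (interior_subset hy)).trans (by gcongr)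
  · have e : (f z - f y) - (f y - f x) = fderivWithin ℝ f s y ((z - y) - (y - x))
        + ((f z - f y - fderivWithin ℝ f s y (z - y))
          + (f x - f y - fderivWithin ℝ f s y (x - y))) := by
      simp only [map_sub]; ring
    rw [e, mul_add K, mul_add K]
    refine (abs_add_le _ _).trans (add_le_add ?_ ((abs_add_le _ _).trans (add_le_add
      (taylor y hy z hz) ((taylor y hy x hx).trans_eq (by rw [norm_sub_rev])))))
    exact (ContinuousLinearMap.le_opNorm (fderivWithin ℝ f s y) _).trans
      (mul_le_mul_of_nonneg_right ((hC1 y hy).trans h1) (norm_nonneg _))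

/-- The interior of the range of nonlocal terms. -/
def nonlocalInterior (N m : ℕ) (ρM : ℝ) : Set (Fin m → ℝ) :=
  {R | ∀ ℓ, R ℓ ∈ Ioo (-(ρM / 8)) (N * ρM + ρM / 8)}

lemma nonlocalInterior_subset (N m : ℕ) (ρM : ℝ) :
    nonlocalInterior N m ρM ⊆ nonlocalRange N m ρM := fun _ hR ℓ => Ioo_subset_Icc_self (hR ℓ)

lemma nonlocalRange_eq (N m : ℕ) (ρM : ℝ) : nonlocalRange N m ρM
    = Icc (fun _ => -(ρM / 8)) (fun _ => N * ρM + ρM / 8) := by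
  ext R; simp [nonlocalRange, Pi.le_def, forall_and]

lemma isOpen_nonlocalInterior (N m : ℕ) (ρM : ℝ) : IsOpen (nonlocalInterior N m ρM) := by
  have : nonlocalInterior N m ρM
      = univ.pi fun _ => Ioo (-(ρM / 8)) (N * ρM + ρM / 8) := by
    ext R; simp [nonlocalInterior]
  rw [this]; exact isOpen_set_pi finite_univ fun _ _ => isOpen_Ioo

lemma norm_le_sum_abs {m : ℕ} (x : Fin m → ℝ) : ‖x‖ ≤ ∑ ℓ, |x ℓ| := by
  rw [pi_norm_le_iff_of_nonneg (Finset.sum_nonneg fun _ _ => abs_nonneg _)]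
  exact fun ℓ => Finset.single_le_sum (f := fun ℓ => |x ℓ|) (fun _ _ => abs_nonneg _)
    (Finset.mem_univ ℓ)

namespace Data

variable {N m : ℕ} (D : Data N m)

/-- All bounds and Lipschitz constants that the estimates use, with one constant `K`; only the
Lipschitz constant `LF` of the flux, on which the CFL condition depends, is kept apart. -/
structure Bounds (ρM LF K : ℝ) : Prop where
  one_le : 1 ≤ K
  ρM_pos : 0 < ρM
  ρM_le : ρM ≤ K
  LF_nonneg : 0 ≤ LF
  F_lip : ∀ k, ∀ r ∈ densityRange ρM, ∀ r' ∈ densityRange ρM,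
    ∀ R ∈ nonlocalRange N m ρM, ∀ R' ∈ nonlocalRange N m ρM,
      |D.F k r R - D.F k r' R'| ≤ LF * (|r - r'| + ∑ ℓ, |R ℓ - R' ℓ|)
  g_le : ∀ k, ∀ r ∈ densityRange ρM, |D.g k r| ≤ K
  g_lip : ∀ k, ∀ r ∈ densityRange ρM, ∀ r' ∈ densityRange ρM,
    |D.g k r - D.g k r'| ≤ K * |r - r'|
  V_lip : ∀ k, ∀ R ∈ nonlocalRange N m ρM, ∀ R' ∈ nonlocalRange N m ρM,
    |D.V k R - D.V k R'| ≤ K * ∑ ℓ, |R ℓ - R' ℓ|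
  dV_le : ∀ k, ∀ R ∈ nonlocalInterior N m ρM, ∀ ℓ, |fderiv ℝ (D.V k) R (Pi.single ℓ 1)| ≤ K
  dV_lip : ∀ k, ∀ R ∈ nonlocalInterior N m ρM, ∀ R' ∈ nonlocalInterior N m ρM, ∀ ℓ,
    |fderiv ℝ (D.V k) R (Pi.single ℓ 1) - fderiv ℝ (D.V k) R' (Pi.single ℓ 1)|
      ≤ K * ∑ i, |R i - R' i|
  V_second : ∀ k, ∀ R ∈ nonlocalRange N m ρM, ∀ R' ∈ nonlocalRange N m ρM,
    ∀ R'' ∈ nonlocalRange N m ρM,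
    |(D.V k R'' - D.V k R') - (D.V k R' - D.V k R)|
      ≤ K * (∑ ℓ, |(R'' ℓ - R' ℓ) - (R' ℓ - R ℓ)|
        + ((∑ ℓ, |R'' ℓ - R' ℓ|) * (∑ ℓ, |R'' ℓ - R' ℓ|)
          + (∑ ℓ, |R' ℓ - R ℓ|) * (∑ ℓ, |R' ℓ - R ℓ|)))
  S_le : ∀ k, ∀ u : Fin N → ℝ, (∀ i, u i ∈ densityRange ρM) → ∀ R ∈ nonlocalRange N m ρM,
    |D.S k u R| ≤ K
  S_lip : ∀ k, ∀ u u' : Fin N → ℝ,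
    (∀ i, u i ∈ densityRange ρM) → (∀ i, u' i ∈ densityRange ρM) →
    ∀ R ∈ nonlocalRange N m ρM, ∀ R' ∈ nonlocalRange N m ρM,
      |D.S k u R - D.S k u' R'| ≤ K * (∑ i, |u i - u' i| + ∑ ℓ, |R ℓ - R' ℓ|)
  ω_nonneg : ∀ ℓ k x, 0 ≤ D.ω ℓ k x
  ω_le : ∀ ℓ k x, |D.ω ℓ k x| ≤ K
  dω_le : ∀ ℓ k x, |D.dω ℓ k x| ≤ K
  ω_lip : ∀ ℓ k, ∀ x ∈ Icc (D.η₁ ℓ k) (D.η₂ ℓ k), ∀ y ∈ Icc (D.η₁ ℓ k) (D.η₂ ℓ k),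
    |D.ω ℓ k x - D.ω ℓ k y| ≤ K * |x - y|
  η₁_nonpos : ∀ ℓ k, D.η₁ ℓ k ≤ 0
  η_lt : ∀ ℓ k, D.η₁ ℓ k < D.η₂ ℓ k
  len_le : ∀ ℓ k, D.η₂ ℓ k - D.η₁ ℓ k ≤ K

lemma zero_mem_densityRange {ρM : ℝ} (h : 0 < ρM) : (0 : ℝ) ∈ densityRange ρM :=
  ⟨by linarith, by linarith⟩

lemma zero_mem_nonlocalInterior {ρM : ℝ} (h : 0 < ρM) :
    (0 : Fin m → ℝ) ∈ nonlocalInterior N m ρM := fun ℓ => by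
  have : (0 : ℝ) ≤ N * ρM := by positivity
  constructor <;> simp only [Pi.zero_apply] <;> linarith

lemma abs_le_of_mem_densityRange {ρM r : ℝ} (h : 0 < ρM) (hr : r ∈ densityRange ρM) :
    |r| ≤ 2 * ρM := abs_le.2 ⟨by linarith [hr.1], by linarith [hr.2]⟩

lemma Assumption.η_lt {D : Data N m} {ρM LF : ℝ} (hD : D.Assumption ρM LF) (ℓ : Fin m)
    (k : Fin N) : D.η₁ ℓ k < D.η₂ ℓ k :=
  lt_of_le_of_ne ((hD.η₁_nonpos ℓ k).trans (hD.η₂_nonneg ℓ k)) (hD.η_ne ℓ k)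

lemma ω_eq_zero {D : Data N m} {ρM LF : ℝ} (hD : D.Assumption ρM LF) (ℓ : Fin m)
    (k : Fin N) {x : ℝ} (hx : x ∉ Icc (D.η₁ ℓ k) (D.η₂ ℓ k)) : D.ω ℓ k x = 0 := by
  rw [← hD.ω_support] at hx; exact image_eq_zero_of_notMem_tsupport hx

/-- The constants exist because the ranges and the supports are compact. For
`N = 0` the assumptions allow a negative `LF`, hence the maximum. -/
theorem exists_bounds {ρM LF : ℝ} (hD : D.Assumption ρM LF) :
    ∃ K, D.Bounds ρM (max LF 0) K := by
  have hρ := hD.ρM_pos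
  have hZ := zero_mem_nonlocalInterior (N := N) (m := m) hρ
  have hint : nonlocalInterior N m ρM ⊆ interior (nonlocalRange N m ρM) :=
    interior_maximal (nonlocalInterior_subset N m ρM) (isOpen_nonlocalInterior N m ρM)
  have hconv : Convex ℝ (nonlocalRange N m ρM) := by
    rw [nonlocalRange_eq]; exact convex_Icc _ _
  have hcomp : IsCompact (nonlocalRange N m ρM) := by
    rw [nonlocalRange_eq]; exact isCompact_Icc
  have E1 : ∀ᶠ K : ℝ in atTop, ∀ k, (∀ r ∈ densityRange ρM, |D.g k r| ≤ K) ∧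
      (∀ r ∈ densityRange ρM, ∀ r' ∈ densityRange ρM, |D.g k r - D.g k r'| ≤ K * |r - r'|) := by
    rw [eventually_all]; intro k
    obtain ⟨Lg, hLg⟩ := hD.g_lip k
    filter_upwards [eventually_ge_atTop Lg,
      eventually_ge_atTop (|D.g k 0| + |Lg| * (2 * ρM))] with K h1 h2
    refine ⟨fun r hr => ?_, fun r hr r' hr' => (hLg r hr r' hr').trans (by gcongr)⟩
    have h3 := hLg r hr 0 (zero_mem_densityRange hρ)
    have h4 := abs_sub_abs_le_abs_sub (D.g k r) (D.g k 0)
    have h5 : Lg * |r - 0| ≤ |Lg| * (2 * ρM) := by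
      rw [sub_zero]
      exact mul_le_mul (le_abs_self _) (abs_le_of_mem_densityRange hρ hr) (abs_nonneg _)
        (abs_nonneg _)
    linarith
  have E2 := eventually_all.2 fun k =>
    eventually_C2_bounds hconv hcomp ⟨0, hint hZ⟩ (hD.V_C2 k)
  have E3 : ∀ᶠ K : ℝ in atTop, ∀ k, ∀ u : Fin N → ℝ, (∀ i, u i ∈ densityRange ρM) →
      ∀ R ∈ nonlocalRange N m ρM, |D.S k u R| ≤ K := by
    rw [eventually_all]; intro k
    obtain ⟨LS, hLS⟩ := hD.S_lip
    filter_upwards [eventually_ge_atTop (|LS| * (N * (2 * ρM)))] with K h1 u hu R hR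
    have h3 := hLS k u 0 hu (fun _ => zero_mem_densityRange hρ) R hR R hR
    rw [hD.S_zero, sub_zero] at h3
    simp only [Pi.zero_apply, sub_zero, sub_self, abs_zero, Finset.sum_const_zero, add_zero] at h3
    refine (h3.trans ?_).trans h1
    refine mul_le_mul (le_abs_self _) ?_ (Finset.sum_nonneg fun _ _ => abs_nonneg _)
      (abs_nonneg _)
    simpa using Finset.sum_le_sum fun i (_ : i ∈ Finset.univ) =>
      abs_le_of_mem_densityRange hρ (hu i)
  have E4 : ∀ᶠ K : ℝ in atTop, ∀ ℓ k, (∀ x, |D.ω ℓ k x| ≤ K) ∧ (∀ x, |D.dω ℓ k x| ≤ K) ∧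
      (∀ x ∈ Icc (D.η₁ ℓ k) (D.η₂ ℓ k), ∀ y ∈ Icc (D.η₁ ℓ k) (D.η₂ ℓ k),
        |D.ω ℓ k x - D.ω ℓ k y| ≤ K * |x - y|) ∧ D.η₂ ℓ k - D.η₁ ℓ k ≤ K := by
    simp only [eventually_all]; intro ℓ k
    have hu := uniqueDiffOn_Icc (hD.η_lt ℓ k)
    obtain ⟨C1, hC1⟩ := isCompact_Icc.exists_bound_of_continuousOn (hD.ω_C1 ℓ k).continuousOn
    obtain ⟨C2, hC2⟩ := isCompact_Icc.exists_bound_of_continuousOn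
      ((hD.ω_C1 ℓ k).continuousOn_derivWithin hu le_rfl)
    filter_upwards [eventually_ge_atTop C1, eventually_ge_atTop C2, eventually_ge_atTop 0,
      eventually_ge_atTop (D.η₂ ℓ k - D.η₁ ℓ k)] with K h1 h2 h0 h4
    refine ⟨fun x => ?_, fun x => ?_, fun x hx y hy => ?_, h4⟩
    · by_cases hx : x ∈ Icc (D.η₁ ℓ k) (D.η₂ ℓ k)
      · exact (hC1 x hx).trans h1
      · rw [ω_eq_zero hD ℓ k hx]; simpa using h0
    · by_cases hx : x ∈ Icc (D.η₁ ℓ k) (D.η₂ ℓ k)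
      · exact (hC2 x hx).trans h2
      · rw [dω, derivWithin_zero_of_notMem_closure (by rwa [isClosed_Icc.closure_eq])]
        simpa using h0
    · have := (convex_Icc _ _).norm_image_sub_le_of_norm_derivWithin_le
        ((hD.ω_C1 ℓ k).differentiableOn (by norm_num)) (fun z hz => (hC2 z hz).trans h2) hy hx
      exact this
  obtain ⟨LS, hLS⟩ := hD.S_lip
  obtain ⟨K, h1, h2, h3, h4, h5, h6, h7⟩ := (E1.and <| E2.and <| E3.and <| E4.and <|
    (eventually_ge_atTop LS).and <| (eventually_ge_atTop (1 : ℝ)).and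
    (eventually_ge_atTop ρM)).exists
  have hK : (0 : ℝ) ≤ K := by linarith
  have single_le : ∀ ℓ : Fin m, ‖(Pi.single ℓ 1 : Fin m → ℝ)‖ ≤ 1 := fun ℓ => by
    rw [pi_norm_le_iff_of_nonneg zero_le_one]
    intro i
    by_cases h : i = ℓ
    · subst h; simp
    · simp [h]
  refine ⟨K, h6, hρ, h7, le_max_right _ _, ?_, fun k => (h1 k).1, fun k => (h1 k).2,
    ?_, ?_, ?_, ?_, h3, ?_, hD.ω_nonneg, fun ℓ k => (h4 ℓ k).1, fun ℓ k => (h4 ℓ k).2.1,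
    fun ℓ k => (h4 ℓ k).2.2.1, hD.η₁_nonpos, hD.η_lt, fun ℓ k => (h4 ℓ k).2.2.2⟩
  · intro k r hr r' hr' R hR R' hR'
    refine (hD.F_lip k r hr r' hr' R hR R' hR').trans ?_
    gcongr
    exact le_max_left _ _
  · intro k R hR R' hR'
    refine ((h2 k).1 R hR R' hR').trans ?_
    gcongr; exact norm_le_sum_abs (R - R')
  · intro k R hR ℓ
    refine (ContinuousLinearMap.le_opNorm (fderiv ℝ (D.V k) R) (Pi.single ℓ 1)).trans ?_
    calc _ ≤ K * 1 := by gcongr; exacts [(h2 k).2.1 R (hint hR), single_le ℓ]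
      _ = K := mul_one _
  · intro k R hR R' hR' ℓ
    have := ContinuousLinearMap.le_opNorm (fderiv ℝ (D.V k) R - fderiv ℝ (D.V k) R')
      (Pi.single ℓ 1)
    refine this.trans ?_
    calc _ ≤ (K * ‖R - R'‖) * 1 := by
          gcongr; exacts [(h2 k).2.2.1 R (hint hR) R' (hint hR'), single_le ℓ]
      _ ≤ _ := by rw [mul_one]; gcongr; exact norm_le_sum_abs (R - R')
  · intro k R hR R' hR' R'' hR''
    refine ((h2 k).2.2.2 R hR R' hR' R'' hR'').trans ?_
    have n1 := norm_le_sum_abs (R'' - R' - (R' - R))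
    have n2 := norm_le_sum_abs (R'' - R')
    have n3 := norm_le_sum_abs (R' - R)
    simp only [Pi.sub_apply] at n1 n2 n3
    gcongr
  · intro k u u' hu hu' R hR R' hR'
    refine (hLS k u u' hu hu' R hR R' hR').trans ?_
    gcongr

/-- The kernels satisfy the hypotheses of the estimates of quadrature rules. -/
lemma Bounds.quadLip {D : Data N m} {ρM LF K h : ℝ} (B : D.Bounds ρM LF K)
    (hh : D.AdmissibleStep h) (h1 : h ≤ 1) (ℓ : Fin m) (k : Fin N) :
    QuadLip h (D.N₁ h ℓ k) (D.N₂ h ℓ k) (D.ω ℓ k) K := by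
  have e1 : (D.N₁ h ℓ k : ℝ) * h = -D.η₁ ℓ k := by
    rw [(hh.2 ℓ k).1, div_mul_cancel₀ _ hh.1.ne', abs_of_nonpos (B.η₁_nonpos ℓ k)]
  have e2 : (D.N₂ h ℓ k : ℝ) * h = D.η₂ ℓ k := by
    rw [(hh.2 ℓ k).2, div_mul_cancel₀ _ hh.1.ne']
  refine ⟨⟨hh.1, h1, ?_, ?_, B.ω_le ℓ k⟩, ?_⟩
  · have h2 : 0 < ((D.N₁ h ℓ k : ℝ) + D.N₂ h ℓ k) * h := by
      rw [add_mul, e1, e2]; linarith [B.η_lt ℓ k]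
    have h3 := pos_of_mul_pos_left h2 hh.1.le
    have : 0 < D.N₁ h ℓ k + D.N₂ h ℓ k := by exact_mod_cast h3
    omega
  · rw [add_mul, e1, e2]; linarith [B.len_le ℓ k]
  · rw [e1, e2, neg_neg]; exact B.ω_lip ℓ k

lemma Bounds.quadBound_dω {D : Data N m} {ρM LF K h : ℝ} (B : D.Bounds ρM LF K)
    (hh : D.AdmissibleStep h) (h1 : h ≤ 1) (ℓ : Fin m) (k : Fin N) :
    QuadBound h (D.N₁ h ℓ k) (D.N₂ h ℓ k) (D.dω ℓ k) K :=
  { (B.quadLip hh h1 ℓ k).toQuadBound with w_le := B.dω_le ℓ k }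

end Data
end NT

namespace NT

/-! ### Bounds for the terms of the scheme -/

lemma diff_add_fun (u v : ℤ → ℝ) (j : ℤ) :
    diff (fun j => u j + v j) j = diff u j + diff v j := by simp only [diff]; ring

lemma diff_sum_fun {ι : Type*} (s : Finset ι) (f : ι → ℤ → ℝ) (j : ℤ) :
    diff (fun j => ∑ i ∈ s, f i j) j = ∑ i ∈ s, diff (f i) j := by
  simp only [diff, Finset.sum_sub_distrib]

/-- The variation of a Lipschitz function of grid functions. -/
lemma TVLE.of_lip {N m : ℕ} {f : ℤ → ℝ} {u : Fin N → ℤ → ℝ} {R : Fin m → ℤ → ℝ} {L A A' : ℝ}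
    (hL : 0 ≤ L) (hu : ∀ i, TVLE (u i) A) (hR : ∀ ℓ, TVLE (R ℓ) A')
    (hf : ∀ j, |diff f j| ≤ L * (∑ i, |diff (u i) j| + ∑ ℓ, |diff (R ℓ) j|)) :
    TVLE f (L * (N * A + m * A')) := by
  have h1 := SumLE.sum_const Finset.univ fun i _ => hu i
  have h2 := SumLE.sum_const Finset.univ fun i _ => hR i
  simp only [Finset.card_univ, Fintype.card_fin] at h1 h2
  exact TVLE.of_le ((h1.add h2).const_mul hL) hf

lemma abs_sum_le_card {N : ℕ} {f : Fin N → ℝ} {M : ℝ} (hf : ∀ i, |f i| ≤ M) :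
    |∑ i, f i| ≤ N * M := by
  refine (Finset.abs_sum_le_sum_abs _ _).trans ?_
  simpa using Finset.sum_le_sum fun i (_ : i ∈ Finset.univ) => hf i

lemma sum_abs_le_card {N : ℕ} {f : Fin N → ℝ} {M : ℝ} (hf : ∀ i, |f i| ≤ M) :
    ∑ i, |f i| ≤ N * M := by
  simpa using Finset.sum_le_sum fun i (_ : i ∈ Finset.univ) => hf i

namespace Data

variable {N m : ℕ} (D : Data N m)

/-- The hypotheses on a grid function under which one step of the scheme is analysed: the values
exceed the range `[0, ρM]` by little, every component has variation at most `A`, and the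
quadrature rules have almost the mass `1` of the kernels. The margins are divided by `N + 1`
because `N` of them add up in the nonlocal terms. -/
structure State (ρM h : ℝ) (u : Fin N → ℤ → ℝ) (A : ℝ) : Prop where
  adm : D.AdmissibleStep h
  h_le : h ≤ 1
  range : ∀ k j, u k j ∈ Icc (-(ρM / (100 * (N + 1)))) (ρM + ρM / (100 * (N + 1)))
  tv : ∀ k, TVLE (u k) A
  mass : ∀ ℓ k, quad h (D.N₁ h ℓ k) (D.N₂ h ℓ k) (D.ω ℓ k) 1 1 1 0 ≤ 1 + 1 / (32 * (N + 1))
  A_nonneg : 0 ≤ A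

/-- The part `S - g ∑ ∂V ∂ₓR` of the approximation of `∂ₜρ`, which is bounded uniformly in the
step. -/
def smoothPart (h : ℝ) (u : Fin N → ℤ → ℝ) (k : Fin N) (j : ℤ) : ℝ :=
  D.S k (fun i => u i j) (D.vecR h u j)
    - D.g k (u k j) * ∑ ℓ, fderiv ℝ (D.V k) (D.vecR h u j) (Pi.single ℓ 1) * D.dxR h u ℓ j

/-- The limited difference quotient of the flux in the approximation of `∂ₜρ`. -/
def limitedPart (h : ℝ) (u : Fin N → ℤ → ℝ) (k : Fin N) (j : ℤ) : ℝ :=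
  minmod ((D.g k (u k (j + 1)) - D.g k (u k j)) / h)
      ((D.g k (u k j) - D.g k (u k (j - 1))) / h) * D.V k (D.vecR h u j)

lemma dtU_eq (h : ℝ) (u : Fin N → ℤ → ℝ) (k : Fin N) (j : ℤ) :
    D.dtU h u k j = D.smoothPart h u k j - D.limitedPart h u k j := by
  simp only [dtU, σ, smoothPart, limitedPart]; ring

variable {D} {ρM LF K : ℝ}

section State

variable {h A : ℝ} {u : Fin N → ℤ → ℝ}

lemma eps_bounds (N : ℕ) {ρM : ℝ} (hρ : 0 < ρM) : 0 < ρM / (100 * (N + 1)) ∧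
    ρM / (100 * ((N : ℝ) + 1)) ≤ ρM / 100 ∧ N * (ρM / (100 * (N + 1))) ≤ ρM / 100 := by
  have hN : (0 : ℝ) ≤ N := Nat.cast_nonneg N
  refine ⟨by positivity, ?_, ?_⟩
  · gcongr; linarith
  · rw [← mul_div_assoc, div_le_div_iff₀ (by positivity) (by positivity)]; nlinarith

lemma State.abs_val_le (s : D.State ρM h u A) (B : D.Bounds ρM LF K) (k : Fin N) (j : ℤ) :
    |u k j| ≤ 2 * K := by
  obtain ⟨h1, h2, -⟩ := eps_bounds N B.ρM_pos
  have := s.range k j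
  exact abs_le.2 ⟨by linarith [this.1, B.ρM_le, B.ρM_pos], by linarith [this.2, B.ρM_le]⟩

lemma State.mem_densityRange (s : D.State ρM h u A) (B : D.Bounds ρM LF K) (k : Fin N) (j : ℤ) :
    u k j ∈ densityRange ρM := by
  obtain ⟨h1, h2, -⟩ := eps_bounds N B.ρM_pos
  have := s.range k j
  exact ⟨by linarith [this.1, B.ρM_pos], by linarith [this.2, B.ρM_pos]⟩

lemma State.abs_diff_le (s : D.State ρM h u A) (B : D.Bounds ρM LF K) (k : Fin N) (j : ℤ) :
    |diff (u k) j| ≤ (1 + 1 / 50) * ρM := by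
  obtain ⟨h1, h2, -⟩ := eps_bounds N B.ρM_pos
  have ha := s.range k j
  have hb := s.range k (j + 1)
  exact abs_le.2 ⟨by simp only [diff]; linarith [ha.2, hb.1],
    by simp only [diff]; linarith [ha.1, hb.2]⟩

/-- The bounds and the variation of the three grid functions that enter the quadrature rules. -/
lemma State.slopes (s : D.State ρM h u A) (B : D.Bounds ρM LF K) (k : Fin N) :
    (∀ j, |u k j + h / 4 * slope h (u k) j| ≤ 2 * K) ∧
    (∀ j, |u k j - h / 4 * slope h (u k) j| ≤ 2 * K) ∧
    TVLE (fun j => u k j + h / 4 * slope h (u k) j) (2 * A) ∧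
    TVLE (fun j => u k j - h / 4 * slope h (u k) j) (2 * A) := by
  obtain ⟨h1, h2, -⟩ := eps_bounds N B.ρM_pos
  have hh := s.adm.1
  refine ⟨fun j => ?_, fun j => ?_, ?_, ?_⟩
  · have := add_slope_mem hh (u k) j (s.range k)
    exact abs_le.2 ⟨by linarith [this.1, B.ρM_le, B.ρM_pos], by linarith [this.2, B.ρM_le]⟩
  · have := sub_slope_mem hh (u k) j (s.range k)
    exact abs_le.2 ⟨by linarith [this.1, B.ρM_le, B.ρM_pos], by linarith [this.2, B.ρM_le]⟩
  · have := tv_add_slope hh (u k) (s.tv k) (1 / 4) (by norm_num [abs_of_pos])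
    convert this using 3; ring
  · have := tv_add_slope hh (u k) (s.tv k) (-(1 / 4)) (by norm_num [abs_of_pos])
    convert this using 3; ring

/-- The discrete nonlocal terms stay in a fixed part of the interior of the admissible range. -/
lemma State.vecR_mem (s : D.State ρM h u A) (B : D.Bounds ρM LF K) (j : ℤ) (ℓ : Fin m) :
    D.vecR h u j ℓ ∈ Icc (-(3 / 32 * ρM)) (N * ρM + 3 / 32 * ρM) := by
  have hρ := B.ρM_pos
  obtain ⟨h1, h2, h3⟩ := eps_bounds N hρ
  have hh := s.adm.1
  have hN : (0 : ℝ) ≤ N := Nat.cast_nonneg N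
  set ε := ρM / (100 * ((N : ℝ) + 1)) with hε
  have hδ : ρM * (1 / (32 * ((N : ℝ) + 1))) * N ≤ ρM / 32 := by
    rw [mul_one_div, div_mul_eq_mul_div, div_le_div_iff₀ (by positivity) (by positivity)]
    nlinarith
  have hδ1 : 1 / (32 * ((N : ℝ) + 1)) ≤ 1 := by
    rw [div_le_one (by positivity)]; linarith
  have hδ0 : 0 < 1 / (32 * ((N : ℝ) + 1)) := by positivity
  set δ := 1 / (32 * ((N : ℝ) + 1)) with hδd
  have key : ∀ k, D.discR h u ℓ k j ∈ Icc (-(2 * ε)) (ρM + ρM * δ + 2 * ε) := fun k => by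
    have := quad_mem (n₁ := D.N₁ h ℓ k) (n₂ := D.N₂ h ℓ k) hh (B.ω_nonneg ℓ k)
      (fun j => add_slope_mem hh (u k) j (s.range k)) (s.range k)
      (fun j => sub_slope_mem hh (u k) j (s.range k)) j
    have hm := s.mass ℓ k
    have hm0 : 0 ≤ quad h (D.N₁ h ℓ k) (D.N₂ h ℓ k) (D.ω ℓ k) 1 1 1 0 := by
      have := quad_mem (n₁ := D.N₁ h ℓ k) (n₂ := D.N₂ h ℓ k) (a := 1) (b := 1) (c := 1)
        (lo := 0) (hi := 1) hh (B.ω_nonneg ℓ k)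
        (fun j => by simp) (fun j => by simp) (fun j => by simp) 0
      simpa using this.1
    constructor
    · refine le_trans ?_ this.1
      nlinarith
    · refine this.2.trans ?_
      have : (ρM + ε) * quad h (D.N₁ h ℓ k) (D.N₂ h ℓ k) (D.ω ℓ k) 1 1 1 0
          ≤ (ρM + ε) * (1 + δ) := by gcongr
      nlinarith
  have hs1 := Finset.sum_le_sum fun k (_ : k ∈ Finset.univ) => (key k).1
  have hs2 := Finset.sum_le_sum fun k (_ : k ∈ Finset.univ) => (key k).2
  simp only [Finset.sum_const, Finset.card_univ, Fintype.card_fin, nsmul_eq_mul] at hs1 hs2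
  simp only [vecR, mem_Icc]
  constructor <;> nlinarith

lemma mem_nonlocalInterior_of {R : Fin m → ℝ} (hρ : 0 < ρM)
    (hR : ∀ ℓ, R ℓ ∈ Icc (-(3 / 32 * ρM)) (N * ρM + 3 / 32 * ρM)) :
    R ∈ nonlocalInterior N m ρM := fun ℓ =>
  ⟨by linarith [(hR ℓ).1], by linarith [(hR ℓ).2]⟩

lemma State.vecR_mem_interior (s : D.State ρM h u A) (B : D.Bounds ρM LF K) (j : ℤ) :
    D.vecR h u j ∈ nonlocalInterior N m ρM := mem_nonlocalInterior_of B.ρM_pos (s.vecR_mem B j)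

lemma State.vecR_mem_range (s : D.State ρM h u A) (B : D.Bounds ρM LF K) (j : ℤ) :
    D.vecR h u j ∈ nonlocalRange N m ρM := nonlocalInterior_subset _ _ _ (s.vecR_mem_interior B j)

/-- Since `g V = F` and the minmod limiter selects the smaller difference quotient, the limited part
is controlled by the Lipschitz constant of the flux, on both sides of an interface. -/
lemma State.limitedPart_le (s : D.State ρM h u A) (B : D.Bounds ρM LF K) (k : Fin N) (j : ℤ) :
    |h * D.limitedPart h u k j| ≤ LF * |diff (u k) j| ∧
    |h * D.limitedPart h u k (j + 1)| ≤ LF * |diff (u k) j| := by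
  have hh := s.adm.1
  have key : ∀ i j' x, |x| ≤ |(D.g k (u k (i + 1)) - D.g k (u k i)) / h| →
      |h * (x * D.V k (D.vecR h u j'))| ≤ LF * |diff (u k) i| := fun i j' x hx => by
    have hF := B.F_lip k _ (s.mem_densityRange B k (i + 1)) _ (s.mem_densityRange B k i) _
      (s.vecR_mem_range B j') _ (s.vecR_mem_range B j')
    simp only [sub_self, abs_zero, Finset.sum_const_zero, add_zero, F, ← sub_mul] at hF
    refine le_trans ?_ hF
    rw [abs_mul, abs_mul, abs_mul, ← mul_assoc, abs_of_pos hh]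
    gcongr
    rw [abs_div, abs_of_pos hh, le_div_iff₀ hh] at hx
    linarith
  refine ⟨key j _ _ (abs_minmod_le_left _ _), key j _ _ ?_⟩
  have := abs_minmod_le_right ((D.g k (u k (j + 1 + 1)) - D.g k (u k (j + 1))) / h)
    ((D.g k (u k (j + 1)) - D.g k (u k (j + 1 - 1))) / h)
  rwa [add_sub_cancel_right] at this ⊢

end State

/-- Bounds for the discrete nonlocal terms. -/
lemma Bounds.vecR_bounds (B : D.Bounds ρM LF K) : ∀ᶠ C : ℝ in atTop, ∀ h u A,
    D.State ρM h u A → ∀ ℓ,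
      (∀ j, |diff (fun j => D.vecR h u j ℓ) j| ≤ C * h) ∧
      TVLE (fun j => D.vecR h u j ℓ) (C * A) ∧
      TVLE (diff fun j => D.vecR h u j ℓ) (C * A * h) := by
  have hK : 0 ≤ K := by linarith [B.one_le]
  filter_upwards [eventually_ge_atTop (N * (K * (6 + K) * (2 * K))),
    eventually_ge_atTop (N * (K * (2 + K) * 2)),
    eventually_ge_atTop (N * (K * (6 + K) * 2))] with C h1 h2 h3 h u A s ℓ
  have hh := s.adm.1
  have hA := s.A_nonneg
  have e : diff (fun j => D.vecR h u j ℓ) = fun j => ∑ k, diff (D.discR h u ℓ k) j := by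
    funext j; exact diff_sum_fun Finset.univ (fun k => D.discR h u ℓ k) j
  have q := fun k => B.quadLip s.adm s.h_le ℓ k
  have t2 : ∀ k, TVLE (u k) (2 * A) := fun k => (s.tv k).weaken (by linarith)
  refine ⟨fun j => ?_, ?_, ?_⟩
  · rw [e]
    refine (abs_sum_le_card fun k => (q k).diff_sup (s.slopes B k).1 (s.abs_val_le B k)
      (s.slopes B k).2.1 j).trans ?_
    rw [← mul_assoc]; gcongr
  · refine (TVLE.sum_const Finset.univ fun k _ => (q k).toQuadBound.tv (s.slopes B k).2.2.1
      (t2 k) (s.slopes B k).2.2.2).weaken ?_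
    simp only [Finset.card_univ, Fintype.card_fin]
    calc _ = (N * (K * (2 + K) * 2)) * A := by ring
      _ ≤ C * A := by gcongr
  · rw [e]
    refine (TVLE.sum_const Finset.univ fun k _ => (q k).diff_tv (s.slopes B k).2.2.1
      (t2 k) (s.slopes B k).2.2.2).weaken ?_
    simp only [Finset.card_univ, Fintype.card_fin]
    calc _ = (N * (K * (6 + K) * 2)) * A * h := by ring
      _ ≤ C * A * h := by gcongr

/-- Bounds for the discrete derivative of the nonlocal terms. -/
lemma Bounds.dxR_bounds (B : D.Bounds ρM LF K) : ∀ᶠ C : ℝ in atTop, ∀ h u A,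
    D.State ρM h u A → ∀ ℓ, (∀ j, |D.dxR h u ℓ j| ≤ C) ∧ TVLE (D.dxR h u ℓ) (C * A) := by
  have hK : 0 ≤ K := by linarith [B.one_le]
  filter_upwards [eventually_ge_atTop (N * (K * (2 * K) + K * (2 * K) + K * (2 + K) * (2 * K))),
    eventually_ge_atTop (N * (K + K + K * (2 + K) * 2))] with C h1 h2 h u A s ℓ
  have hh := s.adm.1
  have hA := s.A_nonneg
  have q := fun k => B.quadBound_dω s.adm s.h_le ℓ k
  have t2 : ∀ k, TVLE (u k) (2 * A) := fun k => (s.tv k).weaken (by linarith)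
  constructor
  · intro j
    refine (abs_sum_le_card fun k => ?_).trans h1
    refine (abs_sub _ _).trans (add_le_add ((abs_add_le _ _).trans (add_le_add ?_ ?_))
      ((q k).sup (s.slopes B k).1 (s.abs_val_le B k) (s.slopes B k).2.1 j))
    · rw [abs_neg, abs_mul]; gcongr
      exacts [B.ω_le _ _ _, s.abs_val_le B _ _]
    · rw [abs_mul]; gcongr
      exacts [B.ω_le _ _ _, s.abs_val_le B _ _]
  · have H := TVLE.sum Finset.univ fun k _ => ((((s.tv k).shift (-D.N₁ h ℓ k)).const_mul
      (-D.ω ℓ k (D.η₁ ℓ k))).add (((s.tv k).shift (D.N₂ h ℓ k)).const_mul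
      (D.ω ℓ k (D.η₂ ℓ k)))).sub ((q k).tv (s.slopes B k).2.2.1 (t2 k) (s.slopes B k).2.2.2)
    simp only [neg_mul, ← sub_eq_add_neg] at H
    refine SumLE.weaken H ?_
    have : ∀ k ∈ Finset.univ, |-D.ω ℓ k (D.η₁ ℓ k)| * A + |D.ω ℓ k (D.η₂ ℓ k)| * A
        + K * (2 + K) * (2 * A) ≤ (K + K + K * (2 + K) * 2) * A := fun k _ => by
      have := mul_le_mul_of_nonneg_right (B.ω_le ℓ k (D.η₁ ℓ k)) hA
      have := mul_le_mul_of_nonneg_right (B.ω_le ℓ k (D.η₂ ℓ k)) hA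
      rw [abs_neg]; linarith
    refine (Finset.sum_le_sum this).trans ?_
    simp only [Finset.sum_const, Finset.card_univ, Fintype.card_fin, nsmul_eq_mul, ← mul_assoc]
    gcongr

/-- Bounds for the regular part of the time derivative. -/
lemma Bounds.smoothPart_bounds (B : D.Bounds ρM LF K) : ∀ᶠ C : ℝ in atTop, ∀ h u A,
    D.State ρM h u A → ∀ k, (∀ j, |D.smoothPart h u k j| ≤ C) ∧
      TVLE (D.smoothPart h u k) (C * A) := by
  have hK : 0 ≤ K := by linarith [B.one_le]
  obtain ⟨C₀, hC₀, hR, hX⟩ :=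
    ((eventually_ge_atTop 0).and (B.vecR_bounds.and B.dxR_bounds)).exists
  filter_upwards [eventually_ge_atTop (K + K * (m * (K * C₀))),
    eventually_ge_atTop (K * (N + m * C₀) + ((m * (K * C₀)) * K
      + K * (m * (C₀ * (K * (m * C₀)) + K * C₀))))] with C h1 h2 h u A s k
  have hA := s.A_nonneg
  have bV : ∀ ℓ j, |fderiv ℝ (D.V k) (D.vecR h u j) (Pi.single ℓ 1)| ≤ K := fun ℓ j =>
    B.dV_le k _ (s.vecR_mem_interior B j) ℓ
  have tV : ∀ ℓ, TVLE (fun j => fderiv ℝ (D.V k) (D.vecR h u j) (Pi.single ℓ 1))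
      (K * (m * (C₀ * A))) := fun ℓ => by
    have := TVLE.of_lip (N := 0) (u := Fin.elim0) (A := 0)
      (f := fun j => fderiv ℝ (D.V k) (D.vecR h u j) (Pi.single ℓ 1)) hK (fun i => i.elim0)
      (fun ℓ => (hR h u A s ℓ).2.1) (fun j => by
        simpa [diff] using B.dV_lip k _ (s.vecR_mem_interior B (j + 1)) _
          (s.vecR_mem_interior B j) ℓ)
    simpa using this
  have bsum : ∀ j, |∑ ℓ, fderiv ℝ (D.V k) (D.vecR h u j) (Pi.single ℓ 1) * D.dxR h u ℓ j|
      ≤ m * (K * C₀) := fun j => abs_sum_le_card fun ℓ => by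
    rw [abs_mul]; gcongr
    exacts [bV ℓ j, (hX h u A s ℓ).1 j]
  have tsum := TVLE.sum_const Finset.univ fun ℓ _ =>
    (tV ℓ).mul (hX h u A s ℓ).2 (bV ℓ) (hX h u A s ℓ).1
  have bg : ∀ j, |D.g k (u k j)| ≤ K := fun j => B.g_le k _ (s.mem_densityRange B k j)
  have tg : TVLE (fun j => D.g k (u k j)) (K * A) :=
    TVLE.of_le (SumLE.const_mul (s.tv k) hK) fun j =>
      B.g_lip k _ (s.mem_densityRange B k _) _ (s.mem_densityRange B k _)
  have tS : TVLE (fun j => D.S k (fun i => u i j) (D.vecR h u j)) (K * (N * A + m * (C₀ * A))) :=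
    TVLE.of_lip hK s.tv (fun ℓ => (hR h u A s ℓ).2.1) fun j =>
      B.S_lip k _ _ (fun i => s.mem_densityRange B i _) (fun i => s.mem_densityRange B i _) _
        (s.vecR_mem_range B _) _ (s.vecR_mem_range B _)
  constructor
  · intro j
    refine ((abs_sub _ _).trans (add_le_add (B.S_le k _ (fun i => s.mem_densityRange B i j) _
      (s.vecR_mem_range B j)) ?_)).trans h1
    rw [abs_mul]
    exact mul_le_mul (bg j) (bsum j) (abs_nonneg _) hK
  · refine (tS.sub (tg.mul tsum bg bsum)).weaken ?_
    simp only [Finset.card_univ, Fintype.card_fin]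
    calc _ = (K * (N + m * C₀) + ((m * (K * C₀)) * K
      + K * (m * (C₀ * (K * (m * C₀)) + K * C₀)))) * A := by ring
      _ ≤ C * A := by gcongr

end Data
end NT

namespace NT
namespace Data

variable {N m : ℕ} {D : Data N m} {ρM LF K lam : ℝ}

/-! ### Half time steps -/

lemma diff_halfU (D : Data N m) (h : ℝ) (u : Fin N → ℤ → ℝ) (k : Fin N) (j : ℤ) :
    diff (D.halfU (lam * h) h u k) j = diff (u k) j + lam / 2 * (h * diff (D.smoothPart h u k) j)
      - lam / 2 * (h * D.limitedPart h u k (j + 1) - h * D.limitedPart h u k j) := by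
  simp only [diff, halfU, dtU_eq]; ring

/-- The correction of the nonlocal terms in the half time step. -/
def corrR (D : Data N m) (lam h : ℝ) (u : Fin N → ℤ → ℝ) (ℓ : Fin m) (j : ℤ) : ℝ :=
  ∑ k, quad h (D.N₁ h ℓ k) (D.N₂ h ℓ k) (D.ω ℓ k) (fun i => lam * h / 2 * D.dtU h u k i)
    (fun i => lam * h / 2 * D.dtU h u k i) (fun i => lam * h / 2 * D.dtU h u k i) j

lemma halfR_eq (D : Data N m) (h : ℝ) (u : Fin N → ℤ → ℝ) (ℓ : Fin m) (j : ℤ) :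
    D.halfR (lam * h) h u j ℓ = D.vecR h u j ℓ + D.corrR lam h u ℓ j := by
  simp only [halfR, vecR, corrR, quad_const_mul, Finset.sum_add_distrib]

/-- The increment in half a time step is a part of order `h` and a part that is summable. -/
lemma halfIncr_eq (D : Data N m) (h : ℝ) (u : Fin N → ℤ → ℝ) (k : Fin N) (i : ℤ) :
    lam * h / 2 * D.dtU h u k i = lam * h / 2 * D.smoothPart h u k i
      + -(lam / 2) * (h * D.limitedPart h u k i) := by
  rw [dtU_eq]; ring

/-- The limited part is controlled by the differences of `u`, which are summable. -/
lemma Bounds.halfIncr_bounds (B : D.Bounds ρM LF K) (hlam : 0 < lam) : ∀ᶠ C : ℝ in atTop,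
    ∀ h u A, D.State ρM h u A → ∀ k,
      (∀ j, |lam * h / 2 * D.smoothPart h u k j| ≤ C * h) ∧
      (∀ j, |lam * h / 2 * D.dtU h u k j| ≤ lam * LF / 2 * |diff (u k) j| + C * h) ∧
      (∀ j, |lam * h / 2 * D.dtU h u k j| ≤ C) ∧
      SumLE (fun j => |-(lam / 2) * (h * D.limitedPart h u k j)|) (C * A) ∧
      TVLE (fun j => lam * h / 2 * D.dtU h u k j) (C * A) := by
  obtain ⟨C₀, hC₀, hX⟩ := ((eventually_ge_atTop 0).and B.smoothPart_bounds).exists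
  have hL := B.LF_nonneg
  have hρ := B.ρM_pos
  filter_upwards [eventually_ge_atTop (lam / 2 * C₀), eventually_ge_atTop (lam * LF / 2),
    eventually_ge_atTop (lam * LF / 2 * ((1 + 1 / 50) * ρM) + lam / 2 * C₀),
    eventually_ge_atTop (lam / 2 * C₀ + 2 * (lam * LF / 2))] with C h1 h2 h3 h4 h u A s k
  have hh := s.adm.1
  have hA := s.A_nonneg
  have b1 : ∀ j, |lam * h / 2 * D.smoothPart h u k j| ≤ lam / 2 * C₀ * h := fun j => by
    rw [abs_mul, abs_of_pos (by positivity : 0 < lam * h / 2)]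
    calc _ ≤ lam * h / 2 * C₀ := by gcongr; exact (hX h u A s k).1 j
      _ = _ := by ring
  have b2 : ∀ j, |-(lam / 2) * (h * D.limitedPart h u k j)| ≤ lam * LF / 2 * |diff (u k) j| :=
    fun j => by
    rw [abs_mul, abs_neg, abs_of_pos (by positivity : 0 < lam / 2)]
    calc _ ≤ lam / 2 * (LF * |diff (u k) j|) := by gcongr; exact (s.limitedPart_le B k j).1
      _ = _ := by ring
  have b3 : SumLE (fun j => |-(lam / 2) * (h * D.limitedPart h u k j)|) (lam * LF / 2 * A) :=
    (SumLE.const_mul (s.tv k) (by positivity)).mono (fun _ => abs_nonneg _) b2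
  refine ⟨fun j => (b1 j).trans (by gcongr), fun j => ?_, fun j => ?_, b3.weaken (by gcongr), ?_⟩
  · rw [halfIncr_eq]
    refine (abs_add_le _ _).trans ?_
    rw [add_comm]
    exact add_le_add (b2 j) ((b1 j).trans (by gcongr))
  · rw [halfIncr_eq]
    refine ((abs_add_le _ _).trans ?_).trans h3
    rw [add_comm]
    refine add_le_add ((b2 j).trans ?_) ((b1 j).trans ?_)
    · gcongr; exact s.abs_diff_le B k j
    · exact mul_le_of_le_one_right (by positivity) s.h_le
  · simp only [halfIncr_eq]
    refine (((hX h u A s k).2.const_mul (lam * h / 2)).add (TVLE.of_sumLE b3)).weaken ?_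
    rw [abs_of_pos (by positivity : 0 < lam * h / 2)]
    have : lam * h / 2 * (C₀ * A) ≤ lam / 2 * C₀ * A := by
      calc _ = (lam / 2 * C₀ * A) * h := by ring
        _ ≤ _ := mul_le_of_le_one_right (by positivity) s.h_le
    calc _ ≤ (lam / 2 * C₀ + 2 * (lam * LF / 2)) * A := by linarith
      _ ≤ C * A := by gcongr

/-- The nonlocal terms at half time steps differ by `O(h)` from those before, since the quadrature
rule of the summable part of the increments gains a factor `h`. They inherit the bounds of the
latter. -/
lemma Bounds.halfR_bounds (B : D.Bounds ρM LF K) (hlam : 0 < lam) : ∀ᶠ C : ℝ in atTop,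
    ∀ h u A, D.State ρM h u A → ∀ ℓ,
      (∀ j, |D.halfR (lam * h) h u j ℓ - D.vecR h u j ℓ| ≤ C * h * (1 + A)) ∧
      (∀ j, |diff (fun j => D.halfR (lam * h) h u j ℓ) j| ≤ C * h) ∧
      TVLE (fun j => D.halfR (lam * h) h u j ℓ) (C * A) ∧
      TVLE (diff fun j => D.halfR (lam * h) h u j ℓ) (C * A * h) := by
  have hK : 0 ≤ K := by linarith [B.one_le]
  obtain ⟨C₀, hC₀, hI, hR⟩ := ((eventually_ge_atTop 0).and
    ((B.halfIncr_bounds hlam).and B.vecR_bounds)).exists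
  filter_upwards [eventually_ge_atTop (N * (K * (2 + K) * C₀ + 3 * K * C₀)),
    eventually_ge_atTop (C₀ + N * (K * (6 + K) * C₀)),
    eventually_ge_atTop (C₀ + N * (K * (2 + K) * C₀))] with C h1 h2 h3 h u A s ℓ
  have hh := s.adm.1
  have hA := s.A_nonneg
  have hC : 0 ≤ C := le_trans (by positivity) h3
  have q := fun k => B.quadLip s.adm s.h_le ℓ k
  have e : (fun j => D.halfR (lam * h) h u j ℓ)
      = fun j => D.vecR h u j ℓ + D.corrR lam h u ℓ j := funext fun j => halfR_eq D h u ℓ j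
  have e2 : diff (D.corrR lam h u ℓ) = fun j => ∑ k, diff (quad h (D.N₁ h ℓ k) (D.N₂ h ℓ k)
      (D.ω ℓ k) (fun i => lam * h / 2 * D.dtU h u k i) (fun i => lam * h / 2 * D.dtU h u k i)
      (fun i => lam * h / 2 * D.dtU h u k i)) j := by
    funext j; exact diff_sum_fun Finset.univ _ j
  have e3 : diff (fun j => D.halfR (lam * h) h u j ℓ)
      = fun j => diff (fun j => D.vecR h u j ℓ) j + diff (D.corrR lam h u ℓ) j := by
    rw [e]; funext j; exact diff_add_fun _ _ j
  refine ⟨fun j => ?_, fun j => ?_, ?_, ?_⟩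
  · rw [halfR_eq, add_sub_cancel_left]
    have hk : ∀ k, |quad h (D.N₁ h ℓ k) (D.N₂ h ℓ k) (D.ω ℓ k)
        (fun i => lam * h / 2 * D.dtU h u k i) (fun i => lam * h / 2 * D.dtU h u k i)
        (fun i => lam * h / 2 * D.dtU h u k i) j|
        ≤ K * (2 + K) * (C₀ * h) + 3 * K * (C₀ * A) * h := fun k => by
      simp only [halfIncr_eq]
      rw [quad_add]
      refine (abs_add_le _ _).trans (add_le_add ?_ ?_)
      · exact (q k).toQuadBound.sup (hI h u A s k).1 (hI h u A s k).1 (hI h u A s k).1 j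
      · exact (q k).toQuadBound.abs_quad_le_of_sumLE (hI h u A s k).2.2.2.1 j
    refine (abs_sum_le_card hk).trans ?_
    calc (N : ℝ) * (K * (2 + K) * (C₀ * h) + 3 * K * (C₀ * A) * h)
        ≤ (N * (K * (2 + K) * C₀ + 3 * K * C₀)) * h * (1 + A) := by
          have : 0 ≤ (N : ℝ) * (K * (2 + K) * (C₀ * h)) * A + N * (3 * K * C₀ * h) := by
            positivity
          linarith
      _ ≤ C * h * (1 + A) := by gcongr
  · rw [e3, e2]
    refine (abs_add_le _ _).trans ((add_le_add ((hR h u A s ℓ).1 j) (abs_sum_le_card fun k =>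
      (q k).diff_sup (hI h u A s k).2.2.1 (hI h u A s k).2.2.1 (hI h u A s k).2.2.1 j)).trans ?_)
    calc _ = (C₀ + N * (K * (6 + K) * C₀)) * h := by ring
      _ ≤ C * h := by gcongr
  · rw [e]
    refine ((hR h u A s ℓ).2.1.add (TVLE.sum_const Finset.univ fun k _ => (q k).toQuadBound.tv
      (hI h u A s k).2.2.2.2 (hI h u A s k).2.2.2.2 (hI h u A s k).2.2.2.2)).weaken ?_
    simp only [Finset.card_univ, Fintype.card_fin]
    calc _ = (C₀ + N * (K * (2 + K) * C₀)) * A := by ring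
      _ ≤ C * A := by gcongr
  · rw [e3, e2]
    refine ((hR h u A s ℓ).2.2.add (TVLE.sum_const Finset.univ fun k _ => (q k).diff_tv
      (hI h u A s k).2.2.2.2 (hI h u A s k).2.2.2.2 (hI h u A s k).2.2.2.2)).weaken ?_
    simp only [Finset.card_univ, Fintype.card_fin]
    calc _ = (C₀ + N * (K * (6 + K) * C₀)) * A * h := by ring
      _ ≤ C * A * h := by gcongr

/-- The CFL condition in the form in which it enters the estimates. -/
lemma cfl_quadratic (hlam : 0 < lam) (hL : 0 ≤ LF) (hC : lam * LF ≤ (Real.sqrt 2 - 1) / 2) :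
    lam * LF * (1 + lam * LF) ≤ 1 / 4 ∧ lam * LF ≤ 21 / 100 := by
  have h2 := Real.sq_sqrt (zero_le_two (α := ℝ))
  have h0 := Real.sqrt_nonneg 2
  have h1 : Real.sqrt 2 ≤ 142 / 100 := by
    rw [Real.sqrt_le_left (by norm_num)]; norm_num
  have h3 : 0 ≤ lam * LF := by positivity
  generalize lam * LF = a at *
  constructor <;> nlinarith

/-- The conclusions on the values at half time steps for a step that is small compared with the
variation. -/
structure HalfState (D : Data N m) (ρM LF lam C h : ℝ) (u : Fin N → ℤ → ℝ) (A : ℝ) : Prop where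
  memU : ∀ k j, D.halfU (lam * h) h u k j ∈ densityRange ρM
  memR : ∀ j, D.halfR (lam * h) h u j ∈ nonlocalRange N m ρM
  subU : ∀ k j, |D.halfU (lam * h) h u k j - u k j| ≤ |diff (u k) j| + C * h
  subR : ∀ j ℓ, |D.halfR (lam * h) h u j ℓ - D.vecR h u j ℓ| ≤ C * h * (1 + A)
  diffU : ∃ e : Fin N → ℤ → ℝ, (∀ k, SumLE (e k) (C * A * h)) ∧ (∀ k j, e k j ≤ C * h) ∧
    ∀ k j, lam * LF * |diff (D.halfU (lam * h) h u k) j| ≤ 1 / 4 * |diff (u k) j| + e k j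
  tvU : ∀ k, TVLE (D.halfU (lam * h) h u k) (C * A)
  diffR : ∀ ℓ j, |diff (fun j => D.halfR (lam * h) h u j ℓ) j| ≤ C * h
  tvR : ∀ ℓ, TVLE (fun j => D.halfR (lam * h) h u j ℓ) (C * A)
  tvDiffR : ∀ ℓ, TVLE (diff fun j => D.halfR (lam * h) h u j ℓ) (C * A * h)

/-- The CFL condition enters here twice: `λ LF ≤ 21/100` keeps the densities at half time steps in
the range of regularity, and `λ LF (1 + λ LF) ≤ 1/4` bounds the differences of the flux in which
the nonlocal term is frozen. -/
lemma Bounds.halfState (B : D.Bounds ρM LF K) (hlam : 0 < lam)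
    (hcfl : lam * LF * (1 + lam * LF) ≤ 1 / 4 ∧ lam * LF ≤ 21 / 100) : ∀ᶠ C : ℝ in atTop,
    ∀ h u A, D.State ρM h u A → C * h * (1 + A) ≤ ρM / 1000 →
      HalfState D ρM LF lam C h u A := by
  obtain ⟨C₀, hC₀, hI, hR, hX⟩ := ((eventually_ge_atTop 0).and
    ((B.halfIncr_bounds hlam).and ((B.halfR_bounds hlam).and B.smoothPart_bounds))).exists
  have hL := B.LF_nonneg
  have hρ := B.ρM_pos
  filter_upwards [eventually_ge_atTop C₀, eventually_ge_atTop (1 + C₀),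
    eventually_ge_atTop (lam * LF * (lam / 2 * C₀)),
    eventually_ge_atTop (lam * LF * (lam / 2 * (2 * C₀)))] with C h1 h2 h3 h4 h u A s hsmall
  have hh := s.adm.1
  have hA := s.A_nonneg
  have hC : 0 ≤ C := hC₀.trans h1
  have hsmall' : C * h ≤ ρM / 1000 := by
    refine le_trans ?_ hsmall
    exact le_mul_of_one_le_right (by positivity) (by linarith)
  have hC₀h : C₀ * h ≤ C * h := by gcongr
  have hsub : ∀ k j, D.halfU (lam * h) h u k j - u k j = lam * h / 2 * D.dtU h u k j :=
    fun k j => by simp only [halfU]; ring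
  have hall : lam * LF / 2 ≤ 21 / 200 := by linarith [hcfl.2]
  refine ⟨fun k j => ?_, fun j => ?_, fun k j => ?_, fun j ℓ => ?_, ?_, fun k => ?_,
    fun ℓ j => ?_, fun ℓ => ?_, fun ℓ => ?_⟩
  · have hi := (hI h u A s k).2.1 j
    rw [← hsub] at hi
    have hd := s.abs_diff_le B k j
    have hr := s.range k j
    obtain ⟨e1, e2, -⟩ := eps_bounds N hρ
    have : lam * LF / 2 * |diff (u k) j| ≤ 21 / 200 * ((1 + 1 / 50) * ρM) := by gcongr
    have hi' := abs_le.1 hi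
    constructor <;> linarith [hr.1, hr.2]
  · refine nonlocalInterior_subset _ _ _ fun ℓ => ?_
    have h5 := abs_le.1 (((hR h u A s ℓ).1 j).trans ((by gcongr :
      C₀ * h * (1 + A) ≤ C * h * (1 + A)).trans hsmall))
    have h6 := s.vecR_mem B j ℓ
    constructor <;> linarith [h6.1, h6.2]
  · rw [hsub]
    refine ((hI h u A s k).2.1 j).trans (add_le_add ?_ hC₀h)
    exact mul_le_of_le_one_left (abs_nonneg _) (by linarith)
  · exact ((hR h u A s ℓ).1 j).trans (by gcongr)
  · refine ⟨fun k j => lam * LF * (lam / 2 * (h * |diff (D.smoothPart h u k) j|)),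
      fun k => ?_, fun k j => ?_, fun k j => ?_⟩
    · refine (((SumLE.const_mul (hX h u A s k).2 hh.le).const_mul
        (by positivity : 0 ≤ lam / 2)).const_mul (by positivity : 0 ≤ lam * LF)).weaken ?_
      calc _ = (lam * LF * (lam / 2 * C₀)) * A * h := by ring
        _ ≤ C * A * h := by gcongr
    · have : |diff (D.smoothPart h u k) j| ≤ 2 * C₀ := by
        refine (abs_sub _ _).trans ?_
        linarith [(hX h u A s k).1 j, (hX h u A s k).1 (j + 1)]
      calc lam * LF * (lam / 2 * (h * |diff (D.smoothPart h u k) j|))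
          ≤ lam * LF * (lam / 2 * (h * (2 * C₀))) := by gcongr
        _ = (lam * LF * (lam / 2 * (2 * C₀))) * h := by ring
        _ ≤ C * h := by gcongr
    · rw [diff_halfU]
      have l1 := (s.limitedPart_le B k j).1
      have l2 := (s.limitedPart_le B k j).2
      have l3 : |lam / 2 * (h * D.limitedPart h u k (j + 1) - h * D.limitedPart h u k j)|
          ≤ lam * LF * |diff (u k) j| := by
        rw [abs_mul, abs_of_pos (by positivity : 0 < lam / 2)]
        calc _ ≤ lam / 2 * (LF * |diff (u k) j| + LF * |diff (u k) j|) := by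
              gcongr; exact (abs_sub _ _).trans (add_le_add l2 l1)
          _ = _ := by ring
      have l4 : |lam / 2 * (h * diff (D.smoothPart h u k) j)|
          = lam / 2 * (h * |diff (D.smoothPart h u k) j|) := by
        rw [abs_mul, abs_mul, abs_of_pos hh, abs_of_pos (by positivity : 0 < lam / 2)]
      have l5 : |diff (u k) j + lam / 2 * (h * diff (D.smoothPart h u k) j)
          - lam / 2 * (h * D.limitedPart h u k (j + 1) - h * D.limitedPart h u k j)|
          ≤ |diff (u k) j| + lam / 2 * (h * |diff (D.smoothPart h u k) j|)
            + lam * LF * |diff (u k) j| := by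
        refine (abs_sub _ _).trans (add_le_add ((abs_add_le _ _).trans_eq ?_) l3)
        rw [l4]
      calc _ ≤ lam * LF * (|diff (u k) j| + lam / 2 * (h * |diff (D.smoothPart h u k) j|)
            + lam * LF * |diff (u k) j|) := by gcongr
        _ = lam * LF * (1 + lam * LF) * |diff (u k) j|
            + lam * LF * (lam / 2 * (h * |diff (D.smoothPart h u k) j|)) := by ring
        _ ≤ _ := add_le_add (mul_le_mul_of_nonneg_right hcfl.1 (abs_nonneg _)) le_rfl
  · have := (s.tv k).add (hI h u A s k).2.2.2.2
    have e : D.halfU (lam * h) h u k = fun j => u k j + lam * h / 2 * D.dtU h u k j := by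
      funext j; rw [← hsub]; ring
    rw [e]
    refine this.weaken ?_
    calc _ = (1 + C₀) * A := by ring
      _ ≤ C * A := by gcongr
  · exact ((hR h u A s ℓ).2.1 j).trans hC₀h
  · exact (hR h u A s ℓ).2.2.1.weaken (by gcongr)
  · exact (hR h u A s ℓ).2.2.2.weaken (by gcongr)

end Data
end NT

namespace NT
namespace Data

variable {N m : ℕ} {D : Data N m} {ρM LF K lam : ℝ}

/-! ### One time step -/

/-- The flux difference is split into one in which the nonlocal term is frozen, which is part of a
convex combination, and one in which it varies, which is of order `h`. -/
lemma stag_eq (D : Data N m) {h : ℝ} (hh : 0 < h) (u : Fin N → ℤ → ℝ) (k : Fin N) (j : ℤ) :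
    D.stag (lam * h) h u k j = (u k j + u k (j + 1)) / 2
      + (h / 8 * (slope h (u k) j - slope h (u k) (j + 1))
        - lam * (D.F k (D.halfU (lam * h) h u k (j + 1)) (D.halfR (lam * h) h u (j + 1))
          - D.F k (D.halfU (lam * h) h u k j) (D.halfR (lam * h) h u (j + 1))))
      + (-lam * (D.g k (D.halfU (lam * h) h u k j)
            * diff (fun j => D.V k (D.halfR (lam * h) h u j)) j)
          + lam * h / 2 * (D.halfS (lam * h) h u k (j + 1) + D.halfS (lam * h) h u k j)) := by
  have : lam * h / h = lam := by field_simp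
  rw [stag, this]
  simp only [halfF, F, diff]; ring

lemma step_eq (D : Data N m) (τ h : ℝ) (u : Fin N → ℤ → ℝ) (k : Fin N) (j : ℤ) :
    D.step τ h u k j = (D.stag τ h u k (j - 1) + D.stag τ h u k (j - 1 + 1)) / 2
      + h / 8 * (slope h (D.stag τ h u k) (j - 1) - slope h (D.stag τ h u k) (j - 1 + 1)) := by
  rw [step, sub_add_cancel]; ring

/-- Averaging the interpolant of the staggered values does not increase the variation. -/
lemma tv_step {h A : ℝ} (hh : 0 < h) (τ : ℝ) {u : Fin N → ℤ → ℝ} {k : Fin N}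
    (hA : TVLE (D.stag τ h u k) A) : TVLE (D.step τ h u k) A := by
  have := (tv_convex hA fun j => (abs_slope_diff_le hh (D.stag τ h u k) j).trans
    (by linarith [abs_nonneg (diff (D.stag τ h u k) j)])).shift (-1)
  refine this.mono (fun _ => abs_nonneg _) fun j => le_of_eq ?_
  congr 2; funext j; rw [step_eq]; rfl

lemma step_mem {h lo hi : ℝ} (hh : 0 < h) (τ : ℝ) {u : Fin N → ℤ → ℝ} {k : Fin N}
    (hs : ∀ j, D.stag τ h u k j ∈ Icc lo hi) (j : ℤ) : D.step τ h u k j ∈ Icc lo hi := by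
  rw [step_eq]
  have := mem_Icc_perturbed (e := 0) (E := 0) (B := 0) hs (j - 1)
    (θ := fun j => h / 8 * (slope h (D.stag τ h u k) j - slope h (D.stag τ h u k) (j + 1)))
    ((abs_slope_diff_le hh (D.stag τ h u k) (j - 1)).trans
      (by simp only [Pi.zero_apply]; linarith [abs_nonneg (diff (D.stag τ h u k) (j - 1))]))
    (by simp)
  simpa using this

/-- The influence of one time step: the range grows by a multiple of the step, and the variation
by a factor `1 + C h`. -/
lemma Bounds.stag_bounds (B : D.Bounds ρM LF K) (hlam : 0 < lam) (C₀ : ℝ) (hC₀ : 0 ≤ C₀) :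
    ∀ᶠ C : ℝ in atTop, ∀ h u A, D.State ρM h u A → HalfState D ρM LF lam C₀ h u A → ∀ k,
      TVLE (D.stag (lam * h) h u k) ((1 + C * h) * A) ∧
      ∀ lo hi, (∀ j, u k j ∈ Icc lo hi) →
        ∀ j, D.stag (lam * h) h u k j ∈ Icc (lo - C * h) (hi + C * h) := by
  have hK : 0 ≤ K := by linarith [B.one_le]
  have hL := B.LF_nonneg
  let cE : ℝ := lam * (K * (m * C₀) * (K * C₀) + K * (K * (m * C₀ + 2 * (m * C₀ * (m * C₀)))))
    + lam / 2 * (2 * (K * (N * C₀ + m * C₀)))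
  let cB : ℝ := lam * (K * (K * (m * C₀))) + lam / 2 * (K + K) + C₀
  filter_upwards [eventually_ge_atTop (2 * C₀ + cE), eventually_ge_atTop cB]
    with C h1 h2 h u A s H k
  have hh := s.adm.1
  have hA := s.A_nonneg
  obtain ⟨e, he, he', hdU⟩ := H.diffU
  -- abbreviations for the values at the half step
  set U := fun j => D.halfU (lam * h) h u k j with hU
  set R := fun j => D.halfR (lam * h) h u j with hR
  set W := fun j => D.V k (D.halfR (lam * h) h u j) with hW
  have dR : ∀ j, ∑ ℓ, |R (j + 1) ℓ - R j ℓ| ≤ m * (C₀ * h) := fun j =>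
    sum_abs_le_card fun ℓ => H.diffR ℓ j
  have bW : ∀ j, |diff W j| ≤ K * (m * C₀) * h := fun j => by
    refine (B.V_lip k _ (H.memR (j + 1)) _ (H.memR j)).trans ?_
    calc _ ≤ K * (m * (C₀ * h)) := by gcongr; exact dR j
      _ = _ := by ring
  have tW : TVLE (diff W) (K * (m * C₀ + 2 * (m * C₀ * (m * C₀))) * A * h) := by
    have s1 := SumLE.sum_const Finset.univ fun ℓ _ => H.tvDiffR ℓ
    have s2 := SumLE.sum_const Finset.univ fun ℓ _ => H.tvR ℓ
    simp only [Finset.card_univ, Fintype.card_fin] at s1 s2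
    have hc : 0 ≤ m * (C₀ * h) := by positivity
    refine SumLE.weaken (TVLE.of_le ((s1.add (((s2.shift 1).const_mul hc).add
      (s2.const_mul hc))).const_mul hK) fun j => ?_) ?_
    · refine (B.V_second k _ (H.memR j) _ (H.memR (j + 1)) _ (H.memR (j + 1 + 1))).trans ?_
      have nn : ∀ j, 0 ≤ ∑ ℓ, |R (j + 1) ℓ - R j ℓ| := fun j =>
        Finset.sum_nonneg fun _ _ => abs_nonneg _
      exact mul_le_mul_of_nonneg_left (add_le_add le_rfl (add_le_add
        (mul_le_mul_of_nonneg_right (dR (j + 1)) (nn (j + 1)))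
        (mul_le_mul_of_nonneg_right (dR j) (nn j)))) hK
    · exact le_of_eq (by ring)
  have bg : ∀ j, |D.g k (U j)| ≤ K := fun j => B.g_le k _ (H.memU k j)
  have tg : TVLE (fun j => D.g k (U j)) (K * (C₀ * A)) :=
    TVLE.of_le (SumLE.const_mul (H.tvU k) hK) fun j =>
      B.g_lip k _ (H.memU k _) _ (H.memU k _)
  have tS : TVLE (D.halfS (lam * h) h u k) (K * (N * (C₀ * A) + m * (C₀ * A))) :=
    TVLE.of_lip hK H.tvU H.tvR fun j =>
      B.S_lip k _ _ (fun i => H.memU i _) (fun i => H.memU i _) _ (H.memR _) _ (H.memR _)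
  have bS : ∀ j, |D.halfS (lam * h) h u k j| ≤ K := fun j =>
    B.S_le k _ (fun i => H.memU i _) _ (H.memR _)
  let θ : ℤ → ℝ := fun j => h / 8 * (slope h (u k) j - slope h (u k) (j + 1))
        - lam * (D.F k (U (j + 1)) (R (j + 1)) - D.F k (U j) (R (j + 1)))
  let E : ℤ → ℝ := fun j => -lam * (D.g k (U j) * diff W j)
    + lam * h / 2 * (D.halfS (lam * h) h u k (j + 1) + D.halfS (lam * h) h u k j)
  have hst : D.stag (lam * h) h u k = fun j => (u k j + u k (j + 1)) / 2 + θ j + E j := by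
    funext j; exact stag_eq D hh u k j
  have hθ : ∀ j, |θ j| ≤ 1 / 2 * |diff (u k) j| + e k j := fun j => by
    have hF := B.F_lip k _ (H.memU k (j + 1)) _ (H.memU k j) _ (H.memR (j + 1)) _
      (H.memR (j + 1))
    simp only [sub_self, abs_zero, Finset.sum_const_zero, add_zero] at hF
    have hF' : |lam * (D.F k (U (j + 1)) (R (j + 1)) - D.F k (U j) (R (j + 1)))|
        ≤ 1 / 4 * |diff (u k) j| + e k j := by
      rw [abs_mul, abs_of_pos hlam]
      refine le_trans ?_ (hdU k j)
      rw [mul_assoc]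
      exact mul_le_mul_of_nonneg_left hF hlam.le
    have := abs_slope_diff_le hh (u k) j
    refine (abs_sub _ _).trans ?_
    linarith
  have hE : TVLE E (cE * A * h) := by
    refine (((tg.mul tW bg bW).const_mul (-lam)).add
      (((tS.shift 1).add tS).const_mul (lam * h / 2))).weaken (le_of_eq ?_)
    rw [abs_neg, abs_of_pos hlam, abs_of_pos (by positivity : 0 < lam * h / 2)]
    simp only [cE]; ring
  have bE : ∀ j, |E j| + e k j ≤ C * h := fun j => by
    have b1 : |-lam * (D.g k (U j) * diff W j)| ≤ lam * (K * (K * (m * C₀) * h)) := by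
      rw [abs_mul, abs_mul, abs_neg, abs_of_pos hlam]
      exact mul_le_mul_of_nonneg_left (mul_le_mul (bg j) (bW j) (abs_nonneg _) hK) hlam.le
    have b2 : |lam * h / 2 * (D.halfS (lam * h) h u k (j + 1) + D.halfS (lam * h) h u k j)|
        ≤ lam * h / 2 * (K + K) := by
      rw [abs_mul, abs_of_pos (by positivity : 0 < lam * h / 2)]
      gcongr; exact (abs_add_le _ _).trans (add_le_add (bS _) (bS _))
    have b3 := (abs_add_le _ _).trans (add_le_add b1 b2)
    have b4 : cB * h ≤ C * h := by gcongr
    have b5 := he' k j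
    have b6 : cB * h = lam * (K * (K * (m * C₀) * h)) + lam * h / 2 * (K + K) + C₀ * h := by
      simp only [cB]; ring
    simp only [E]
    linarith
  rw [hst]
  constructor
  · refine (tv_perturbed (s.tv k) hθ (he k) hE).weaken ?_
    calc _ = A + (2 * C₀ + cE) * (A * h) := by ring
      _ ≤ A + C * (A * h) := by gcongr
      _ = _ := by ring
  · exact fun lo hi hu j => mem_Icc_perturbed hu j (hθ j) (bE j)

end Data
end NT

namespace NT

/-! ### Step functions on the grid -/

/-- The index of the cell of width `h` that contains `x`. -/
def cell (h x : ℝ) : ℤ := ⌊x / h + 1 / 2⌋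

/-- The cell `[(j - 1/2) h, (j + 1/2) h)`. -/
def cellSet (h : ℝ) (j : ℤ) : Set ℝ := Ico ((j - 1 / 2 : ℝ) * h) ((j + 1 / 2 : ℝ) * h)

lemma measurable_cell (h : ℝ) : Measurable (cell h) :=
  Int.measurable_floor.comp ((measurable_id.div_const h).add_const _)

lemma measurableSet_cellSet (h : ℝ) (j : ℤ) : MeasurableSet (cellSet h j) := measurableSet_Ico

lemma cell_eq_iff {h : ℝ} (hh : 0 < h) {x : ℝ} {j : ℤ} : cell h x = j ↔ x ∈ cellSet h j := by
  rw [cell, Int.floor_eq_iff, cellSet, mem_Ico, ← le_div_iff₀ hh, ← div_lt_iff₀ hh]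
  constructor <;> rintro ⟨h1, h2⟩ <;> constructor <;> linarith

lemma volume_cellSet {h : ℝ} (j : ℤ) : volume (cellSet h j) = ENNReal.ofReal h := by
  rw [cellSet, Real.volume_Ico]; congr 1; ring

lemma abs_cell_mul_sub_le {h : ℝ} (hh : 0 < h) (x : ℝ) : |cell h x * h - x| ≤ h / 2 := by
  have := (cell_eq_iff hh (x := x)).1 rfl
  rw [cellSet, mem_Ico] at this
  rw [abs_le]; constructor <;> linarith

lemma lt_cell_iff {h : ℝ} (hh : 0 < h) {x : ℝ} {j : ℤ} :
    j < cell h x ↔ (j + 1 / 2 : ℝ) * h ≤ x := by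
  rw [cell, ← Int.add_one_le_iff, Int.le_floor, ← le_div_iff₀ hh]
  push_cast
  constructor <;> intro <;> linarith

lemma tendsto_cell_mul {ι : Type*} {l : Filter ι} {h : ι → ℝ} (hh : ∀ i, 0 < h i)
    (h0 : Tendsto h l (𝓝 0)) (x : ℝ) : Tendsto (fun i => cell (h i) x * h i) l (𝓝 x) := by
  rw [tendsto_iff_dist_tendsto_zero]
  refine squeeze_zero (fun _ => dist_nonneg) (fun i => ?_) h0
  rw [Real.dist_eq]
  exact (abs_cell_mul_sub_le (hh i) x).trans (by linarith [hh i])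

lemma integral_mul_step {h : ℝ} (hh : 0 < h) {f : ℝ → ℝ}
    (hf : ∀ j, IntegrableOn f (cellSet h j)) {g : ℤ → ℝ} {s : Finset ℤ}
    (hg : ∀ j ∉ s, g j = 0) :
    ∫ x, f x * g (cell h x) = ∑ j ∈ s, g j * ∫ x in cellSet h j, f x := by
  have e : ∀ x, f x * g (cell h x) = ∑ j ∈ s, g j * (cellSet h j).indicator f x := fun x => by
    by_cases hx : cell h x ∈ s
    · rw [Finset.sum_eq_single_of_mem _ hx, indicator_of_mem ((cell_eq_iff hh).1 rfl), mul_comm]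
      intro j _ hj
      rw [indicator_of_notMem, mul_zero]
      rw [← cell_eq_iff hh]; exact hj.symm
    · rw [hg _ hx, mul_zero]
      refine (Finset.sum_eq_zero fun j hj => ?_).symm
      rw [indicator_of_notMem, mul_zero]
      rw [← cell_eq_iff hh]; rintro rfl; exact hx hj
  simp only [e]
  rw [integral_finsetSum]
  · refine Finset.sum_congr rfl fun j _ => ?_
    rw [integral_const_mul, integral_indicator (measurableSet_cellSet h j)]
  · exact fun j _ => ((integrable_indicator_iff (measurableSet_cellSet h j)).2 (hf j)).const_mul _

lemma integral_step {h : ℝ} (hh : 0 < h) {g : ℤ → ℝ} {s : Finset ℤ} (hg : ∀ j ∉ s, g j = 0) :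
    ∫ x, g (cell h x) = h * ∑ j ∈ s, g j := by
  have hv : ∀ j, volume (cellSet h j) ≠ ⊤ := fun j => by
    rw [volume_cellSet]; exact ENNReal.ofReal_ne_top
  have := integral_mul_step hh (f := fun _ => 1)
    (fun j => integrableOn_const (hv j)) hg
  simp only [one_mul, setIntegral_const, smul_eq_mul, mul_one, measureReal_def,
    volume_cellSet, ENNReal.toReal_ofReal hh.le] at this
  rw [this, Finset.mul_sum]
  exact Finset.sum_congr rfl fun _ _ => mul_comm _ _

/-- Integral of a step function with summable values. -/
lemma SumLE.lintegral_le {a : ℤ → ℝ} {A h : ℝ} (ha : SumLE a A) (hh : 0 < h) :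
    ∫⁻ x, ENNReal.ofReal (a (cell h x)) ≤ ENNReal.ofReal (h * A) := by
  have e : ∀ x, ENNReal.ofReal (a (cell h x))
      = ∑' j, (cellSet h j).indicator (fun _ => ENNReal.ofReal (a j)) x := fun x => by
    rw [tsum_eq_single (cell h x), indicator_of_mem ((cell_eq_iff hh).1 rfl)]
    intro j hj
    rw [indicator_of_notMem]
    rw [← cell_eq_iff hh]; exact hj.symm
  simp only [e]
  rw [lintegral_tsum fun j => (measurable_const.indicator (measurableSet_cellSet h j)).aemeasurable]
  simp only [lintegral_indicator (measurableSet_cellSet h _), lintegral_const,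
    Measure.restrict_apply MeasurableSet.univ, univ_inter, volume_cellSet]
  rw [ENNReal.tsum_mul_right, mul_comm, ENNReal.ofReal_mul hh.le]
  gcongr
  rw [ENNReal.tsum_eq_iSup_sum]
  refine iSup_le fun s => ?_
  rw [← ENNReal.ofReal_sum_of_nonneg fun j _ => ha.1 j]
  exact ENNReal.ofReal_le_ofReal (ha.2 s)

/-- Convergence of the integrals of step functions on refining grids. -/
lemma tendsto_integral_step {ι : Type*} {l : Filter ι} [l.IsCountablyGenerated] {h : ι → ℝ}
    (hh : ∀ i, 0 < h i) (h0 : Tendsto h l (𝓝 0)) {G : ι → ℤ → ℝ} {g : ℝ → ℝ} {K r : ℝ}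
    (hK : ∀ᶠ i in l, ∀ j, |G i j| ≤ K) (hr : ∀ᶠ i in l, ∀ j : ℤ, r < |j * h i| → G i j = 0)
    (hg : ∀ᵐ y, Tendsto (fun i => G i (cell (h i) y)) l (𝓝 (g y))) :
    Tendsto (fun i => ∫ y, G i (cell (h i) y)) l (𝓝 (∫ y, g y)) := by
  refine tendsto_integral_filter_of_dominated_convergence
    ((Icc (-(r + 1)) (r + 1)).indicator fun _ => K) ?_ ?_ ?_ hg
  · exact Eventually.of_forall fun i =>
      (measurable_from_top.comp (measurable_cell (h i))).aestronglyMeasurable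
  · filter_upwards [hK, hr, h0.eventually (Iio_mem_nhds one_pos)] with i h1 h2 h3
    refine Eventually.of_forall fun y => ?_
    by_cases hy : y ∈ Icc (-(r + 1)) (r + 1)
    · rw [indicator_of_mem hy]; exact h1 _
    · rw [indicator_of_notMem hy, h2, norm_zero]
      have h4 := abs_cell_mul_sub_le (hh i) y
      have h5 : r + 1 < |y| := by
        by_contra hc; exact hy (abs_le.1 (not_lt.1 hc))
      have h6 := abs_sub_abs_le_abs_sub y (cell (h i) y * h i)
      rw [abs_sub_comm] at h6
      linarith
  · exact (integrable_indicator_iff measurableSet_Icc).2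
      (integrableOn_const (by rw [Real.volume_Icc]; exact ENNReal.ofReal_ne_top))

/-! ### Convergence of the quadrature rule -/

/-- The quadrature rules of grid functions that converge almost everywhere converge to the
integral against the kernel. -/
lemma tendsto_quad {ι : Type*} {l : Filter ι} [l.IsCountablyGenerated] {h : ι → ℝ}
    (hh : ∀ i, 0 < h i) (h0 : Tendsto h l (𝓝 0)) {n₁ n₂ : ι → ℤ} {η₁ η₂ : ℝ}
    (e₁ : ∀ i, n₁ i * h i = -η₁) (e₂ : ∀ i, n₂ i * h i = η₂) {w : ℝ → ℝ} {K M : ℝ}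
    (hwK : ∀ x, |w x| ≤ K) (hwc : ContinuousOn w (Icc η₁ η₂)) (hw0 : ∀ x ∉ Icc η₁ η₂, w x = 0)
    {a b c : ι → ℤ → ℝ} (ha : ∀ᶠ i in l, ∀ j, |a i j| ≤ M) (hb : ∀ᶠ i in l, ∀ j, |b i j| ≤ M)
    (hc : ∀ᶠ i in l, ∀ j, |c i j| ≤ M) {x : ℝ} {j : ι → ℤ}
    (hj : Tendsto (fun i => j i * h i) l (𝓝 x)) {ρ : ℝ → ℝ}
    (hρ : ∀ᵐ y, Tendsto (fun i => b i (cell (h i) y)) l (𝓝 (ρ y))) :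
    Tendsto (fun i => quad (h i) (n₁ i) (n₂ i) w (a i) (b i) (c i) (j i)) l
      (𝓝 (∫ y, w (y - x) * ρ y)) := by
  have hK : 0 ≤ K := (abs_nonneg _).trans (hwK 0)
  -- the boundary cells contribute nothing in the limit
  have bd : ∀ (d : ι → ℤ → ℝ) (p : ι → ℤ) (z : ι → ℝ), (∀ᶠ i in l, ∀ j, |d i j| ≤ M) →
      Tendsto (fun i => h i / 2 * d i (p i) * w (z i)) l (𝓝 0) := fun d p z hd => by
    have : Tendsto (fun i => h i * (|M| * K)) l (𝓝 0) := by simpa using h0.mul_const (|M| * K)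
    refine squeeze_zero_norm' ?_ this
    filter_upwards [hd] with i hi
    rw [Real.norm_eq_abs, abs_mul, abs_mul, abs_of_pos (half_pos (hh i)), mul_assoc]
    have := hh i
    exact mul_le_mul (by linarith) (mul_le_mul ((hi _).trans (le_abs_self M)) (hwK _)
      (abs_nonneg _) (abs_nonneg _)) (by positivity) this.le
  -- the inner cells as a step function
  let G : ι → ℤ → ℝ := fun i p =>
    if p ∈ Finset.Icc (j i - n₁ i + 1) (j i + n₂ i - 1) then b i p * w ((p - j i) * h i) else 0
  have mid : ∀ i, h i * ∑ p ∈ Finset.Icc (-(n₁ i)) (n₂ i - 2),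
      b i (j i + p + 1) * w ((p + 1) * h i) = ∫ y, G i (cell (h i) y) := fun i => by
    rw [integral_step (hh i) (s := Finset.Icc (j i - n₁ i + 1) (j i + n₂ i - 1))
      (fun p hp => by simp only [G, if_neg hp])]
    congr 1
    refine Finset.sum_nbij (fun p => j i + p + 1) ?_ ?_ ?_ ?_
    · intro p hp; simp only [Finset.mem_Icc] at *; omega
    · intro p _ q _ hpq; simpa using hpq
    · intro p hp
      simp only [Finset.coe_Icc, mem_Icc, mem_image] at *
      exact ⟨p - j i - 1, by omega, by omega⟩
    · intro p hp
      have : j i + p + 1 ∈ Finset.Icc (j i - n₁ i + 1) (j i + n₂ i - 1) := by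
        simp only [Finset.mem_Icc] at *; omega
      simp only [G, if_pos this]
      push_cast; congr 2; ring
  have key : Tendsto (fun i => ∫ y, G i (cell (h i) y)) l (𝓝 (∫ y, w (y - x) * ρ y)) := by
    refine tendsto_integral_step (K := |M| * K) (r := |x| + 1 + |η₁| + |η₂|) hh h0 ?_ ?_ ?_
    · filter_upwards [hb] with i hi p
      by_cases hp : p ∈ Finset.Icc (j i - n₁ i + 1) (j i + n₂ i - 1)
      · simp only [G, if_pos hp, abs_mul]
        exact mul_le_mul ((hi p).trans (le_abs_self M)) (hwK _) (abs_nonneg _) (abs_nonneg _)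
      · simp only [G, if_neg hp, abs_zero]; positivity
    · filter_upwards [(hj.abs).eventually (Iio_mem_nhds (lt_add_one |x|))] with i hi p hp
      simp only [G]
      rw [if_neg]
      intro hmem
      rw [Finset.mem_Icc] at hmem
      have m1 : (j i : ℝ) - n₁ i + 1 ≤ p := by exact_mod_cast hmem.1
      have m2 : (p : ℝ) ≤ j i + n₂ i - 1 := by exact_mod_cast hmem.2
      have m3 := mul_le_mul_of_nonneg_right m1 (hh i).le
      have m4 := mul_le_mul_of_nonneg_right m2 (hh i).le
      have := hh i
      have hi' := abs_le.1 hi.le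
      have : |p * h i| ≤ |x| + 1 + |η₁| + |η₂| := by
        have q1 := neg_abs_le η₁
        have q2 := le_abs_self η₂
        have q3 := abs_nonneg η₁
        have q4 := abs_nonneg η₂
        rw [abs_le]; constructor <;> nlinarith [e₁ i, e₂ i]
      linarith
    · -- the end points of the support are exceptional
      have hne : ∀ z : ℝ, ∀ᵐ y, y ≠ z := fun z => by
        simp [ae_iff]
      filter_upwards [hρ, hne (x + η₁), hne (x + η₂)] with y hy n1 n2
      have t : Tendsto (fun i => ((cell (h i) y : ℝ) - j i) * h i) l (𝓝 (y - x)) := by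
        simpa only [sub_mul] using (tendsto_cell_mul hh h0 y).sub hj
      by_cases hin : y - x ∈ Ioo η₁ η₂
      · have hev : ∀ᶠ i in l, G i (cell (h i) y)
            = b i (cell (h i) y) * w (((cell (h i) y : ℝ) - j i) * h i) := by
          filter_upwards [t.eventually (Ioo_mem_nhds hin.1 hin.2)] with i hi
          have := hh i
          simp only [G]
          rw [if_pos]
          have i1 : -(n₁ i : ℝ) < cell (h i) y - j i := by
            refine lt_of_mul_lt_mul_right ?_ (hh i).le
            linarith [hi.1, e₁ i]
          have i2 : (cell (h i) y : ℝ) - j i < n₂ i := by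
            refine lt_of_mul_lt_mul_right ?_ (hh i).le
            linarith [hi.2, e₂ i]
          have i1' : -(n₁ i) < cell (h i) y - j i := by exact_mod_cast i1
          have i2' : cell (h i) y - j i < n₂ i := by exact_mod_cast i2
          rw [Finset.mem_Icc]; omega
        refine Tendsto.congr' (hev.mono fun _ hi => hi.symm) ?_
        rw [mul_comm]
        exact hy.mul ((hwc.continuousAt (Icc_mem_nhds hin.1 hin.2)).tendsto.comp t)
      · have hout : y - x < η₁ ∨ η₂ < y - x := by
          by_contra hcon
          push Not at hcon
          refine hin ⟨lt_of_le_of_ne hcon.1 ?_, lt_of_le_of_ne hcon.2 ?_⟩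
          · intro h; apply n1; linarith
          · intro h; apply n2; linarith
        have hz : w (y - x) = 0 := hw0 _ fun hm => by
          rcases hout with h | h
          · exact absurd hm.1 (not_le.2 h)
          · exact absurd hm.2 (not_le.2 h)
        rw [hz, zero_mul]
        have hev : ∀ᶠ i in l, G i (cell (h i) y) = 0 := by
          have : ∀ᶠ i in l, ((cell (h i) y : ℝ) - j i) * h i < η₁ ∨
              η₂ < ((cell (h i) y : ℝ) - j i) * h i := by
            rcases hout with h | h
            · exact (t.eventually (Iio_mem_nhds h)).mono fun _ => Or.inl
            · exact (t.eventually (Ioi_mem_nhds h)).mono fun _ => Or.inr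
          filter_upwards [this] with i hi
          simp only [G]
          split_ifs with hm
          · rw [hw0, mul_zero]
            intro hm'
            rcases hi with h | h
            · exact absurd hm'.1 (not_le.2 h)
            · exact absurd hm'.2 (not_le.2 h)
          · rfl
        exact tendsto_const_nhds.congr' (hev.mono fun _ hi => hi.symm)
  have := ((bd a (fun i => j i - n₁ i) (fun i => h i / 4 - n₁ i * h i) ha).add key).add
    (bd c (fun i => j i + n₂ i) (fun i => n₂ i * h i - h i / 4) hc)
  rw [zero_add, add_zero] at this
  refine this.congr fun i => ?_
  rw [← mid]; rfl

namespace Data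

variable {N m : ℕ} {D : Data N m} {ρM LF : ℝ}

lemma Assumption.N₁_mul {h : ℝ} (hD : D.Assumption ρM LF) (hh : D.AdmissibleStep h) (ℓ : Fin m)
    (k : Fin N) : (D.N₁ h ℓ k : ℝ) * h = -D.η₁ ℓ k := by
  rw [(hh.2 ℓ k).1, div_mul_cancel₀ _ hh.1.ne', abs_of_nonpos (hD.η₁_nonpos ℓ k)]

lemma AdmissibleStep.N₂_mul {h : ℝ} (hh : D.AdmissibleStep h) (ℓ : Fin m)
    (k : Fin N) : (D.N₂ h ℓ k : ℝ) * h = D.η₂ ℓ k := by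
  rw [(hh.2 ℓ k).2, div_mul_cancel₀ _ hh.1.ne']

/-- For small steps, the quadrature rules almost reproduce the mass of the kernels. -/
lemma Assumption.eventually_mass (hD : D.Assumption ρM LF) {δ : ℝ} (hδ : 0 < δ) (ℓ : Fin m)
    (k : Fin N) : ∀ᶠ h in 𝓝 (0 : ℝ), D.AdmissibleStep h →
      quad h (D.N₁ h ℓ k) (D.N₂ h ℓ k) (D.ω ℓ k) 1 1 1 0 ≤ 1 + δ := by
  obtain ⟨K, B⟩ := D.exists_bounds hD
  let l : Filter {h // D.AdmissibleStep h} := comap (fun h => (h : ℝ)) (𝓝 0)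
  have t := tendsto_quad (l := l) (h := fun h => (h : ℝ)) (fun h => h.2.1) tendsto_comap
    (n₁ := fun h => D.N₁ h ℓ k) (n₂ := fun h => D.N₂ h ℓ k)
    (fun h => hD.N₁_mul h.2 ℓ k) (fun h => h.2.N₂_mul ℓ k) (B.ω_le ℓ k)
    (hD.ω_C1 ℓ k).continuousOn (fun x hx => ω_eq_zero hD ℓ k hx) (M := 1)
    (a := fun _ => 1) (b := fun _ => 1) (c := fun _ => 1) (by simp) (by simp) (by simp)
    (x := 0) (j := fun _ => 0) (by simpa using tendsto_const_nhds) (ρ := fun _ => 1)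
    (Eventually.of_forall fun _ => tendsto_const_nhds)
  simp only [sub_zero, mul_one, hD.ω_integral] at t
  have := t.eventually (Iic_mem_nhds (by linarith : (1 : ℝ) < 1 + δ))
  rw [eventually_comap] at this
  filter_upwards [this] with h hh hadm
  exact hh ⟨h, hadm⟩ rfl

/-! ### The initial values -/

lemma init_eq (D : Data N m) {h : ℝ} (hh : 0 < h) (k : Fin N) (j : ℤ) :
    D.init h k j = 1 / h * ∫ x in cellSet h j, D.ρ₀ k x := by
  rw [init, intervalIntegral.integral_of_le (by nlinarith), integral_Ioc_eq_integral_Ioo, cellSet,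
    integral_Ico_eq_integral_Ioo]

lemma Assumption.init_mem (hD : D.Assumption ρM LF) {h : ℝ} (hh : 0 < h) (k : Fin N) (j : ℤ) :
    D.init h k j ∈ Icc 0 ρM := by
  rw [init_eq D hh]
  have hi : IntegrableOn (D.ρ₀ k) (cellSet h j) := (hD.ρ₀_L1BV k).1.integrableOn
  have hv : volume (cellSet h j) ≠ ⊤ := by rw [volume_cellSet]; exact ENNReal.ofReal_ne_top
  constructor
  · refine mul_nonneg (by positivity) (integral_nonneg_of_ae ?_)
    exact ae_restrict_of_ae ((hD.ρ₀_range k).mono fun x hx => hx.1)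
  · have : ∫ x in cellSet h j, D.ρ₀ k x ≤ ∫ _ in cellSet h j, ρM :=
      integral_mono_ae hi (integrableOn_const hv)
        (ae_restrict_of_ae ((hD.ρ₀_range k).mono fun x hx => hx.2.le))
    rw [setIntegral_const, measureReal_def, volume_cellSet, ENNReal.toReal_ofReal hh.le,
      smul_eq_mul] at this
    rw [one_div, inv_mul_le_iff₀ hh]; exact this

/-- Translates of a function of bounded variation along a grid. -/
lemma sum_abs_translates_le {f : ℝ → ℝ} (hf : BoundedVariationOn f univ) {h : ℝ} (hh : 0 < h)
    (y : ℝ) (s : Finset ℤ) :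
    ∑ j ∈ s, |f (y + (j + 1) * h) - f (y + j * h)| ≤ (eVariationOn f univ).toReal := by
  obtain ⟨L, hL⟩ : ∃ L : ℕ, s ⊆ Finset.Ico (-L : ℤ) L := by
    refine ⟨∑ j ∈ s, (j.natAbs + 1), fun j hj => ?_⟩
    have := Finset.single_le_sum (f := fun j : ℤ => j.natAbs + 1) (fun _ _ => Nat.zero_le _) hj
    rw [Finset.mem_Ico]; omega
  have hsum := eVariationOn.sum_le (f := f) (s := univ) (n := 2 * L)
    (u := fun i : ℕ => y + ((i : ℝ) - L) * h)
    (fun a b hab => by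
      have : (a : ℝ) ≤ b := by exact_mod_cast hab
      simp only; gcongr) (fun _ => mem_univ _)
  have e : ∑ i ∈ Finset.range (2 * L), edist (f (y + (((i + 1 : ℕ) : ℝ) - L) * h))
      (f (y + ((i : ℝ) - L) * h))
      = ENNReal.ofReal (∑ j ∈ Finset.Ico (-L : ℤ) L, |f (y + (j + 1) * h) - f (y + j * h)|) := by
    rw [ENNReal.ofReal_sum_of_nonneg fun _ _ => abs_nonneg _]
    refine Finset.sum_nbij (fun i : ℕ => (i : ℤ) - L) ?_ ?_ ?_ ?_
    · intro i hi; simp only [Finset.mem_range, Finset.mem_Ico] at *; omega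
    · intro i _ i' _ hii; simpa using hii
    · intro j hj
      simp only [Finset.coe_Ico, mem_Ico, Finset.coe_range, mem_image, mem_Iio] at *
      exact ⟨(j + L).toNat, by omega, by omega⟩
    · intro i _
      rw [edist_dist, Real.dist_eq]; push_cast; congr 5; ring
  rw [e] at hsum
  have h1 : ∑ j ∈ s, |f (y + (j + 1) * h) - f (y + j * h)|
      ≤ ∑ j ∈ Finset.Ico (-L : ℤ) L, |f (y + (j + 1) * h) - f (y + j * h)| :=
    Finset.sum_le_sum_of_subset_of_nonneg hL fun _ _ _ => abs_nonneg _
  exact h1.trans ((ENNReal.ofReal_le_iff_le_toReal hf).1 hsum)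

/-- The variation of the cell averages is bounded uniformly in the step. -/
lemma Assumption.exists_tv_init (hD : D.Assumption ρM LF) : ∃ A, 0 ≤ A ∧
    ∀ h, 0 < h → ∀ k, TVLE (D.init h k) A := by
  choose hint f hf hBV using hD.ρ₀_L1BV
  refine ⟨∑ k, (eVariationOn (f k) univ).toReal, Finset.sum_nonneg fun _ _ => ENNReal.toReal_nonneg,
    fun h hh k => ?_⟩
  have hfi : Integrable (f k) := (hint k).congr (hf k)
  refine SumLE.weaken (K := (eVariationOn (f k) univ).toReal)
    ⟨fun _ => abs_nonneg _, fun s => ?_⟩ (Finset.single_le_sum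
      (f := fun k => (eVariationOn (f k) univ).toReal) (fun _ _ => ENNReal.toReal_nonneg)
      (Finset.mem_univ k))
  have ei : ∀ j : ℤ, D.init h k j = 1 / h * ∫ y in (-(h / 2))..(h / 2), f k (y + j * h) :=
    fun j => by
    rw [init, intervalIntegral.integral_comp_add_right]
    congr 1
    rw [show -(h / 2) + j * h = (j - 1 / 2 : ℝ) * h by ring,
      show h / 2 + j * h = (j + 1 / 2 : ℝ) * h by ring]
    exact intervalIntegral.integral_congr_ae ((hf k).mono fun x hx _ => hx)
  have ii : ∀ c : ℝ, IntervalIntegrable (fun y => f k (y + c)) volume (-(h / 2)) (h / 2) :=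
    fun c => (hfi.comp_add_right c).intervalIntegrable
  have hd : ∀ j : ℤ, |diff (D.init h k) j|
      ≤ 1 / h * ∫ y in (-(h / 2))..(h / 2), |f k (y + (j + 1) * h) - f k (y + j * h)| :=
    fun j => by
    rw [diff, ei, ei, ← mul_sub, ← intervalIntegral.integral_sub (ii _) (ii _), abs_mul,
      abs_of_pos (by positivity : 0 < 1 / h)]
    gcongr
    push_cast
    exact intervalIntegral.abs_integral_le_integral_abs (by linarith)
  calc ∑ j ∈ s, |diff (D.init h k) j|
      ≤ ∑ j ∈ s, 1 / h * ∫ y in (-(h / 2))..(h / 2),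
          |f k (y + (j + 1) * h) - f k (y + j * h)| := Finset.sum_le_sum fun j _ => hd j
    _ = 1 / h * ∫ y in (-(h / 2))..(h / 2),
          ∑ j ∈ s, |f k (y + (j + 1) * h) - f k (y + j * h)| := by
        rw [← Finset.mul_sum, intervalIntegral.integral_finsetSum]
        exact fun j _ => ((ii _).sub (ii _)).abs
    _ ≤ 1 / h * ∫ _ in (-(h / 2))..(h / 2), (eVariationOn (f k) univ).toReal := by
        gcongr
        refine intervalIntegral.integral_mono_on (by linarith) ?_ (by simp)
          fun y _ => sum_abs_translates_le (hBV k) hh y s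
        exact intervalIntegrable_iff.2 (integrable_finsetSum s fun j _ =>
          intervalIntegrable_iff.1 ((ii _).sub (ii _)).abs)
    _ = (eVariationOn (f k) univ).toReal := by
        rw [intervalIntegral.integral_const, smul_eq_mul]; field_simp; ring

end Data
end NT

namespace NT
namespace Data

variable {N m : ℕ} {D : Data N m} {ρM LF K lam : ℝ}

/-! ### Uniform bounds on a short time interval -/

/-- The bounds for the discrete solutions that hold uniformly in the step up to the time `Ts`. -/
structure Uniform (D : Data N m) (ρM LF lam Ts A C h : ℝ) : Prop where
  adm : D.AdmissibleStep h
  state : ∀ n : ℕ, n * (lam * h) ≤ Ts → D.State ρM h (D.sol (lam * h) h n) A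
  half : ∀ n : ℕ, n * (lam * h) ≤ Ts → D.HalfState ρM LF lam C h (D.sol (lam * h) h n) A
  stag : ∀ n : ℕ, n * (lam * h) ≤ Ts → ∀ k,
    TVLE (D.stag (lam * h) h (D.sol (lam * h) h n) k) C

/-- In one step, the range grows by `C₂ h` on both sides and the variation by a factor `1 + C₂ h`.
The time `Ts` is such that the range grows by at most the margin `ε` of `State`. -/
theorem exists_uniform {T : ℝ} (hD : D.Assumption ρM LF) (hT : 0 < T) (hlam : 0 < lam)
    (hCFL : lam * LF ≤ (Real.sqrt 2 - 1) / 2) : ∃ Ts A C h₀ : ℝ, 0 < Ts ∧ Ts ≤ T ∧ 0 ≤ A ∧ 0 ≤ C ∧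
      0 < h₀ ∧ ∀ h, D.AdmissibleStep h → h < h₀ → D.Uniform ρM (max LF 0) lam Ts A C h := by
  obtain ⟨K, B⟩ := D.exists_bounds hD
  have hcfl : lam * max LF 0 ≤ (Real.sqrt 2 - 1) / 2 := by
    rcases max_cases LF 0 with ⟨h, _⟩ | ⟨h, _⟩ <;> rw [h]
    · exact hCFL
    · have : (1 : ℝ) ≤ Real.sqrt 2 := by rw [Real.one_le_sqrt]; norm_num
      linarith
  obtain ⟨C₁, hC₁, hHalf⟩ := ((eventually_ge_atTop 0).and
    (B.halfState hlam (cfl_quadratic hlam B.LF_nonneg hcfl))).exists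
  obtain ⟨C₂, hC₂, hStag⟩ := ((eventually_gt_atTop 0).and
    (B.stag_bounds hlam C₁ hC₁)).exists
  obtain ⟨A₀, hA₀, hInit⟩ := hD.exists_tv_init
  have hρ := hD.ρM_pos
  obtain ⟨hε, -, -⟩ := eps_bounds N hρ
  set ε := ρM / (100 * ((N : ℝ) + 1)) with hεd
  obtain ⟨A, hAd⟩ : ∃ A, A = A₀ * Real.exp (C₂ * (T / lam)) := ⟨_, rfl⟩
  have hA : 0 ≤ A := hAd ▸ by positivity
  have hδ : (0 : ℝ) < 1 / (32 * (N + 1)) := by positivity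
  obtain ⟨h₁, hh₁, hm⟩ : ∃ h₁ : ℝ, 0 < h₁ ∧ ∀ h, D.AdmissibleStep h → h < h₁ → ∀ ℓ k,
      quad h (D.N₁ h ℓ k) (D.N₂ h ℓ k) (D.ω ℓ k) 1 1 1 0 ≤ 1 + 1 / (32 * (N + 1)) := by
    have := eventually_all.2 fun ℓ => eventually_all.2 fun k => hD.eventually_mass hδ ℓ k
    obtain ⟨r, hr, hball⟩ := Metric.eventually_nhds_iff.1 this
    refine ⟨r, hr, fun h hh hhr ℓ k => hball ?_ ℓ k hh⟩
    rw [Real.dist_eq, sub_zero, abs_of_pos hh.1]; exact hhr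
  refine ⟨min T (ε * lam / C₂), A, max C₁ ((1 + C₂) * A),
    min h₁ (min 1 (ρM / 1000 / (C₁ * (1 + A) + 1))), by positivity, min_le_left _ _,
    hA, le_max_of_le_left hC₁, by positivity, fun h hh hlt => ?_⟩
  obtain ⟨hlt1, hlt2, hlt3⟩ : h < h₁ ∧ h < 1 ∧ h < ρM / 1000 / (C₁ * (1 + A) + 1) := by
    simpa using hlt
  have hpos := hh.1
  have hsmall : C₁ * h * (1 + A) ≤ ρM / 1000 := by
    rw [lt_div_iff₀ (by positivity)] at hlt3
    nlinarith
  -- the accumulated growth of the range and of the variation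
  have growth : ∀ n : ℕ, n * (lam * h) ≤ min T (ε * lam / C₂) →
      n * (C₂ * h) ≤ ε ∧ (1 + C₂ * h) ^ n * A₀ ≤ A := fun n hn => by
    have n1 : n * (lam * h) ≤ T := hn.trans (min_le_left _ _)
    have n2 : n * (lam * h) ≤ ε * lam / C₂ := hn.trans (min_le_right _ _)
    constructor
    · rw [le_div_iff₀ hC₂] at n2
      refine le_of_mul_le_mul_right ?_ hlam
      linarith
    · have e1 : (1 + C₂ * h) ^ n ≤ Real.exp (C₂ * (T / lam)) := by
        calc (1 + C₂ * h) ^ n ≤ Real.exp (C₂ * h) ^ n := by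
              gcongr; rw [add_comm]; exact Real.add_one_le_exp _
          _ = Real.exp (n * (C₂ * h)) := (Real.exp_nat_mul _ _).symm
          _ ≤ _ := by
              have : n * h ≤ T / lam := by rw [le_div_iff₀ hlam]; linarith
              rw [Real.exp_le_exp]; nlinarith
      rw [hAd, mul_comm]; gcongr
  have mk : ∀ n : ℕ, n * (lam * h) ≤ min T (ε * lam / C₂) → ∀ u : Fin N → ℤ → ℝ,
      (∀ k j, u k j ∈ Icc (-(n * (C₂ * h))) (ρM + n * (C₂ * h))) →
      ∀ A', 0 ≤ A' → (∀ k, TVLE (u k) A') → D.State ρM h u A' := fun n hn u hu A' hA' htv =>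
    ⟨hh, hlt2.le, fun k j => ⟨by linarith [(hu k j).1, (growth n hn).1],
      by linarith [(hu k j).2, (growth n hn).1]⟩, htv, hm h hh hlt1, hA'⟩
  have small : ∀ A', 0 ≤ A' → A' ≤ A → C₁ * h * (1 + A') ≤ ρM / 1000 := fun A' _ h2 =>
    (by gcongr : C₁ * h * (1 + A') ≤ C₁ * h * (1 + A)).trans hsmall
  have main : ∀ n : ℕ, n * (lam * h) ≤ min T (ε * lam / C₂) →
      (∀ k j, D.sol (lam * h) h n k j ∈ Icc (-(n * (C₂ * h))) (ρM + n * (C₂ * h))) ∧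
      ∀ k, TVLE (D.sol (lam * h) h n k) ((1 + C₂ * h) ^ n * A₀) := by
    intro n
    induction n with
    | zero =>
      intro _
      simp only [sol, Nat.cast_zero, zero_mul, neg_zero, add_zero, pow_zero, one_mul]
      exact ⟨fun k j => hD.init_mem hpos k j, fun k => hInit h hpos k⟩
    | succ n ih =>
      intro hn
      have hn' : n * (lam * h) ≤ min T (ε * lam / C₂) := by
        refine le_trans ?_ hn
        push_cast; nlinarith [mul_pos hlam hpos]
      obtain ⟨i1, i2⟩ := ih hn'
      have hA' : 0 ≤ (1 + C₂ * h) ^ n * A₀ := by positivity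
      have s := mk n hn' _ i1 _ hA' i2
      have H := hHalf _ _ _ s (small _ hA' (growth n hn').2)
      constructor
      · intro k j
        refine step_mem hpos _ (fun j => ?_) j
        have := (hStag _ _ _ s H k).2 _ _ (i1 k) j
        push_cast
        constructor <;> linarith [this.1, this.2]
      · intro k
        have := tv_step hpos _ (hStag _ _ _ s H k).1
        rw [← mul_assoc, ← pow_succ'] at this
        exact this
  have sA : ∀ n : ℕ, n * (lam * h) ≤ min T (ε * lam / C₂) →
      D.State ρM h (D.sol (lam * h) h n) A := fun n hn =>
    mk n hn _ (main n hn).1 _ hA fun k => ((main n hn).2 k).weaken (growth n hn).2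
  have hCC : C₁ ≤ max C₁ ((1 + C₂) * A) := le_max_left _ _
  refine ⟨hh, sA, fun n hn => ?_, fun n hn k => ?_⟩
  · have H := hHalf _ _ _ (sA n hn) (small A hA le_rfl)
    have hl : C₁ * h ≤ max C₁ ((1 + C₂) * A) * h := by gcongr
    obtain ⟨e, he1, he2, he3⟩ := H.diffU
    refine ⟨H.memU, H.memR, fun k j => (H.subU k j).trans (by gcongr),
      fun j ℓ => (H.subR j ℓ).trans (by gcongr), ⟨e, fun k => (he1 k).weaken (by gcongr),
        fun k j => (he2 k j).trans hl, he3⟩, fun k => (H.tvU k).weaken (by gcongr),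
      fun ℓ j => (H.diffR ℓ j).trans hl, fun ℓ => (H.tvR ℓ).weaken (by gcongr),
      fun ℓ => (H.tvDiffR ℓ).weaken (by gcongr)⟩
  · have H := hHalf _ _ _ (sA n hn) (small A hA le_rfl)
    refine (hStag _ _ _ (sA n hn) H k).1.weaken (le_max_of_le_right ?_)
    gcongr
    nlinarith

/-! ### The scheme as a perturbed conservation law -/

/-- The numerical viscosity of the scheme: the part of a time step that is due to averaging and to
the slopes is the difference of its values at the two sides of a cell. -/
def viscosity (D : Data N m) (τ h : ℝ) (u : Fin N → ℤ → ℝ) (k : Fin N) (j : ℤ) : ℝ :=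
  1 / 4 * diff (u k) j - 1 / 16 * (h * slope h (u k) (j + 1) + h * slope h (u k) j)
    - 1 / 8 * (h * slope h (D.stag τ h u k) j)

lemma step_sub_eq (D : Data N m) {h : ℝ} (hh : 0 < h) (u : Fin N → ℤ → ℝ) (k : Fin N) (j : ℤ) :
    D.step (lam * h) h u k j - u k j
      = (D.viscosity (lam * h) h u k j - D.viscosity (lam * h) h u k (j - 1))
        - lam / 2 * (D.halfF (lam * h) h u k (j + 1) - D.halfF (lam * h) h u k (j - 1))
        + lam * h / 4 * (D.halfS (lam * h) h u k (j + 1) + 2 * D.halfS (lam * h) h u k j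
          + D.halfS (lam * h) h u k (j - 1)) := by
  have e : lam * h / h = lam := by field_simp
  have h1 : D.stag (lam * h) h u k j = (u k j + u k (j + 1)) / 2
      + h / 8 * (slope h (u k) j - slope h (u k) (j + 1))
      - lam * (D.halfF (lam * h) h u k (j + 1) - D.halfF (lam * h) h u k j)
      + lam * h / 2 * (D.halfS (lam * h) h u k (j + 1) + D.halfS (lam * h) h u k j) := by
    rw [stag, e]
  have h2 : D.stag (lam * h) h u k (j - 1) = (u k (j - 1) + u k j) / 2
      + h / 8 * (slope h (u k) (j - 1) - slope h (u k) j)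
      - lam * (D.halfF (lam * h) h u k j - D.halfF (lam * h) h u k (j - 1))
      + lam * h / 2 * (D.halfS (lam * h) h u k j + D.halfS (lam * h) h u k (j - 1)) := by
    rw [stag, e, sub_add_cancel]
  rw [step, h1, h2]
  simp only [viscosity, diff, sub_add_cancel]
  ring

section

variable {Ts A C h : ℝ} {n : ℕ}

lemma Uniform.sumLE_viscosity (U : D.Uniform ρM LF lam Ts A C h) (hn : n * (lam * h) ≤ Ts)
    (k : Fin N) : SumLE (fun j => |D.viscosity (lam * h) h (D.sol (lam * h) h n) k j|)
      (A + C) := by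
  have hh := U.adm.1
  set u := D.sol (lam * h) h n
  refine SumLE.mono (SumLE.add ((U.state n hn).tv k) (U.stag n hn k)) (fun _ => abs_nonneg _)
    fun j => ?_
  have h1 := abs_mul_slope_le_left hh (u k) j
  have h2 := abs_mul_slope_le_right hh (u k) j
  have h3 := abs_mul_slope_le_right hh (D.stag (lam * h) h u k) j
  rw [abs_le] at *
  have h4 := neg_abs_le (diff (u k) j)
  have h5 := le_abs_self (diff (u k) j)
  simp only [viscosity]
  constructor <;> linarith

/-- The change in one time step is small, up to a summable part, whose sum is bounded. -/
lemma Uniform.exists_step_sub_le (U : D.Uniform ρM LF lam Ts A C h) (B : D.Bounds ρM LF K)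
    (hlam : 0 < lam) (hn : n * (lam * h) ≤ Ts) (k : Fin N) :
    ∃ b : ℤ → ℝ, SumLE b (2 * (A + C) + A + 2 * (C * A)) ∧
      ∀ j, |D.sol (lam * h) h (n + 1) k j - D.sol (lam * h) h n k j|
        ≤ b j + (C + lam * LF * (m * C) + lam * K) * h := by
  have hh := U.adm.1
  have hL := B.LF_nonneg
  have s := U.state n hn
  have H := U.half n hn
  have hv := U.sumLE_viscosity hn k
  obtain ⟨e, he, he', hdU⟩ := H.diffU
  change ∃ b : ℤ → ℝ, SumLE b _ ∧ ∀ j, |D.step (lam * h) h (D.sol (lam * h) h n) k j - _| ≤ _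
  set u := D.sol (lam * h) h n
  have dF : ∀ j, lam * |diff (D.halfF (lam * h) h u k) j|
      ≤ 1 / 4 * |diff (u k) j| + e k j + lam * LF * (m * (C * h)) := fun j => by
    have h1 := B.F_lip k _ (H.memU k (j + 1)) _ (H.memU k j) _ (H.memR (j + 1)) _ (H.memR j)
    have h2 : ∑ ℓ, |D.halfR (lam * h) h u (j + 1) ℓ - D.halfR (lam * h) h u j ℓ|
      ≤ m * (C * h) := sum_abs_le_card fun ℓ => H.diffR ℓ j
    have h3 := hdU k j
    calc lam * |diff (D.halfF (lam * h) h u k) j|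
        ≤ lam * (LF * (|D.halfU (lam * h) h u k (j + 1) - D.halfU (lam * h) h u k j|
          + ∑ ℓ, |D.halfR (lam * h) h u (j + 1) ℓ - D.halfR (lam * h) h u j ℓ|)) := by
          gcongr; exact h1
      _ = lam * LF * |diff (D.halfU (lam * h) h u k) j| + lam * LF *
          ∑ ℓ, |D.halfR (lam * h) h u (j + 1) ℓ - D.halfR (lam * h) h u j ℓ| := by
          simp only [diff]; ring
      _ ≤ _ := by gcongr
  have bS : ∀ j, |D.halfS (lam * h) h u k j| ≤ K := fun j =>
    B.S_le k _ (fun i => H.memU i _) _ (H.memR _)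
  have hd1 := SumLE.const_mul (s.tv k) (by norm_num : (0 : ℝ) ≤ 1 / 4)
  refine ⟨fun j => (|D.viscosity (lam * h) h u k j| + |D.viscosity (lam * h) h u k (j + -1)|)
    + 1 / 2 * ((1 / 4 * |diff (u k) j| + e k j)
      + (1 / 4 * |diff (u k) (j + -1)| + e k (j + -1))), ?_, fun j => ?_⟩
  · refine ((hv.add (hv.shift (-1))).add (((hd1.add (he k)).add ((hd1.shift (-1)).add
      ((he k).shift (-1)))).const_mul (by norm_num : (0 : ℝ) ≤ 1 / 2))).weaken ?_
    have : C * A * h ≤ C * A := mul_le_of_le_one_right (H.tvU k).nonneg s.h_le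
    have := (H.tvU k).nonneg
    linarith [s.A_nonneg]
  · rw [step_sub_eq D hh]
    have e1 : D.halfF (lam * h) h u k (j + 1) - D.halfF (lam * h) h u k (j - 1)
        = diff (D.halfF (lam * h) h u k) j + diff (D.halfF (lam * h) h u k) (j + -1) := by
      simp only [diff, ← sub_eq_add_neg, sub_add_cancel]; ring
    have f1 := dF j
    have f2 := dF (j + -1)
    have f3 : |lam / 2 * (D.halfF (lam * h) h u k (j + 1) - D.halfF (lam * h) h u k (j - 1))|
        ≤ 1 / 2 * (lam * |diff (D.halfF (lam * h) h u k) j|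
          + lam * |diff (D.halfF (lam * h) h u k) (j + -1)|) := by
      rw [e1, abs_mul, abs_of_pos (by positivity : 0 < lam / 2)]
      have := abs_add_le (diff (D.halfF (lam * h) h u k) j)
        (diff (D.halfF (lam * h) h u k) (j + -1))
      nlinarith
    have f4 : |lam * h / 4 * (D.halfS (lam * h) h u k (j + 1) + 2 * D.halfS (lam * h) h u k j
        + D.halfS (lam * h) h u k (j - 1))| ≤ lam * h / 4 * (4 * K) := by
      rw [abs_mul, abs_of_pos (by positivity : 0 < lam * h / 4)]
      gcongr
      have b1 := abs_le.1 (bS (j + 1))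
      have b2 := abs_le.1 (bS j)
      have b3 := abs_le.1 (bS (j - 1))
      rw [abs_le]; constructor <;> linarith
    have f5 := abs_sub (D.viscosity (lam * h) h u k j) (D.viscosity (lam * h) h u k (j - 1))
    have hC : 0 ≤ C * h := (he' k j).trans' ((he k).1 j)
    refine (abs_add_le _ _).trans
      ((add_le_add ((abs_sub _ _).trans (add_le_add f5 f3)) f4).trans ?_)
    rw [sub_eq_add_neg j 1]
    linarith

end

end Data
end NT

namespace NT

/-! ### A compactness criterion in `L¹` -/

open scoped ENNReal in
/-- A bounded sequence of functions is relatively compact in `L¹` of a finite measure if the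
functions are approximated, uniformly in the limit, by their values at countably many points:
a diagonal sequence converges at all of these points, and is a Cauchy sequence in `L¹`. -/
theorem exists_subseq_tendsto_L1 {X : Type*} [MeasurableSpace X] {μ : Measure X}
    [IsFiniteMeasure μ] {E : Type*} [NormedAddCommGroup E] [ProperSpace E] [CompleteSpace E]
    [MeasurableSpace E] [BorelSpace E] [SecondCountableTopology E] {v : ℕ → X → E}
    (hv : ∀ i, Measurable (v i)) {M : ℝ} (hM : ∀ i p, ‖v i p‖ ≤ M) {d : ℕ → X → X}
    (hd : ∀ q, Measurable (d q)) (hc : ∀ q, (range (d q)).Countable)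
    (happ : ∀ ε : ℝ≥0∞, 0 < ε → ∃ q, ∀ᶠ i in atTop, ∫⁻ p, ‖v i p - v i (d q p)‖ₑ ∂μ ≤ ε) :
    ∃ ψ : ℕ → ℕ, StrictMono ψ ∧ ∃ ρ : X → E, StronglyMeasurable ρ ∧
      Tendsto (fun i => ∫⁻ p, ‖v (ψ i) p - ρ p‖ₑ ∂μ) atTop (𝓝 0) := by
  let S : Set X := ⋃ q, range (d q)
  have hS : S.Countable := countable_iUnion hc
  have : Countable S := hS.to_subtype
  have hmem : ∀ q p, d q p ∈ S := fun q p => mem_iUnion.2 ⟨q, mem_range_self p⟩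
  obtain ⟨L, hL, ψ, hψ, hlim⟩ := (isCompact_univ_pi fun _ : S =>
    isCompact_closedBall (0 : E) M).tendsto_subseq (x := fun i (s : S) => v i s)
    (fun i s _ => by simpa using hM i s)
  rw [tendsto_pi_nhds] at hlim
  have hMv : ∀ i p, ‖v i p‖ₑ ≤ ENNReal.ofReal M := fun i p => by
    rw [← ofReal_norm]; exact ENNReal.ofReal_le_ofReal (hM i p)
  -- the sampled functions converge in `L¹`
  have hsamp : ∀ q, Tendsto (fun i => ∫⁻ p, ‖v (ψ i) (d q p) - L ⟨d q p, hmem q p⟩‖ₑ ∂μ) atTop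
      (𝓝 0) := fun q => by
    have hLm : Measurable fun p => L ⟨d q p, hmem q p⟩ :=
      measurable_of_tendsto_metrizable (fun i => (hv (ψ i)).comp (hd q))
        (tendsto_pi_nhds.2 fun p => hlim ⟨d q p, hmem q p⟩)
    have := tendsto_lintegral_of_dominated_convergence (μ := μ)
      (F := fun i p => ‖v (ψ i) (d q p) - L ⟨d q p, hmem q p⟩‖ₑ) (f := fun _ => 0)
      (fun _ => ENNReal.ofReal M + ENNReal.ofReal M)
      (fun i => (((hv (ψ i)).comp (hd q)).sub hLm).enorm)
      (fun i => Eventually.of_forall fun p => enorm_sub_le.trans (add_le_add (hMv _ _) ?_))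
      ?_ (Eventually.of_forall fun p => ?_)
    · simpa using this
    · have := hL ⟨d q p, hmem q p⟩ (mem_univ _)
      rw [mem_closedBall_zero_iff] at this
      rw [← ofReal_norm]; exact ENNReal.ofReal_le_ofReal this
    · rw [lintegral_const]
      exact ENNReal.mul_ne_top (by simp) (measure_ne_top _ _)
    · have h1 := (hlim ⟨d q p, hmem q p⟩).sub_const (L ⟨d q p, hmem q p⟩)
      rw [sub_self] at h1
      simpa using h1.enorm
  have hmemLp : ∀ i, MemLp (v (ψ i)) 1 μ := fun i =>
    MemLp.of_bound (hv _).aestronglyMeasurable M (Eventually.of_forall (hM _))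
  have hcauchy : CauchySeq fun i => (hmemLp i).toLp := by
    rw [EMetric.cauchySeq_iff]
    intro ε hε
    have hε5 : 0 < ε / 5 := ENNReal.div_pos hε.ne' (by simp)
    obtain ⟨q, hq⟩ := happ _ hε5
    have h1 := hψ.tendsto_atTop.eventually hq
    have h2 := (hsamp q).eventually (Iic_mem_nhds hε5)
    obtain ⟨I, hI⟩ := eventually_atTop.1 (h1.and h2)
    refine ⟨I, fun i hi j hj => ?_⟩
    rw [Lp.edist_toLp_toLp, eLpNorm_one_eq_lintegral_enorm]
    by_cases htop : ε = ⊤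
    · rw [htop]
      have := ((hmemLp i).sub (hmemLp j)).2
      rwa [eLpNorm_one_eq_lintegral_enorm] at this
    have hLm : Measurable fun p => L ⟨d q p, hmem q p⟩ :=
      measurable_of_tendsto_metrizable (fun i => (hv (ψ i)).comp (hd q))
        (tendsto_pi_nhds.2 fun p => hlim ⟨d q p, hmem q p⟩)
    have m1 : ∀ i, Measurable fun p => ‖v (ψ i) p - v (ψ i) (d q p)‖ₑ := fun i =>
      ((hv _).sub ((hv _).comp (hd q))).enorm
    have m2 : ∀ i, Measurable fun p => ‖v (ψ i) (d q p) - L ⟨d q p, hmem q p⟩‖ₑ := fun i =>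
      (((hv _).comp (hd q)).sub hLm).enorm
    have tri : ∀ p, ‖(v (ψ i) - v (ψ j)) p‖ₑ
        ≤ (‖v (ψ i) p - v (ψ i) (d q p)‖ₑ + ‖v (ψ i) (d q p) - L ⟨d q p, hmem q p⟩‖ₑ)
          + (‖v (ψ j) p - v (ψ j) (d q p)‖ₑ + ‖v (ψ j) (d q p) - L ⟨d q p, hmem q p⟩‖ₑ) :=
      fun p => by
      have e : (v (ψ i) - v (ψ j)) p = ((v (ψ i) p - v (ψ i) (d q p))
          + (v (ψ i) (d q p) - L ⟨d q p, hmem q p⟩))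
          - ((v (ψ j) p - v (ψ j) (d q p)) + (v (ψ j) (d q p) - L ⟨d q p, hmem q p⟩)) := by
        simp only [Pi.sub_apply]; abel
      rw [e]
      exact enorm_sub_le.trans (add_le_add (enorm_add_le _ _) (enorm_add_le _ _))
    have m12 : ∀ i, Measurable fun p => ‖v (ψ i) p - v (ψ i) (d q p)‖ₑ
        + ‖v (ψ i) (d q p) - L ⟨d q p, hmem q p⟩‖ₑ := fun i => (m1 i).add (m2 i)
    refine (lintegral_mono tri).trans_lt ?_
    rw [lintegral_add_left (m12 i), lintegral_add_left (m1 i),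
      lintegral_add_left (m1 j)]
    refine (add_le_add (add_le_add (hI i hi).1 (hI i hi).2)
      (add_le_add (hI j hj).1 (hI j hj).2)).trans_lt ?_
    -- four error terms of size at most `ε / 5` leave room for a strict inequality
    have h4 : ε / 5 + ε / 5 + (ε / 5 + ε / 5) = 4 * (ε / 5) := by ring
    have h5 : ε = 5 * (ε / 5) := (ENNReal.mul_div_cancel (by simp) (by simp)).symm
    rw [h4]; conv_rhs => rw [h5]
    exact ENNReal.mul_lt_mul_left hε5.ne' (ENNReal.div_ne_top htop (by simp)) (by norm_num)
  obtain ⟨f, hf⟩ := cauchySeq_tendsto_of_complete hcauchy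
  refine ⟨ψ, hψ, f, Lp.stronglyMeasurable f, ?_⟩
  rw [tendsto_iff_edist_tendsto_0] at hf
  refine hf.congr fun i => ?_
  rw [Lp.edist_def, eLpNorm_one_eq_lintegral_enorm]
  refine lintegral_congr_ae ?_
  filter_upwards [(hmemLp i).coeFn_toLp] with p hp
  rw [Pi.sub_apply, hp]

/-! ### Sampling step functions -/

/-- The largest multiple of `1/Q` that is at most `x`. -/
def sample (Q x : ℝ) : ℝ := ⌊x * Q⌋ / Q

lemma sample_le {Q : ℝ} (hQ : 0 < Q) (x : ℝ) : sample Q x ≤ x := by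
  rw [sample, div_le_iff₀ hQ]; exact Int.floor_le _

lemma lt_sample_add {Q : ℝ} (hQ : 0 < Q) (x : ℝ) : x < sample Q x + 1 / Q := by
  rw [sample, ← add_div, lt_div_iff₀ hQ]; exact Int.lt_floor_add_one _

lemma sample_nonneg {Q : ℝ} (hQ : 0 < Q) {x : ℝ} (hx : 0 ≤ x) : 0 ≤ sample Q x :=
  div_nonneg (by exact_mod_cast Int.floor_nonneg.2 (by positivity)) hQ.le

lemma measurable_sample (Q : ℝ) : Measurable (sample Q) :=
  (measurable_from_top (f := fun z : ℤ => (z : ℝ) / Q)).comp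
    (Int.measurable_floor.comp (measurable_id.mul_const Q))

lemma countable_range_sample (Q : ℝ) : (range (sample Q)).Countable :=
  (countable_range fun z : ℤ => (z : ℝ) / Q).mono
    (by rintro _ ⟨x, rfl⟩; exact ⟨⌊x * Q⌋, rfl⟩)

lemma cell_mono {h : ℝ} (hh : 0 < h) {x y : ℝ} (hxy : x ≤ y) : cell h x ≤ cell h y := by
  unfold cell; gcongr

lemma abs_sub_le_sum_diff (u : ℤ → ℝ) {a b : ℤ} (hab : a ≤ b) :
    |u b - u a| ≤ ∑ j ∈ Finset.Ico a b, |diff u j| := by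
  induction b, hab using Int.leInduction with
  | base => simp
  | succ b hab ih =>
    have e : Finset.Ico a (b + 1) = insert b (Finset.Ico a b) := by
      ext j; simp only [Finset.mem_Ico, Finset.mem_insert]; omega
    rw [e, Finset.sum_insert (by simp)]
    have : u (b + 1) - u a = diff u b + (u b - u a) := by simp only [diff]; ring
    rw [this]
    exact (abs_add_le _ _).trans (by gcongr)

/-- Sampling a step function at distance `1/Q` costs at most `1/Q` times its variation: each jump
is seen at most on an interval of length `1/Q`. -/
lemma TVLE.lintegral_sample_le {u : ℤ → ℝ} {A : ℝ} (hu : TVLE u A) {h Q : ℝ} (hh : 0 < h)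
    (hQ : 0 < Q) :
    ∫⁻ x, ‖u (cell h x) - u (cell h (sample Q x))‖ₑ ≤ ENNReal.ofReal (1 / Q * A) := by
  let S : ℤ → Set ℝ := fun j => {x | cell h (sample Q x) ≤ j ∧ j < cell h x}
  have hS : ∀ j, MeasurableSet (S j) := fun j =>
    (measurableSet_le ((measurable_cell h).comp (measurable_sample Q)) measurable_const).inter
      (measurableSet_lt measurable_const (measurable_cell h))
  have hvol : ∀ j, volume (S j) ≤ ENNReal.ofReal (1 / Q) := fun j => by
    have : S j ⊆ Ico ((j + 1 / 2 : ℝ) * h) ((j + 1 / 2 : ℝ) * h + 1 / Q) := by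
      rintro x ⟨h1, h2⟩
      refine ⟨(lt_cell_iff hh).1 h2, ?_⟩
      have h3 : sample Q x < (j + 1 / 2 : ℝ) * h := by
        by_contra hc
        exact absurd ((lt_cell_iff hh).2 (not_lt.1 hc)) (not_lt.2 h1)
      linarith [lt_sample_add hQ x]
    refine (measure_mono this).trans_eq ?_
    rw [Real.volume_Ico, add_sub_cancel_left]
  have hpt : ∀ x, ‖u (cell h x) - u (cell h (sample Q x))‖ₑ
      ≤ ∑' j, (S j).indicator (fun _ => ENNReal.ofReal |diff u j|) x := fun x => by
    rw [Real.enorm_eq_ofReal_abs]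
    refine (ENNReal.ofReal_le_ofReal (abs_sub_le_sum_diff u
      (cell_mono hh (sample_le hQ x)))).trans ?_
    rw [ENNReal.ofReal_sum_of_nonneg fun _ _ => abs_nonneg _]
    refine le_trans (Finset.sum_le_sum fun j hj => ?_)
      (ENNReal.sum_le_tsum (Finset.Ico (cell h (sample Q x)) (cell h x)))
    rw [indicator_of_mem (show x ∈ S j from Finset.mem_Ico.1 hj)]
  refine (lintegral_mono hpt).trans ?_
  rw [lintegral_tsum fun j => (measurable_const.indicator (hS j)).aemeasurable]
  simp only [lintegral_indicator (hS _), lintegral_const, Measure.restrict_apply MeasurableSet.univ,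
    univ_inter]
  calc ∑' j, ENNReal.ofReal |diff u j| * volume (S j)
      ≤ ∑' j, ENNReal.ofReal |diff u j| * ENNReal.ofReal (1 / Q) := by
        gcongr with j; exact hvol j
    _ = (∑' j, ENNReal.ofReal |diff u j|) * ENNReal.ofReal (1 / Q) := ENNReal.tsum_mul_right
    _ ≤ ENNReal.ofReal A * ENNReal.ofReal (1 / Q) := by
        gcongr
        rw [ENNReal.tsum_eq_iSup_sum]
        refine iSup_le fun s => ?_
        rw [← ENNReal.ofReal_sum_of_nonneg fun j _ => abs_nonneg _]
        exact ENNReal.ofReal_le_ofReal (hu.2 s)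
    _ = ENNReal.ofReal (1 / Q * A) := by
        rw [mul_comm, ENNReal.ofReal_mul (by positivity)]

/-! ### A finite measure on the strip -/

/-- The finite measure on `ℝ` with density `1 / (1 + x²)`. It bounds Lebesgue measure from above on
bounded sets, up to a factor, and makes constants integrable, so that no bound on the discrete
solutions in `L¹(ℝ)` is needed. -/
def weight : Measure ℝ := volume.withDensity fun x => ENNReal.ofReal ((1 + x ^ 2)⁻¹)

instance : IsFiniteMeasure weight :=
  isFiniteMeasure_withDensity_ofReal integrable_inv_one_add_sq.2

lemma weight_le : weight ≤ volume := by
  have : weight ≤ volume.withDensity 1 := by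
    refine withDensity_mono (Eventually.of_forall fun x => ?_)
    rw [Pi.one_apply, ENNReal.ofReal_le_one]
    exact inv_le_one_of_one_le₀ (by nlinarith)
  rwa [withDensity_one] at this

lemma measurable_weight_density : Measurable fun x : ℝ => ENNReal.ofReal ((1 + x ^ 2)⁻¹) := by
  fun_prop

lemma volume_absolutelyContinuous_weight : (volume : Measure ℝ) ≪ weight :=
  withDensity_absolutelyContinuous' measurable_weight_density.aemeasurable
    (Eventually.of_forall fun x => by
      rw [Ne, ENNReal.ofReal_eq_zero, not_le]; positivity)

/-- The strip `(0, T) × ℝ` with the weight `1 / (1 + x²)` in space. -/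
def stripMeasure (T : ℝ) : Measure (ℝ × ℝ) := (volume.restrict (Ioo 0 T)).prod weight

instance (T : ℝ) : IsFiniteMeasure (stripMeasure T) := by
  unfold stripMeasure; infer_instance

lemma volume_strip (T : ℝ) (s : Set ℝ) : (volume : Measure (ℝ × ℝ)).restrict (Ioo 0 T ×ˢ s)
    = (volume.restrict (Ioo 0 T)).prod (volume.restrict s) := by
  rw [Measure.prod_restrict]; rfl

lemma volume_strip_absolutelyContinuous (T : ℝ) :
    (volume : Measure (ℝ × ℝ)).restrict (Ioo 0 T ×ˢ univ) ≪ stripMeasure T := by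
  rw [volume_strip, Measure.restrict_univ]
  exact Measure.AbsolutelyContinuous.rfl.prod volume_absolutelyContinuous_weight

/-- On bounded sets, Lebesgue measure is dominated by the weighted measure. -/
lemma setLIntegral_box_le (T r : ℝ) {f : ℝ × ℝ → ENNReal} (hf : Measurable f) :
    ∫⁻ p in Ioo 0 T ×ˢ Icc (-r) r, f p
      ≤ ENNReal.ofReal (1 + r ^ 2) * ∫⁻ p, f p ∂stripMeasure T := by
  rw [volume_strip, lintegral_prod _ hf.aemeasurable, stripMeasure,
    lintegral_prod _ hf.aemeasurable, ← lintegral_const_mul _ hf.lintegral_prod_right']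
  refine lintegral_mono fun t => ?_
  have hft : Measurable fun x => f (t, x) := hf.comp measurable_prodMk_left
  rw [weight, lintegral_withDensity_eq_lintegral_mul _ measurable_weight_density hft,
    ← lintegral_const_mul _ (measurable_weight_density.mul hft)]
  refine (setLIntegral_mono' measurableSet_Icc fun x hx => ?_).trans
    (setLIntegral_le_lintegral (Icc (-r) r) _)
  rw [Pi.mul_apply, ← mul_assoc, ← ENNReal.ofReal_mul (by positivity)]
  refine le_mul_of_one_le_left zero_le ?_
  rw [ENNReal.one_le_ofReal, ← div_eq_mul_inv, one_le_div (by positivity)]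
  have : x ^ 2 ≤ r ^ 2 := sq_le_sq' hx.1 hx.2
  linarith

end NT

namespace NT

lemma measurable_grid (τ h : ℝ) (f : ℕ → ℤ → ℝ) :
    Measurable fun p : ℝ × ℝ => f ⌊p.1 / τ⌋₊ (cell h p.2) := by
  have h1 : Measurable fun p : ℝ × ℝ => (⌊p.1 / τ⌋₊, cell h p.2) :=
    (Nat.measurable_floor.comp (measurable_fst.div_const τ)).prodMk
      ((measurable_cell h).comp measurable_snd)
  exact (Measurable.of_discrete (f := fun q : ℕ × ℤ => f q.1 q.2)).comp h1

lemma enorm_le_ofReal_sum {N : ℕ} (x : Fin N → ℝ) : ‖x‖ₑ ≤ ENNReal.ofReal (∑ k, |x k|) := by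
  rw [← ofReal_norm]; exact ENNReal.ofReal_le_ofReal (norm_le_sum_abs x)

/-- The norm in `L¹` of a function that is bounded by the sum of a summable step function and a
constant. -/
lemma lintegral_weight_le {N : ℕ} {f : ℝ → Fin N → ℝ} {a : Fin N → ℤ → ℝ} {A c h : ℝ}
    (hh : 0 < h) (hc : 0 ≤ c) (hA : 0 ≤ A) (ha : ∀ k, SumLE (a k) A)
    (hf : ∀ x k, |f x k| ≤ a k (cell h x) + c) :
    ∫⁻ x, ‖f x‖ₑ ∂weight ≤ ENNReal.ofReal (N * (h * A + c * weight.real univ)) := by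
  have h1 : ∀ x, ‖f x‖ₑ ≤ ∑ k, (ENNReal.ofReal (a k (cell h x)) + ENNReal.ofReal c) := fun x => by
    refine (enorm_le_ofReal_sum (f x)).trans ?_
    rw [ENNReal.ofReal_sum_of_nonneg fun _ _ => abs_nonneg _]
    refine Finset.sum_le_sum fun k _ => ?_
    rw [← ENNReal.ofReal_add ((ha k).1 _) hc]
    exact ENNReal.ofReal_le_ofReal (hf x k)
  have hm : ∀ k, Measurable fun x => ENNReal.ofReal (a k (cell h x)) := fun k =>
    (measurable_from_top (f := fun j => ENNReal.ofReal (a k j))).comp (measurable_cell h)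
  refine (lintegral_mono h1).trans ?_
  rw [lintegral_finsetSum _ fun k _ => (hm k).add_const _]
  have h2 : ∀ k ∈ Finset.univ, ∫⁻ x, (ENNReal.ofReal (a k (cell h x)) + ENNReal.ofReal c) ∂weight
      ≤ ENNReal.ofReal (h * A + c * weight.real univ) := fun k _ => by
    rw [lintegral_add_left (hm k), lintegral_const,
      ENNReal.ofReal_add (by positivity) (by positivity)]
    refine add_le_add ((lintegral_mono' weight_le le_rfl).trans ((ha k).lintegral_le hh)) ?_
    rw [ENNReal.ofReal_mul hc, ofReal_measureReal]
  refine (Finset.sum_le_sum h2).trans_eq ?_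
  rw [Finset.sum_const, Finset.card_univ, Fintype.card_fin, nsmul_eq_mul,
    ENNReal.ofReal_mul (Nat.cast_nonneg N), ENNReal.ofReal_natCast]

lemma lintegral_strip_le {T : ℝ} {f : ℝ × ℝ → ENNReal} (hf : Measurable f) {G : ENNReal}
    (hG : ∀ t ∈ Ioo 0 T, ∫⁻ x, f (t, x) ∂weight ≤ G) :
    ∫⁻ p, f p ∂stripMeasure T ≤ G * ENNReal.ofReal T := by
  rw [stripMeasure, lintegral_prod _ hf.aemeasurable]
  refine (setLIntegral_mono' measurableSet_Ioo hG).trans_eq ?_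
  rw [setLIntegral_const, Real.volume_Ioo, sub_zero]

namespace Data

variable {N m : ℕ} {D : Data N m} {ρM LF K lam Ts A C : ℝ}

/-! ### Compactness of the discrete solutions -/

/-- The piecewise constant function on `[0, Ts] × ℝ` whose values are those of the grid functions
`f n`, `n ≥ 0`; it is `0` at all other times. -/
def stepFun (Ts τ h : ℝ) (f : ℕ → Fin N → ℤ → ℝ) (p : ℝ × ℝ) : Fin N → ℝ :=
  if p.1 ∈ Icc 0 Ts then fun k => f ⌊p.1 / τ⌋₊ k (cell h p.2) else 0

lemma measurable_stepFun (Ts τ h : ℝ) (f : ℕ → Fin N → ℤ → ℝ) :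
    Measurable (stepFun Ts τ h f) := by
  refine Measurable.ite (measurable_fst measurableSet_Icc) ?_ measurable_const
  exact measurable_pi_lambda _ fun k => measurable_grid τ h fun n j => f n k j

lemma floor_mul_le {τ t : ℝ} (hτ : 0 < τ) (ht : t ∈ Icc 0 Ts) : ⌊t / τ⌋₊ * τ ≤ Ts := by
  rw [← le_div_iff₀ hτ]
  exact (Nat.floor_le (div_nonneg ht.1 hτ.le)).trans (by gcongr; exact ht.2)

lemma stepFun_bound {τ h M : ℝ} (hτ : 0 < τ) (hM : 0 ≤ M) {f : ℕ → Fin N → ℤ → ℝ}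
    (hf : ∀ n : ℕ, n * τ ≤ Ts → ∀ k j, |f n k j| ≤ M) (p : ℝ × ℝ) :
    ‖stepFun Ts τ h f p‖ ≤ M := by
  unfold stepFun
  split_ifs with hp
  · exact (pi_norm_le_iff_of_nonneg hM).2 fun k => hf _ (floor_mul_le hτ hp) k _
  · simpa using hM

/-- The discrete solutions are Lipschitz in time on the scale of the time step. -/
lemma exists_time_bound (B : D.Bounds ρM LF K) (hlam : 0 < lam) (hA : 0 ≤ A) (hC : 0 ≤ C) :
    ∃ C', 0 ≤ C' ∧ ∀ h, D.Uniform ρM LF lam Ts A C h → ∀ n n' : ℕ, n ≤ n' →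
      n' * (lam * h) ≤ Ts →
      ∫⁻ x, ‖(fun k => D.sol (lam * h) h n' k (cell h x)) -
          (fun k => D.sol (lam * h) h n k (cell h x))‖ₑ ∂weight
        ≤ ENNReal.ofReal (C' * (((n' : ℝ) - n) * h)) := by
  have hL := B.LF_nonneg
  have hK : 0 ≤ K := by linarith [B.one_le]
  let c := C + lam * LF * (m * C) + lam * K
  have hc : 0 ≤ c := by positivity
  refine ⟨N * ((2 * (A + C) + A + 2 * (C * A)) + c * weight.real univ), by positivity,
    fun h U n n' hnn => ?_⟩
  have hh := U.adm.1
  induction n', hnn using Nat.le_induction with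
  | base => intro _; simp
  | succ n' hnn ih =>
    intro hn'
    have hn : n' * (lam * h) ≤ Ts := by
      refine le_trans ?_ hn'
      push_cast; nlinarith [mul_pos hlam hh]
    choose b hb hb' using U.exists_step_sub_le B hlam hn
    have h1 := lintegral_weight_le hh (mul_nonneg hc hh.le)
      (by positivity : 0 ≤ 2 * (A + C) + A + 2 * (C * A)) hb
      (f := fun x => (fun k => D.sol (lam * h) h (n' + 1) k (cell h x)) -
          (fun k => D.sol (lam * h) h n' k (cell h x))) fun x k => hb' k (cell h x)
    have hm : ∀ i, Measurable fun x : ℝ => fun k => D.sol (lam * h) h i k (cell h x) := fun i =>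
      measurable_pi_lambda _ fun k => (measurable_from_top (f := D.sol (lam * h) h i k)).comp
        (measurable_cell h)
    have tri : ∀ x, ‖(fun k => D.sol (lam * h) h (n' + 1) k (cell h x)) -
          (fun k => D.sol (lam * h) h n k (cell h x))‖ₑ
        ≤ ‖(fun k => D.sol (lam * h) h (n' + 1) k (cell h x)) -
          (fun k => D.sol (lam * h) h n' k (cell h x))‖ₑ
          + ‖(fun k => D.sol (lam * h) h n' k (cell h x)) -
          (fun k => D.sol (lam * h) h n k (cell h x))‖ₑ := fun x => by
      refine le_trans (le_of_eq ?_) (enorm_add_le _ _)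
      rw [sub_add_sub_cancel]
    refine (lintegral_mono tri).trans ?_
    have hmd : Measurable fun x => ‖(fun k => D.sol (lam * h) h (n' + 1) k (cell h x)) -
          (fun k => D.sol (lam * h) h n' k (cell h x))‖ₑ := ((hm _).sub (hm _)).enorm
    rw [lintegral_add_left hmd]
    refine (add_le_add h1 (ih hn)).trans_eq ?_
    have : (n : ℝ) ≤ n' := by exact_mod_cast hnn
    rw [← ENNReal.ofReal_add (by positivity) (by
      have : (0 : ℝ) ≤ n' - n := by linarith
      positivity)]
    congr 1; push_cast; ring

/-- The point of the sampling grid of mesh `1/Q` to the lower left of `p`. -/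
def samplePt (Q : ℝ) (p : ℝ × ℝ) : ℝ × ℝ := (sample Q p.1, sample Q p.2)

/-- Sampling on a grid of mesh `1/Q` approximates the discrete solutions uniformly in the step. -/
lemma exists_sample_bound (B : D.Bounds ρM LF K) (hlam : 0 < lam) (hA : 0 ≤ A) (hC : 0 ≤ C)
    (hTs : 0 < Ts) :
    ∃ C', 0 ≤ C' ∧ ∀ h, D.Uniform ρM LF lam Ts A C h → ∀ Q, 0 < Q →
      ∫⁻ p, ‖stepFun Ts (lam * h) h (D.sol (lam * h) h) p
        - stepFun Ts (lam * h) h (D.sol (lam * h) h) (samplePt Q p)‖ₑ ∂stripMeasure Ts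
        ≤ ENNReal.ofReal (C' * (1 / Q + h)) := by
  obtain ⟨C₁, hC₁, hT⟩ := exists_time_bound (Ts := Ts) B hlam hA hC
  refine ⟨(C₁ * (1 / lam + 1) + N * A) * Ts, by positivity, fun h U Q hQ => ?_⟩
  have hh := U.adm.1
  have hτ : 0 < lam * h := by positivity
  set v := stepFun Ts (lam * h) h (D.sol (lam * h) h) with hv
  have hvm : Measurable v := measurable_stepFun _ _ _ _
  have hsm : Measurable (samplePt Q) :=
    ((measurable_sample Q).comp measurable_fst).prodMk ((measurable_sample Q).comp measurable_snd)
  refine (lintegral_strip_le (G := ENNReal.ofReal ((C₁ * (1 / lam + 1) + N * A) * (1 / Q + h)))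
    (hvm.sub (hvm.comp hsm)).enorm fun t ht => ?_).trans_eq ?_
  · have ht' : t ∈ Icc 0 Ts := Ioo_subset_Icc_self ht
    have hs' : sample Q t ∈ Icc 0 Ts :=
      ⟨sample_nonneg hQ ht'.1, (sample_le hQ t).trans ht'.2⟩
    set n' := ⌊t / (lam * h)⌋₊ with hn'
    set n := ⌊sample Q t / (lam * h)⌋₊ with hn
    have hnn : n ≤ n' := Nat.floor_mono (by gcongr; exact sample_le hQ t)
    have hn'T : n' * (lam * h) ≤ Ts := floor_mul_le hτ ht'
    have hnT : n * (lam * h) ≤ Ts := floor_mul_le hτ hs'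
    have hm : ∀ i, Measurable fun x : ℝ => fun k => D.sol (lam * h) h i k (cell h x) := fun i =>
      measurable_pi_lambda _ fun k => (measurable_from_top (f := D.sol (lam * h) h i k)).comp
        (measurable_cell h)
    have tri : ∀ x, ‖v (t, x) - v (samplePt Q (t, x))‖ₑ
        ≤ ‖(fun k => D.sol (lam * h) h n' k (cell h x)) -
          (fun k => D.sol (lam * h) h n k (cell h x))‖ₑ
          + ‖(fun k => D.sol (lam * h) h n k (cell h x)) -
            (fun k => D.sol (lam * h) h n k (cell h (sample Q x)))‖ₑ := fun x => by
      refine le_trans (le_of_eq ?_) (enorm_add_le _ _)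
      rw [sub_add_sub_cancel]
      simp only [hv, stepFun, samplePt, if_pos ht', if_pos hs', hn, hn']
    refine (lintegral_mono tri).trans ?_
    have hmd : Measurable fun x => ‖(fun k => D.sol (lam * h) h n' k (cell h x)) -
          (fun k => D.sol (lam * h) h n k (cell h x))‖ₑ := ((hm _).sub (hm _)).enorm
    rw [lintegral_add_left hmd]
    have steps : ((n' : ℝ) - n) * h ≤ (1 / lam + 1) * (1 / Q + h) := by
      have a1 : (n' : ℝ) ≤ t / (lam * h) := Nat.floor_le (div_nonneg ht'.1 hτ.le)
      have a2 : sample Q t / (lam * h) < n + 1 := Nat.lt_floor_add_one _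
      have a3 := lt_sample_add hQ t
      have a4 : (n' : ℝ) - n ≤ (1 / Q) / (lam * h) + 1 := by
        have : t / (lam * h) ≤ sample Q t / (lam * h) + (1 / Q) / (lam * h) := by
          rw [← add_div]; gcongr
        linarith
      calc ((n' : ℝ) - n) * h ≤ ((1 / Q) / (lam * h) + 1) * h := by gcongr
        _ = 1 / lam * (1 / Q) + h := by field_simp
        _ ≤ _ := by
          have : 0 ≤ 1 / lam * h + 1 / Q := by positivity
          linarith
    have t1 := (hT h U n n' hnn hn'T).trans (ENNReal.ofReal_le_ofReal
      (mul_le_mul_of_nonneg_left steps hC₁))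
    have t2 : ∫⁻ x, ‖(fun k => D.sol (lam * h) h n k (cell h x)) -
            (fun k => D.sol (lam * h) h n k (cell h (sample Q x)))‖ₑ ∂weight
        ≤ ENNReal.ofReal (N * (1 / Q * A)) := by
      have p1 : ∀ x, ‖(fun k => D.sol (lam * h) h n k (cell h x)) -
            (fun k => D.sol (lam * h) h n k (cell h (sample Q x)))‖ₑ
          ≤ ∑ k, ‖D.sol (lam * h) h n k (cell h x)
            - D.sol (lam * h) h n k (cell h (sample Q x))‖ₑ := fun x => by
        refine (enorm_le_ofReal_sum _).trans_eq ?_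
        rw [ENNReal.ofReal_sum_of_nonneg fun _ _ => abs_nonneg _]
        simp only [Real.enorm_eq_ofReal_abs, Pi.sub_apply]
      refine (lintegral_mono' weight_le p1).trans ?_
      have mk : ∀ k, Measurable fun x => ‖D.sol (lam * h) h n k (cell h x)
          - D.sol (lam * h) h n k (cell h (sample Q x))‖ₑ := fun k => by
        have := (measurable_from_top (f := D.sol (lam * h) h n k)).comp (measurable_cell h)
        exact (this.sub (this.comp (measurable_sample Q))).enorm
      rw [lintegral_finsetSum _ fun k _ => mk k]
      refine (Finset.sum_le_sum fun k _ =>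
        ((U.state n hnT).tv k).lintegral_sample_le hh hQ).trans_eq ?_
      rw [Finset.sum_const, Finset.card_univ, Fintype.card_fin, nsmul_eq_mul,
        ENNReal.ofReal_mul (Nat.cast_nonneg N), ENNReal.ofReal_natCast]
    refine (add_le_add t1 t2).trans ?_
    rw [← ENNReal.ofReal_add (by positivity) (by positivity)]
    refine ENNReal.ofReal_le_ofReal ?_
    have : 0 ≤ N * A * h := by positivity
    linarith
  · rw [← ENNReal.ofReal_mul (by positivity)]; congr 1; ring

/-- A function that is bounded, in every time slice, by `O(h)` and a summable step function is
`O(h)` in `L¹` of the strip. -/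
lemma lintegral_strip_diff_le {h c G : ℝ} (hh : 0 < h) (hc : 0 ≤ c) (hG : 0 ≤ G)
    {f : ℝ × ℝ → Fin N → ℝ} (hf : Measurable f) {a : ℝ → Fin N → ℤ → ℝ}
    (ha : ∀ t ∈ Ioo 0 Ts, ∀ k, SumLE (a t k) G)
    (hfa : ∀ t ∈ Ioo 0 Ts, ∀ x k, |f (t, x) k| ≤ a t k (cell h x) + c * h) :
    ∫⁻ p, ‖f p‖ₑ ∂stripMeasure Ts
      ≤ ENNReal.ofReal ((N * (G + c * weight.real univ) * Ts) * h) := by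
  refine (lintegral_strip_le hf.enorm fun t ht => lintegral_weight_le hh (by positivity) hG
    (ha t ht) (hfa t ht)).trans_eq ?_
  rw [← ENNReal.ofReal_mul (by positivity)]; congr 1; ring

end Data
end NT

namespace NT

lemma exists_subseq_ae {X : Type*} [MeasurableSpace X] {μ : Measure X} {N : ℕ}
    {f : ℕ → X → Fin N → ℝ} {g : X → Fin N → ℝ} (hf : ∀ i, Measurable (f i))
    (hg : StronglyMeasurable g) (h : Tendsto (fun i => ∫⁻ p, ‖f i p - g p‖ₑ ∂μ) atTop (𝓝 0)) :
    ∃ ψ : ℕ → ℕ, StrictMono ψ ∧ ∀ᵐ p ∂μ, Tendsto (fun i => f (ψ i) p) atTop (𝓝 (g p)) := by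
  refine TendstoInMeasure.exists_seq_tendsto_ae (tendstoInMeasure_of_tendsto_eLpNorm one_ne_zero
    (fun i => (hf i).aestronglyMeasurable) hg.aestronglyMeasurable ?_)
  simpa only [eLpNorm_one_eq_lintegral_enorm, Pi.sub_apply] using h

/-- Functions with vanishing distance in `L¹` have the same limits in `L¹`. -/
lemma tendsto_L1_of_sub {X : Type*} [MeasurableSpace X] {μ : Measure X} {N : ℕ}
    {f g : ℕ → X → Fin N → ℝ} {ρ : X → Fin N → ℝ} (hf : ∀ i, Measurable (f i))
    (hg : ∀ i, Measurable (g i))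
    (hfg : Tendsto (fun i => ∫⁻ p, ‖g i p - f i p‖ₑ ∂μ) atTop (𝓝 0))
    (h : Tendsto (fun i => ∫⁻ p, ‖f i p - ρ p‖ₑ ∂μ) atTop (𝓝 0)) :
    Tendsto (fun i => ∫⁻ p, ‖g i p - ρ p‖ₑ ∂μ) atTop (𝓝 0) := by
  have := hfg.add h
  rw [add_zero] at this
  refine tendsto_of_tendsto_of_tendsto_of_le_of_le tendsto_const_nhds this
    (fun _ => zero_le) fun i => ?_
  have hm : Measurable fun p => ‖g i p - f i p‖ₑ := ((hg i).sub (hf i)).enorm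
  simp only
  rw [← lintegral_add_left hm]
  refine lintegral_mono fun p => le_trans (le_of_eq ?_) (enorm_add_le _ _)
  rw [sub_add_sub_cancel]

lemma tendsto_zero_of_le_ofReal_mul {G : ℕ → ENNReal} {c : ℝ} {h : ℕ → ℝ}
    (h0 : Tendsto h atTop (𝓝 0)) (hG : ∀ i, G i ≤ ENNReal.ofReal (c * h i)) :
    Tendsto G atTop (𝓝 0) := by
  have : Tendsto (fun i => ENNReal.ofReal (c * h i)) atTop (𝓝 0) := by
    simpa using ENNReal.tendsto_ofReal (h0.const_mul c)
  exact tendsto_of_tendsto_of_tendsto_of_le_of_le tendsto_const_nhds this (fun _ => zero_le) hG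

namespace Data

variable {N m : ℕ} {D : Data N m} {ρM LF K lam Ts A C : ℝ}

/-- The discrete solution as a piecewise constant function. -/
def solFun (D : Data N m) (Ts lam h : ℝ) : ℝ × ℝ → Fin N → ℝ :=
  stepFun Ts (lam * h) h (D.sol (lam * h) h)

/-- The values at half time steps as a piecewise constant function. -/
def halfFun (D : Data N m) (Ts lam h : ℝ) : ℝ × ℝ → Fin N → ℝ :=
  stepFun Ts (lam * h) h fun n => D.halfU (lam * h) h (D.sol (lam * h) h n)

lemma stepFun_of_mem {τ h t : ℝ} (ht : t ∈ Ioo 0 Ts) (f : ℕ → Fin N → ℤ → ℝ) (x : ℝ) (k : Fin N) :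
    stepFun Ts τ h f (t, x) k = f ⌊t / τ⌋₊ k (cell h x) := by
  rw [stepFun, if_pos (Ioo_subset_Icc_self ht)]

lemma measurable_approx (D : Data N m) (τ h : ℝ) : Measurable (D.approx τ h) := by
  refine measurable_pi_lambda _ fun k => ?_
  exact (measurable_grid τ h fun n j => D.sol τ h n k j).add
    ((measurable_grid τ h fun n j => slope h (D.sol τ h n k) j).mul
      (measurable_snd.sub ((measurable_grid τ h fun _ j => (j : ℝ)).mul_const h)))

/-- The linear reconstruction differs little from the piecewise constant one. -/
lemma exists_approx_sub_le (hlam : 0 < lam) (hA : 0 ≤ A) : ∃ c, ∀ h,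
    D.Uniform ρM LF lam Ts A C h →
      ∫⁻ p, ‖D.approx (lam * h) h p - D.solFun Ts lam h p‖ₑ ∂stripMeasure Ts
        ≤ ENNReal.ofReal (c * h) := by
  refine ⟨N * (A + 0 * weight.real univ) * Ts, fun h U => ?_⟩
  have hh := U.adm.1
  refine lintegral_strip_diff_le hh le_rfl hA
    ((measurable_approx D _ _).sub (measurable_stepFun _ _ _ _))
    (a := fun t k j => |diff (D.sol (lam * h) h ⌊t / (lam * h)⌋₊ k) j|) (fun t ht k =>
      (U.state _ (floor_mul_le (by positivity) (Ioo_subset_Icc_self ht))).tv k)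
    fun t ht x k => ?_
  rw [Pi.sub_apply, solFun, stepFun_of_mem ht, zero_mul, add_zero]
  simp only [approx]
  change |D.sol (lam * h) h ⌊t / (lam * h)⌋₊ k (cell h x) + slope h
    (D.sol (lam * h) h ⌊t / (lam * h)⌋₊ k) (cell h x) * (x - cell h x * h) - _| ≤ _
  rw [add_sub_cancel_left, abs_mul]
  have h1 := abs_mul_slope_le_right hh (D.sol (lam * h) h ⌊t / (lam * h)⌋₊ k) (cell h x)
  have h2 := abs_cell_mul_sub_le hh x
  rw [abs_sub_comm] at h2
  rw [abs_mul, abs_of_pos hh] at h1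
  refine le_trans ?_ h1
  rw [mul_comm]
  gcongr; linarith

/-- The densities at half time steps have the same limit, since they differ from those before by the
summable `|diff u|` and by `O(h)`. -/
lemma exists_half_sub_le (hlam : 0 < lam) (hA : 0 ≤ A) (hC : 0 ≤ C) : ∃ c, ∀ h,
    D.Uniform ρM LF lam Ts A C h →
      ∫⁻ p, ‖D.halfFun Ts lam h p - D.solFun Ts lam h p‖ₑ ∂stripMeasure Ts
        ≤ ENNReal.ofReal (c * h) := by
  refine ⟨N * (A + C * weight.real univ) * Ts, fun h U => ?_⟩
  have hh := U.adm.1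
  refine lintegral_strip_diff_le hh hC hA
    ((measurable_stepFun _ _ _ _).sub (measurable_stepFun _ _ _ _))
    (a := fun t k j => |diff (D.sol (lam * h) h ⌊t / (lam * h)⌋₊ k) j|) (fun t ht k =>
      (U.state _ (floor_mul_le (by positivity) (Ioo_subset_Icc_self ht))).tv k)
    fun t ht x k => ?_
  rw [Pi.sub_apply, solFun, halfFun, stepFun_of_mem ht, stepFun_of_mem ht]
  exact (U.half _ (floor_mul_le (by positivity) (Ioo_subset_Icc_self ht))).subU k _

/-- A subsequence of the discrete solutions converges in `L¹`; a further subsequence converges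
almost everywhere, also at half time steps. -/
theorem exists_limit (B : D.Bounds ρM LF K) (hlam : 0 < lam) (hA : 0 ≤ A) (hC : 0 ≤ C)
    (hTs : 0 < Ts) {h : ℕ → ℝ} (U : ∀ i, D.Uniform ρM LF lam Ts A C (h i))
    (h0 : Tendsto h atTop (𝓝 0)) :
    ∃ ψ : ℕ → ℕ, StrictMono ψ ∧ ∃ ρ : ℝ × ℝ → Fin N → ℝ, StronglyMeasurable ρ ∧
      Tendsto (fun i => ∫⁻ p, ‖D.approx (lam * h (ψ i)) (h (ψ i)) p - ρ p‖ₑ ∂stripMeasure Ts)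
        atTop (𝓝 0) ∧
      (∀ᵐ p ∂stripMeasure Ts, Tendsto (fun i => D.solFun Ts lam (h (ψ i)) p) atTop (𝓝 (ρ p))) ∧
      ∀ᵐ p ∂stripMeasure Ts, Tendsto (fun i => D.halfFun Ts lam (h (ψ i)) p) atTop (𝓝 (ρ p)) := by
  have hK : 0 ≤ K := by linarith [B.one_le]
  have hτ : ∀ i, 0 < lam * h i := fun i => mul_pos hlam (U i).adm.1
  have mv : ∀ i, Measurable (D.solFun Ts lam (h i)) := fun i => measurable_stepFun _ _ _ _
  have mw : ∀ i, Measurable (D.halfFun Ts lam (h i)) := fun i => measurable_stepFun _ _ _ _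
  obtain ⟨C', hC', hS⟩ := exists_sample_bound (D := D) (Ts := Ts) B hlam hA hC hTs
  obtain ⟨c₁, hc₁⟩ := exists_approx_sub_le (D := D) (ρM := ρM) (LF := LF) (Ts := Ts) (C := C)
    hlam hA
  obtain ⟨c₂, hc₂⟩ := exists_half_sub_le (D := D) (ρM := ρM) (LF := LF) (Ts := Ts) hlam hA hC
  obtain ⟨ψ₁, hψ₁, ρ, hρ, hlim⟩ := exists_subseq_tendsto_L1 (μ := stripMeasure Ts) mv
    (M := 2 * K) (fun i p => stepFun_bound (hτ i) (by positivity)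
      (fun n hn k j => ((U i).state n hn).abs_val_le B k j) p)
    (d := fun q => samplePt ((q : ℝ) + 1))
    (fun q => ((measurable_sample _).comp measurable_fst).prodMk
      ((measurable_sample _).comp measurable_snd))
    (fun q => ((countable_range_sample _).prod (countable_range_sample _)).mono
      (by rintro _ ⟨p, rfl⟩; exact ⟨⟨_, rfl⟩, ⟨_, rfl⟩⟩))
    (fun ε hε => by
      have t1 : Tendsto (fun q : ℕ => ENNReal.ofReal (C' * (1 / ((q : ℝ) + 1)))) atTop (𝓝 0) := by
        simpa using ENNReal.tendsto_ofReal
          (tendsto_one_div_add_atTop_nhds_zero_nat.const_mul C')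
      obtain ⟨q, hq⟩ := (t1.eventually (Iio_mem_nhds hε)).exists
      have t2 : Tendsto (fun i => ENNReal.ofReal (C' * (1 / ((q : ℝ) + 1) + h i))) atTop
          (𝓝 (ENNReal.ofReal (C' * (1 / ((q : ℝ) + 1))))) := by
        simpa using ENNReal.tendsto_ofReal ((h0.const_add (1 / ((q : ℝ) + 1))).const_mul C')
      refine ⟨q, ?_⟩
      filter_upwards [t2.eventually (Iio_mem_nhds hq)] with i hi
      exact (hS _ (U i) _ (by positivity)).trans (le_of_lt hi))
  obtain ⟨ψ₂, hψ₂, hae⟩ := exists_subseq_ae (fun i => mv (ψ₁ i)) hρ hlim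
  have h0₂ : Tendsto (fun i => h (ψ₁ (ψ₂ i))) atTop (𝓝 0) :=
    h0.comp (hψ₁.tendsto_atTop.comp hψ₂.tendsto_atTop)
  have hlim₂ : Tendsto (fun i => ∫⁻ p, ‖D.halfFun Ts lam (h (ψ₁ (ψ₂ i))) p - ρ p‖ₑ
      ∂stripMeasure Ts) atTop (𝓝 0) :=
    tendsto_L1_of_sub (fun i => mv _) (fun i => mw _)
      (tendsto_zero_of_le_ofReal_mul h0₂ fun i => hc₂ _ (U _)) (hlim.comp hψ₂.tendsto_atTop)
  obtain ⟨ψ₃, hψ₃, hae₃⟩ := exists_subseq_ae (fun i => mw _) hρ hlim₂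
  refine ⟨fun i => ψ₁ (ψ₂ (ψ₃ i)), hψ₁.comp (hψ₂.comp hψ₃), ρ, hρ, ?_, ?_, hae₃⟩
  · exact tendsto_L1_of_sub (fun i => mv _) (fun i => measurable_approx D _ _)
      (tendsto_zero_of_le_ofReal_mul (h0₂.comp hψ₃.tendsto_atTop) fun i => hc₁ _ (U _))
      (hlim.comp (hψ₂.tendsto_atTop.comp hψ₃.tendsto_atTop))
  · filter_upwards [hae] with p hp
    exact hp.comp hψ₃.tendsto_atTop

end Data
end NT

namespace NT

/-! ### The discrete weak formulation -/

lemma sum_shift {f : ℤ → ℝ} {L c : ℤ} (hc : |c| ≤ 1) (hf : ∀ j, L < |j| → f j = 0) :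
    ∑ j ∈ Finset.Icc (-(L + 1)) (L + 1), f (j + c) = ∑ j ∈ Finset.Icc (-(L + 1)) (L + 1), f j := by
  rw [abs_le] at hc
  refine Finset.sum_bij_ne_zero (fun j _ _ => j + c) ?_ ?_ ?_ ?_
  · intro j _ hj
    have : |j + c| ≤ L := not_lt.1 fun h => hj (hf _ h)
    rw [abs_le] at this
    rw [Finset.mem_Icc]; omega
  · intro a _ _ b _ _ hab; simpa using hab
  · intro j _ hj
    have : |j| ≤ L := not_lt.1 fun h => hj (hf _ h)
    rw [abs_le] at this
    exact ⟨j - c, by rw [Finset.mem_Icc]; omega, by simpa using hj, by simp⟩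
  · intro j _ _; rfl

/-- Summation by parts in space and time: the discrete weak formulation of a scheme in viscous
form. -/
lemma discrete_weak {u P F S φ : ℕ → ℤ → ℝ} {lam h : ℝ} {M : ℕ} {L : ℤ} (hh : 0 < h)
    (hlam : 0 < lam)
    (hu : ∀ n < M, ∀ j, u (n + 1) j - u n j = (P n j - P n (j - 1))
      - lam / 2 * (F n (j + 1) - F n (j - 1))
      + lam * h / 4 * (S n (j + 1) + 2 * S n j + S n (j - 1)))
    (hφ : ∀ n j, L < |j| → φ n j = 0) (hφM : ∀ j, φ M j = 0) :
    h * ∑ j ∈ Finset.Icc (-(L + 1)) (L + 1), u 0 j * φ 0 j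
      + lam * h * h * ∑ n ∈ Finset.range M, ∑ j ∈ Finset.Icc (-(L + 1)) (L + 1),
          u n j * ((φ (n + 1) j - φ n j) / (lam * h))
      + lam * h * h * ∑ n ∈ Finset.range M, ∑ j ∈ Finset.Icc (-(L + 1)) (L + 1),
          F n j * ((φ (n + 1) (j + 1) - φ (n + 1) (j - 1)) / (2 * h))
      + lam * h * h * ∑ n ∈ Finset.range M, ∑ j ∈ Finset.Icc (-(L + 1)) (L + 1),
          S n j * ((φ (n + 1) (j - 1) + 2 * φ (n + 1) j + φ (n + 1) (j + 1)) / 4)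
      + h * ∑ n ∈ Finset.range M, ∑ j ∈ Finset.Icc (-(L + 1)) (L + 1),
          P n j * (φ (n + 1) j - φ (n + 1) (j + 1)) = 0 := by
  set s := Finset.Icc (-(L + 1)) (L + 1)
  -- summation by parts in space
  have sp : ∀ n < M, ∑ j ∈ s, (u (n + 1) j - u n j) * φ (n + 1) j
      = ∑ j ∈ s, (P n j * (φ (n + 1) j - φ (n + 1) (j + 1))
        + lam / 2 * (F n j * (φ (n + 1) (j + 1) - φ (n + 1) (j - 1)))
        + lam * h / 4 * (S n j * (φ (n + 1) (j - 1) + 2 * φ (n + 1) j + φ (n + 1) (j + 1)))) := by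
    intro n hn
    have sh : ∀ (Q : ℤ → ℝ) (c : ℤ), |c| ≤ 1 →
        ∑ j ∈ s, Q j * φ (n + 1) (j + c) = ∑ j ∈ s, Q (j - c) * φ (n + 1) j := fun Q c hc => by
      have := sum_shift (f := fun j => Q (j - c) * φ (n + 1) j) hc
        (fun j hj => by rw [hφ _ _ hj, mul_zero])
      simpa only [add_sub_cancel_right] using this
    have p1 := sh (P n) 1 (by norm_num)
    have f1 := sh (F n) 1 (by norm_num)
    have f2 := sh (F n) (-1) (by norm_num)
    have s1 := sh (S n) 1 (by norm_num)
    have s2 := sh (S n) (-1) (by norm_num)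
    simp only [sub_neg_eq_add, ← sub_eq_add_neg] at f2 s2
    have e1 : ∑ j ∈ s, (u (n + 1) j - u n j) * φ (n + 1) j
        = ∑ j ∈ s, P n j * φ (n + 1) j - ∑ j ∈ s, P n (j - 1) * φ (n + 1) j
          - lam / 2 * (∑ j ∈ s, F n (j + 1) * φ (n + 1) j - ∑ j ∈ s, F n (j - 1) * φ (n + 1) j)
          + lam * h / 4 * (∑ j ∈ s, S n (j + 1) * φ (n + 1) j + 2 * ∑ j ∈ s, S n j * φ (n + 1) j
            + ∑ j ∈ s, S n (j - 1) * φ (n + 1) j) := by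
      simp only [Finset.mul_sum, ← Finset.sum_add_distrib, ← Finset.sum_sub_distrib]
      refine Finset.sum_congr rfl fun j _ => ?_
      rw [hu n hn]; ring
    rw [e1, ← p1, ← f1, ← f2, ← s1, ← s2]
    simp only [Finset.mul_sum, ← Finset.sum_add_distrib, ← Finset.sum_sub_distrib]
    exact Finset.sum_congr rfl fun j _ => by ring
  -- summation by parts in time
  have tm : ∑ n ∈ Finset.range M, (∑ j ∈ s, u n j * (φ (n + 1) j - φ n j)
      + ∑ j ∈ s, (u (n + 1) j - u n j) * φ (n + 1) j) = - ∑ j ∈ s, u 0 j * φ 0 j := by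
    have := Finset.sum_range_sub (fun n => ∑ j ∈ s, u n j * φ n j) M
    rw [show ∑ j ∈ s, u M j * φ M j = 0 from
      Finset.sum_eq_zero fun j _ => by rw [hφM, mul_zero], zero_sub] at this
    rw [← this]
    refine Finset.sum_congr rfl fun n _ => ?_
    rw [← Finset.sum_add_distrib, ← Finset.sum_sub_distrib]
    exact Finset.sum_congr rfl fun j _ => by ring
  rw [Finset.sum_congr rfl fun n hn => by rw [sp n (Finset.mem_range.1 hn)]] at tm
  rw [← neg_neg (∑ j ∈ s, u 0 j * φ 0 j), ← tm]
  simp only [Finset.mul_sum, ← Finset.sum_add_distrib, ← Finset.sum_neg_distrib]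
  refine Finset.sum_eq_zero fun n _ => Finset.sum_eq_zero fun j _ => ?_
  have hh' := hh.ne'
  field_simp
  ring

/-! ### Convergence of sums over the space-time grid -/

/-- The cells of the space-time grid are the level sets of the indices of the grid. -/
lemma mem_tile_iff {h τ : ℝ} (hh : 0 < h) (hτ : 0 < τ) {p : ℝ × ℝ} (hp : 0 ≤ p.1) {n : ℕ} {j : ℤ} :
    p ∈ Ico (n * τ) ((n + 1) * τ) ×ˢ cellSet h j ↔ ⌊p.1 / τ⌋₊ = n ∧ cell h p.2 = j := by
  rw [mem_prod, ← cell_eq_iff hh, Nat.floor_eq_iff (by positivity), le_div_iff₀ hτ, div_lt_iff₀ hτ,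
    mem_Ico]

/-- The integral of a step function over the strip. The function has to vanish
from the last, possibly incomplete time step on. -/
lemma integral_strip_step {Ts h τ : ℝ} (hh : 0 < h) (hτ : 0 < τ) (hTs : 0 < Ts)
    {G : ℕ → ℤ → ℝ} {s : Finset ℤ}
    (hs : ∀ n, ∀ j ∉ s, G n j = 0) (hn : ∀ n, ⌊Ts / τ⌋₊ ≤ n → ∀ j, G n j = 0) :
    ∫ p in Ioo 0 Ts ×ˢ univ, G ⌊p.1 / τ⌋₊ (cell h p.2)
      = τ * h * ∑ n ∈ Finset.range ⌊Ts / τ⌋₊, ∑ j ∈ s, G n j := by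
  have e0 : (volume : Measure (ℝ × ℝ)).restrict (Ioo 0 Ts ×ˢ univ)
      = volume.restrict (Ico 0 Ts ×ˢ univ) := by
    rw [volume_strip, Measure.restrict_congr_set Ioo_ae_eq_Ico, Measure.prod_restrict]; rfl
  have tile : ∀ n ∈ Finset.range ⌊Ts / τ⌋₊, ∀ j : ℤ,
      Ico (n * τ) ((n + 1) * τ) ×ˢ cellSet h j ⊆ Ico 0 Ts ×ˢ univ := fun n hn' j p hp => by
    have h1 : (n + 1 : ℝ) ≤ Ts / τ := by
      have := (Nat.le_floor_iff (by positivity)).1 (Nat.succ_le_of_lt (Finset.mem_range.1 hn'))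
      exact_mod_cast this
    rw [le_div_iff₀ hτ] at h1
    exact ⟨⟨le_trans (by positivity) hp.1.1, hp.1.2.trans_le h1⟩, mem_univ _⟩
  have e1 : ∀ p ∈ Ico 0 Ts ×ˢ (univ : Set ℝ), G ⌊p.1 / τ⌋₊ (cell h p.2)
      = ∑ n ∈ Finset.range ⌊Ts / τ⌋₊, ∑ j ∈ s,
        (Ico (n * τ) ((n + 1) * τ) ×ˢ cellSet h j).indicator (fun _ => G n j) p := fun p hp => by
    have hp0 : 0 ≤ p.1 := hp.1.1
    have hz : ∀ n j, ¬(⌊p.1 / τ⌋₊ = n ∧ cell h p.2 = j) →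
        (Ico (n * τ) ((n + 1) * τ) ×ˢ cellSet h j).indicator (fun _ => G n j) p = 0 :=
      fun n j hnj => indicator_of_notMem (by rwa [mem_tile_iff hh hτ hp0]) _
    have ho : (Ico ((⌊p.1 / τ⌋₊ : ℝ) * τ) ((⌊p.1 / τ⌋₊ + 1 : ℝ) * τ) ×ˢ
        cellSet h (cell h p.2)).indicator (fun _ => G ⌊p.1 / τ⌋₊ (cell h p.2)) p
        = G ⌊p.1 / τ⌋₊ (cell h p.2) :=
      indicator_of_mem ((mem_tile_iff hh hτ hp0).2 ⟨rfl, rfl⟩) _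
    rw [Finset.sum_eq_single ⌊p.1 / τ⌋₊, Finset.sum_eq_single (cell h p.2), ho]
    · exact fun j _ hj => hz _ _ fun hc => hj hc.2.symm
    · exact fun hj => by rw [ho]; exact hs _ _ hj
    · exact fun n _ hn' => Finset.sum_eq_zero fun j _ => hz _ _ fun hc => hn' hc.1.symm
    · exact fun hn' => Finset.sum_eq_zero fun j _ => by
        rw [hn _ (by simpa using hn') j]; simp
  have hm : ∀ (n : ℕ) (j : ℤ), MeasurableSet (Ico (n * τ) ((n + 1) * τ) ×ˢ cellSet h j) :=
    fun n j => measurableSet_Ico.prod (measurableSet_cellSet h j)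
  have hv : ∀ (n : ℕ) (j : ℤ), volume (Ico (n * τ) ((n + 1) * τ) ×ˢ cellSet h j)
      = ENNReal.ofReal (τ * h) := fun n j => by
    rw [Measure.volume_eq_prod, Measure.prod_prod, volume_cellSet, Real.volume_Ico,
      ← ENNReal.ofReal_mul (by nlinarith)]
    congr 1; ring
  rw [e0, setIntegral_congr_fun (measurableSet_Ico.prod MeasurableSet.univ) e1]
  have hi : ∀ n ∈ Finset.range ⌊Ts / τ⌋₊, ∀ j ∈ s, IntegrableOn
      ((Ico (n * τ) ((n + 1) * τ) ×ˢ cellSet h j).indicator fun _ => G n j)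
      (Ico 0 Ts ×ˢ univ) := fun n _ j _ =>
    ((integrable_indicator_iff (hm n j)).2
      (integrableOn_const (by rw [hv]; exact ENNReal.ofReal_ne_top))).integrableOn
  rw [integral_finsetSum _ fun n hn' => integrable_finsetSum _ fun j hj => hi n hn' j hj,
    Finset.mul_sum]
  refine Finset.sum_congr rfl fun n hn' => ?_
  rw [integral_finsetSum _ fun j hj => hi n hn' j hj, Finset.mul_sum]
  refine Finset.sum_congr rfl fun j _ => ?_
  rw [setIntegral_indicator (hm n j), inter_eq_self_of_subset_right (tile n hn' j),
    setIntegral_const, measureReal_def, hv, ENNReal.toReal_ofReal (by positivity), smul_eq_mul]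

lemma eventually_floor_lt {Ts t : ℝ} (ht : t ∈ Ioo 0 Ts) {τ : ℕ → ℝ} (hτ : ∀ i, 0 < τ i)
    (h0 : Tendsto τ atTop (𝓝 0)) : ∀ᶠ i in atTop, ⌊t / τ i⌋₊ < ⌊Ts / τ i⌋₊ := by
  filter_upwards [h0.eventually (Iio_mem_nhds (sub_pos.2 ht.2))] with i hi
  have := hτ i
  rw [← Nat.add_one_le_iff, ← Nat.floor_add_one (div_nonneg ht.1.le this.le)]
  refine Nat.floor_le_floor ?_
  rw [← sub_nonneg, show Ts / τ i - (t / τ i + 1) = (Ts - t - τ i) / τ i by field_simp; ring]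
  exact div_nonneg (by linarith) this.le

/-- Sums over the space-time grid converge to integrals over the strip, if the summands converge
almost everywhere. -/
lemma tendsto_sum_strip {Ts : ℝ} (hTs : 0 < Ts) {h τ : ℕ → ℝ} (hh : ∀ i, 0 < h i)
    (h1 : ∀ i, h i ≤ 1) (hτ : ∀ i, 0 < τ i) (h0 : Tendsto τ atTop (𝓝 0))
    {W Φ : ℕ → ℕ → ℤ → ℝ} {w f : ℝ × ℝ → ℝ} {K₁ K₂ r : ℝ} {s : ℕ → Finset ℤ}
    (hW : ∀ i (n : ℕ) j, n * τ i ≤ Ts → |W i n j| ≤ K₁) (hΦ : ∀ i n j, |Φ i n j| ≤ K₂)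
    (hr : ∀ i n (j : ℤ), r < |j * h i| → Φ i n j = 0) (hs : ∀ i, ∀ j ∉ s i, r < |j * h i|)
    (cW : ∀ᵐ p ∂volume.restrict (Ioo 0 Ts ×ˢ univ),
      Tendsto (fun i => W i ⌊p.1 / τ i⌋₊ (cell (h i) p.2)) atTop (𝓝 (w p)))
    (cΦ : ∀ p ∈ Ioo 0 Ts ×ˢ univ,
      Tendsto (fun i => Φ i ⌊p.1 / τ i⌋₊ (cell (h i) p.2)) atTop (𝓝 (f p))) :
    IntegrableOn (fun p => w p * f p) (Ioo 0 Ts ×ˢ univ) ∧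
    Tendsto (fun i => τ i * h i * ∑ n ∈ Finset.range ⌊Ts / τ i⌋₊, ∑ j ∈ s i, W i n j * Φ i n j)
      atTop (𝓝 (∫ p in Ioo 0 Ts ×ˢ univ, w p * f p)) := by
  set μ := (volume : Measure (ℝ × ℝ)).restrict (Ioo 0 Ts ×ˢ univ) with hμ
  have hms : MeasurableSet (Ioo 0 Ts ×ˢ (univ : Set ℝ)) := measurableSet_Ioo.prod MeasurableSet.univ
  have hK₂ : 0 ≤ K₂ := (abs_nonneg _).trans (hΦ 0 0 0)
  have hK₁ : 0 ≤ K₁ := (abs_nonneg _).trans (hW 0 0 0 (by simpa using hTs.le))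
  -- `W` is controlled only up to the time `Ts`, and is cut off there
  let G : ℕ → ℕ → ℤ → ℝ := fun i n j => if n < ⌊Ts / τ i⌋₊ then W i n j * Φ i n j else 0
  have hG : ∀ i n j, |G i n j| ≤ K₁ * K₂ := fun i n j => by
    simp only [G]
    split_ifs with hn
    · rw [abs_mul]
      refine mul_le_mul (hW i n j ?_) (hΦ i n j) (abs_nonneg _) hK₁
      rw [← le_div_iff₀ (hτ i)]
      exact (Nat.le_floor_iff (div_nonneg hTs.le (hτ i).le)).1 hn.le
    · rw [abs_zero]; positivity
  have hGr : ∀ i n (j : ℤ), r < |j * h i| → G i n j = 0 := fun i n j hj => by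
    simp only [G]
    rw [hr i n j hj, mul_zero, ite_self]
  have cG : ∀ᵐ p ∂μ, Tendsto (fun i => G i ⌊p.1 / τ i⌋₊ (cell (h i) p.2)) atTop
      (𝓝 (w p * f p)) := by
    filter_upwards [cW, ae_restrict_mem hms] with p hp hp'
    refine (hp.mul (cΦ p hp')).congr' ?_
    filter_upwards [eventually_floor_lt hp'.1 hτ h0] with i hi
    simp only [G]
    rw [if_pos hi]
  have mG : ∀ i, AEStronglyMeasurable (fun p : ℝ × ℝ => G i ⌊p.1 / τ i⌋₊ (cell (h i) p.2)) μ :=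
    fun i => (measurable_grid (τ i) (h i) (G i)).aestronglyMeasurable
  let b : ℝ × ℝ → ℝ := (univ ×ˢ Icc (-(r + 1)) (r + 1)).indicator fun _ => K₁ * K₂
  have hb : Integrable b μ := by
    refine (integrable_indicator_iff (MeasurableSet.univ.prod measurableSet_Icc)).2
      (integrableOn_const ?_)
    rw [hμ, volume_strip, Measure.restrict_univ, Measure.prod_prod, Measure.restrict_apply_univ,
      Real.volume_Ioo, Real.volume_Icc]
    exact ENNReal.mul_ne_top ENNReal.ofReal_ne_top ENNReal.ofReal_ne_top
  have hGb : ∀ i p, ‖G i ⌊p.1 / τ i⌋₊ (cell (h i) p.2)‖ ≤ b p := fun i p => by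
    by_cases hp : p ∈ univ ×ˢ Icc (-(r + 1)) (r + 1)
    · simp only [b]; rw [indicator_of_mem hp]; exact hG _ _ _
    · simp only [b]
      rw [indicator_of_notMem hp, hGr, norm_zero]
      have h4 := abs_cell_mul_sub_le (hh i) p.2
      have h5 : r + 1 < |p.2| := by
        by_contra hc; exact hp ⟨mem_univ _, abs_le.1 (not_lt.1 hc)⟩
      have h6 := abs_sub_abs_le_abs_sub p.2 (cell (h i) p.2 * h i)
      rw [abs_sub_comm] at h6
      linarith [h1 i]
  refine ⟨?_, ?_⟩
  · refine hb.mono' (aestronglyMeasurable_of_tendsto_ae atTop mG cG) ?_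
    filter_upwards [cG] with p hp
    exact le_of_tendsto hp.norm (Eventually.of_forall fun i => hGb i p)
  · have := tendsto_integral_of_dominated_convergence b mG hb
      (fun i => Eventually.of_forall (hGb i)) cG
    refine this.congr fun i => ?_
    rw [integral_strip_step (hh i) (hτ i) hTs (s := s i) (fun n j hj => hGr i n j (hs i j hj))
      (fun n hn j => if_neg hn.not_gt)]
    congr 1
    exact Finset.sum_congr rfl fun n hn => Finset.sum_congr rfl fun j _ =>
      if_pos (Finset.mem_range.1 hn)

/-! ### Test functions -/

lemma tendsto_difference_quotient {φ : ℝ × ℝ → ℝ} (hφ : ContDiff ℝ 1 φ) {p v : ℝ × ℝ}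
    {a : ℕ → ℝ × ℝ} {c : ℕ → ℝ} (ha : Tendsto a atTop (𝓝 p)) (hc : Tendsto c atTop (𝓝 0))
    (hc0 : ∀ i, c i ≠ 0) :
    Tendsto (fun i => (φ (a i + c i • v) - φ (a i)) / c i) atTop (𝓝 (fderiv ℝ φ p v)) := by
  have hs := (hφ.contDiffAt (x := p)).hasStrictFDerivAt one_ne_zero
  have hb : Tendsto (fun i => a i + c i • v) atTop (𝓝 p) := by
    simpa using ha.add (hc.smul_const v)
  have h1 := hs.isLittleO.comp_tendsto (hb.prodMk_nhds ha)
  have h2 : (fun i => a i + c i • v - a i) =O[atTop] c := by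
    refine Asymptotics.IsBigO.of_bound ‖v‖ (Eventually.of_forall fun i => ?_)
    rw [add_sub_cancel_left, norm_smul, mul_comm]
  have h3 := (h1.trans_isBigO h2).tendsto_div_nhds_zero
  have h4 := h3.add_const (fderiv ℝ φ p v)
  rw [zero_add] at h4
  refine h4.congr fun i => ?_
  have := hc0 i
  simp only [Function.comp_apply, add_sub_cancel_left, map_smul, smul_eq_mul]
  field_simp
  ring

/-- A test function is bounded, Lipschitz, and vanishes for large `|x|` and near the time `Ts`. -/
lemma exists_test_bounds {Ts : ℝ} {φ : ℝ × ℝ → ℝ} (hφ : ContDiff ℝ 1 φ)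
    (hc : HasCompactSupport φ) (hs : tsupport φ ⊆ Ioo (-42) Ts ×ˢ univ) :
    ∃ L r T' : ℝ, 0 ≤ L ∧ T' < Ts ∧ (∀ p q, |φ p - φ q| ≤ L * ‖p - q‖) ∧ (∀ p, |φ p| ≤ L) ∧
      (∀ t x, r < |x| → φ (t, x) = 0) ∧ ∀ t x, T' < t → φ (t, x) = 0 := by
  obtain ⟨L₁, hL₁⟩ := hφ.lipschitzWith_of_hasCompactSupport hc one_ne_zero
  obtain ⟨L₂, hL₂⟩ := hc.exists_bound_of_continuous hφ.continuous
  obtain ⟨r, hr⟩ := (hc.isCompact.image continuous_snd).isBounded.exists_norm_le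
  obtain ⟨T', hT', hT''⟩ : ∃ T' < Ts, ∀ p ∈ tsupport φ, p.1 ≤ T' := by
    rcases (tsupport φ).eq_empty_or_nonempty with he | hne
    · exact ⟨Ts - 1, by linarith, fun p hp => by simp [he] at hp⟩
    · obtain ⟨q, hq, hmax⟩ := hc.isCompact.exists_isMaxOn hne continuous_fst.continuousOn
      exact ⟨q.1, (hs hq).1.2, fun p hp => hmax hp⟩
  refine ⟨max L₁ L₂, r, T', le_max_of_le_left L₁.2, hT', fun p q => ?_,
    fun p => (hL₂ p).trans (le_max_right _ _), fun t x hx => ?_, fun t x ht => ?_⟩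
  · rw [← Real.norm_eq_abs]
    refine (hL₁.norm_sub_le p q).trans ?_
    gcongr
    exact le_max_left _ _
  · by_contra hne
    exact absurd (hr x ⟨_, subset_tsupport _ hne, rfl⟩) (not_le.2 hx)
  · by_contra hne
    exact absurd (hT'' _ (subset_tsupport _ hne)) (not_le.2 ht)

lemma tendsto_floor_mul {τ : ℕ → ℝ} (hτ : ∀ i, 0 < τ i) (h0 : Tendsto τ atTop (𝓝 0)) {t : ℝ}
    (ht : 0 ≤ t) : Tendsto (fun i => (⌊t / τ i⌋₊ : ℝ) * τ i) atTop (𝓝 t) := by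
  rw [tendsto_iff_dist_tendsto_zero]
  refine squeeze_zero (fun _ => dist_nonneg) (fun i => ?_) h0
  have h1 := Nat.floor_le (div_nonneg ht (hτ i).le)
  have h2 := Nat.lt_floor_add_one (t / τ i)
  rw [le_div_iff₀ (hτ i)] at h1
  rw [div_lt_iff₀ (hτ i)] at h2
  rw [Real.dist_eq, abs_le]
  constructor <;> linarith [hτ i]

end NT

namespace NT
namespace Data

variable {N m : ℕ} {D : Data N m} {ρM LF K lam Ts A C : ℝ} {h : ℕ → ℝ} {ρ : ℝ × ℝ → Fin N → ℝ}

/-! ### The limit solves the system -/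

/-- At the point `p` of the strip, the discrete densities, their values at half time steps, and the
discrete nonlocal terms at half time steps converge to the values of the limit `ρ`. -/
structure ConvergesAt (D : Data N m) (lam : ℝ) (h : ℕ → ℝ) (ρ : ℝ × ℝ → Fin N → ℝ) (p : ℝ × ℝ) :
    Prop where
  sol : ∀ k, Tendsto (fun i => D.sol (lam * h i) (h i) ⌊p.1 / (lam * h i)⌋₊ k (cell (h i) p.2))
    atTop (𝓝 (ρ p k))
  halfU : ∀ k, Tendsto (fun i => D.halfU (lam * h i) (h i)
    (D.sol (lam * h i) (h i) ⌊p.1 / (lam * h i)⌋₊) k (cell (h i) p.2)) atTop (𝓝 (ρ p k))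
  halfR : ∀ ℓ, Tendsto (fun i => D.halfR (lam * h i) (h i)
    (D.sol (lam * h i) (h i) ⌊p.1 / (lam * h i)⌋₊) (cell (h i) p.2) ℓ) atTop (𝓝 (D.nonlocal ρ p ℓ))

lemma ae_convergesAt (hD : D.Assumption ρM LF) {LF' : ℝ} (B : D.Bounds ρM LF' K) (hlam : 0 < lam)
    (U : ∀ i, D.Uniform ρM LF' lam Ts A C (h i)) (h0 : Tendsto h atTop (𝓝 0))
    (cs : ∀ᵐ p ∂stripMeasure Ts, Tendsto (fun i => D.solFun Ts lam (h i) p) atTop (𝓝 (ρ p)))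
    (ch : ∀ᵐ p ∂stripMeasure Ts, Tendsto (fun i => D.halfFun Ts lam (h i) p) atTop (𝓝 (ρ p))) :
    ∀ᵐ p ∂(volume : Measure (ℝ × ℝ)).restrict (Ioo 0 Ts ×ˢ univ), D.ConvergesAt lam h ρ p := by
  have hms : MeasurableSet (Ioo 0 Ts ×ˢ (univ : Set ℝ)) := measurableSet_Ioo.prod MeasurableSet.univ
  have hh : ∀ i, 0 < h i := fun i => (U i).adm.1
  have cs' := (volume_strip_absolutelyContinuous Ts).ae_le cs
  have ch' := (volume_strip_absolutelyContinuous Ts).ae_le ch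
  -- the nonlocal terms involve the values at all points with the same time
  have ct : ∀ᵐ p ∂(volume : Measure (ℝ × ℝ)).restrict (Ioo 0 Ts ×ˢ univ), ∀ᵐ y,
      Tendsto (fun i => D.solFun Ts lam (h i) (p.1, y)) atTop (𝓝 (ρ (p.1, y))) := by
    rw [volume_strip, Measure.restrict_univ] at cs' ⊢
    exact Measure.quasiMeasurePreserving_fst.ae (Measure.ae_ae_of_ae_prod cs')
  filter_upwards [cs', ch', ct, ae_restrict_mem hms] with p h1 h2 h3 h4
  have hfl : ∀ i, (⌊p.1 / (lam * h i)⌋₊ : ℝ) * (lam * h i) ≤ Ts := fun i =>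
    floor_mul_le (mul_pos hlam (hh i)) (Ioo_subset_Icc_self h4.1)
  refine ⟨fun k => ?_, fun k => ?_, fun ℓ => ?_⟩
  · refine (tendsto_pi_nhds.1 h1 k).congr fun i => ?_
    exact stepFun_of_mem h4.1 _ p.2 k
  · refine (tendsto_pi_nhds.1 h2 k).congr fun i => ?_
    exact stepFun_of_mem h4.1 _ p.2 k
  · have hv : Tendsto (fun i => D.vecR (h i) (D.sol (lam * h i) (h i) ⌊p.1 / (lam * h i)⌋₊)
        (cell (h i) p.2) ℓ) atTop (𝓝 (D.nonlocal ρ p ℓ)) := by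
      refine tendsto_finsetSum _ fun k _ => ?_
      have st := fun i => (U i).state _ (hfl i)
      refine tendsto_quad (M := 2 * K) hh h0 (fun i => hD.N₁_mul (U i).adm ℓ k)
        (fun i => (U i).adm.N₂_mul ℓ k) (B.ω_le ℓ k) (hD.ω_C1 ℓ k).continuousOn
        (fun x hx => ω_eq_zero hD ℓ k hx)
        (Eventually.of_forall fun i j => ((st i).slopes B k).1 j)
        (Eventually.of_forall fun i j => (st i).abs_val_le B k j)
        (Eventually.of_forall fun i j => ((st i).slopes B k).2.1 j)
        (tendsto_cell_mul hh h0 p.2) ?_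
      filter_upwards [h3] with y hy
      refine (tendsto_pi_nhds.1 hy k).congr fun i => ?_
      exact stepFun_of_mem h4.1 _ y k
    have hd : Tendsto (fun i => D.halfR (lam * h i) (h i)
        (D.sol (lam * h i) (h i) ⌊p.1 / (lam * h i)⌋₊) (cell (h i) p.2) ℓ
        - D.vecR (h i) (D.sol (lam * h i) (h i) ⌊p.1 / (lam * h i)⌋₊) (cell (h i) p.2) ℓ)
        atTop (𝓝 0) := by
      have : Tendsto (fun i => C * h i * (1 + A)) atTop (𝓝 0) := by
        simpa using (h0.const_mul C).mul_const (1 + A)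
      exact squeeze_zero_norm (fun i => ((U i).half _ (hfl i)).subR _ ℓ) this
    simpa using hd.add hv

lemma isClosed_nonlocalRange (N m : ℕ) (ρM : ℝ) : IsClosed (nonlocalRange N m ρM) := by
  rw [nonlocalRange_eq]; exact isClosed_Icc

namespace ConvergesAt

variable {p : ℝ × ℝ} {LF' : ℝ}

lemma mem_densityRange (c : D.ConvergesAt lam h ρ p) (U : ∀ i, D.Uniform ρM LF lam Ts A C (h i))
    (hlam : 0 < lam) (hp : p.1 ∈ Icc 0 Ts) (k : Fin N) : ρ p k ∈ densityRange ρM :=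
  isClosed_Icc.mem_of_tendsto (c.halfU k) (Eventually.of_forall fun i =>
    ((U i).half _ (floor_mul_le (mul_pos hlam (U i).adm.1) hp)).memU k _)

lemma mem_nonlocalRange (c : D.ConvergesAt lam h ρ p)
    (U : ∀ i, D.Uniform ρM LF lam Ts A C (h i)) (hlam : 0 < lam) (hp : p.1 ∈ Icc 0 Ts) :
    D.nonlocal ρ p ∈ nonlocalRange N m ρM :=
  (isClosed_nonlocalRange N m ρM).mem_of_tendsto (tendsto_pi_nhds.2 c.halfR)
    (Eventually.of_forall fun i =>
      ((U i).half _ (floor_mul_le (mul_pos hlam (U i).adm.1) hp)).memR _)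

lemma tendsto_halfF (c : D.ConvergesAt lam h ρ p) (B : D.Bounds ρM LF K)
    (U : ∀ i, D.Uniform ρM LF lam Ts A C (h i)) (hlam : 0 < lam) (hp : p.1 ∈ Icc 0 Ts)
    (k : Fin N) :
    Tendsto (fun i => D.halfF (lam * h i) (h i)
      (D.sol (lam * h i) (h i) ⌊p.1 / (lam * h i)⌋₊) k (cell (h i) p.2)) atTop
      (𝓝 (D.F k (ρ p k) (D.nonlocal ρ p))) := by
  have e1 := tendsto_iff_dist_tendsto_zero.1 (c.halfU k)
  have e2 := tendsto_finsetSum Finset.univ fun ℓ _ => tendsto_iff_dist_tendsto_zero.1 (c.halfR ℓ)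
  have e3 := (e1.add e2).const_mul LF
  simp only [Finset.sum_const_zero, add_zero, mul_zero, Real.dist_eq] at e3
  rw [tendsto_iff_dist_tendsto_zero]
  refine squeeze_zero (fun _ => dist_nonneg) (fun i => ?_) e3
  have H := (U i).half _ (floor_mul_le (mul_pos hlam (U i).adm.1) hp)
  exact B.F_lip k _ (H.memU k _) _ (c.mem_densityRange U hlam hp k) _ (H.memR _) _
    (c.mem_nonlocalRange U hlam hp)

lemma tendsto_halfS (c : D.ConvergesAt lam h ρ p) (B : D.Bounds ρM LF K)
    (U : ∀ i, D.Uniform ρM LF lam Ts A C (h i)) (hlam : 0 < lam) (hp : p.1 ∈ Icc 0 Ts)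
    (k : Fin N) :
    Tendsto (fun i => D.halfS (lam * h i) (h i)
      (D.sol (lam * h i) (h i) ⌊p.1 / (lam * h i)⌋₊) k (cell (h i) p.2)) atTop
      (𝓝 (D.S k (ρ p) (D.nonlocal ρ p))) := by
  have e1 := tendsto_finsetSum Finset.univ fun k _ => tendsto_iff_dist_tendsto_zero.1 (c.halfU k)
  have e2 := tendsto_finsetSum Finset.univ fun ℓ _ => tendsto_iff_dist_tendsto_zero.1 (c.halfR ℓ)
  have e3 := (e1.add e2).const_mul K
  simp only [Finset.sum_const_zero, add_zero, mul_zero, Real.dist_eq] at e3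
  rw [tendsto_iff_dist_tendsto_zero]
  refine squeeze_zero (fun _ => dist_nonneg) (fun i => ?_) e3
  have H := (U i).half _ (floor_mul_le (mul_pos hlam (U i).adm.1) hp)
  exact B.S_lip k _ _ (fun i => H.memU i _) (c.mem_densityRange U hlam hp) _ (H.memR _) _
    (c.mem_nonlocalRange U hlam hp)

end ConvergesAt

lemma HalfState.abs_halfF_le {u : Fin N → ℤ → ℝ} {h : ℝ} (H : D.HalfState ρM LF lam C h u A)
    (B : D.Bounds ρM LF K) (hF : ∀ k R, D.F k 0 R = 0) (k : Fin N) (j : ℤ) :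
    |D.halfF (lam * h) h u k j| ≤ LF * (2 * K) := by
  have h1 := B.F_lip k _ (H.memU k j) 0 (zero_mem_densityRange B.ρM_pos) _ (H.memR j) _ (H.memR j)
  simp only [hF, sub_self, abs_zero, Finset.sum_const_zero, add_zero, sub_zero] at h1
  refine h1.trans ?_
  have := H.memU k j
  rw [densityRange, mem_Icc] at this
  have h2 : |D.halfU (lam * h) h u k j| ≤ 2 * K := by
    rw [abs_le]; constructor <;> linarith [B.ρM_le, B.ρM_pos]
  exact mul_le_mul_of_nonneg_left h2 B.LF_nonneg

/-- The discrete initial values converge weakly to the initial datum. -/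
lemma tendsto_init (hD : D.Assumption ρM LF) (hh : ∀ i, 0 < h i) (h0 : Tendsto h atTop (𝓝 0))
    {φ : ℝ → ℝ} (hφ : Continuous φ) {L : ℝ} (hL : ∀ x, |φ x| ≤ L) {s : ℕ → Finset ℤ}
    (hs : ∀ i, ∀ j ∉ s i, φ (j * h i) = 0) (k : Fin N) :
    Tendsto (fun i => h i * ∑ j ∈ s i, D.init (h i) k j * φ (j * h i)) atTop
      (𝓝 (∫ x, D.ρ₀ k x * φ x)) := by
  have hi := (hD.ρ₀_L1BV k).1
  have t : Tendsto (fun i => ∫ x, D.ρ₀ k x * φ (cell (h i) x * h i)) atTop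
      (𝓝 (∫ x, D.ρ₀ k x * φ x)) := by
    refine tendsto_integral_of_dominated_convergence (fun x => |D.ρ₀ k x| * L) (fun i => ?_)
      (hi.abs.mul_const L) (fun i => Eventually.of_forall fun x => ?_)
      (Eventually.of_forall fun x => ?_)
    · refine hi.aestronglyMeasurable.mul (Measurable.aestronglyMeasurable ?_)
      exact (measurable_from_top (f := fun j : ℤ => φ (j * h i))).comp (measurable_cell (h i))
    · rw [norm_mul, Real.norm_eq_abs, Real.norm_eq_abs]
      exact mul_le_mul_of_nonneg_left (hL _) (abs_nonneg _)
    · exact ((hφ.tendsto x).comp (tendsto_cell_mul hh h0 x)).const_mul _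
  refine t.congr fun i => ?_
  rw [integral_mul_step (hh i) (g := fun j => φ (j * h i)) (fun j => hi.integrableOn) (hs i),
    Finset.mul_sum]
  refine Finset.sum_congr rfl fun j _ => ?_
  have := (hh i).ne'
  rw [init_eq D (hh i)]
  field_simp

/-- The numerical viscosity vanishes in the limit. -/
lemma tendsto_viscosity (hlam : 0 < lam) (hTs : 0 < Ts) (hA : 0 ≤ A) (hC : 0 ≤ C)
    (U : ∀ i, D.Uniform ρM LF lam Ts A C (h i)) (h0 : Tendsto h atTop (𝓝 0)) (k : Fin N)
    {ψ : ℕ → ℕ → ℤ → ℝ} {L : ℝ} (hL : 0 ≤ L)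
    (hψ : ∀ i n j, |ψ i n j - ψ i n (j + 1)| ≤ L * h i) (s : ℕ → Finset ℤ) :
    Tendsto (fun i => h i * ∑ n ∈ Finset.range ⌊Ts / (lam * h i)⌋₊, ∑ j ∈ s i,
      D.viscosity (lam * h i) (h i) (D.sol (lam * h i) (h i) n) k j
        * (ψ i n j - ψ i n (j + 1))) atTop (𝓝 0) := by
  have hlim : Tendsto (fun i => h i * (Ts / lam * (A + C) * L)) atTop (𝓝 0) := by
    simpa using h0.mul_const (Ts / lam * (A + C) * L)
  refine squeeze_zero_norm (fun i => ?_) hlim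
  have hh := (U i).adm.1
  have hτ : 0 < lam * h i := mul_pos hlam hh
  have h1 : ∀ n ∈ Finset.range ⌊Ts / (lam * h i)⌋₊, |∑ j ∈ s i,
      D.viscosity (lam * h i) (h i) (D.sol (lam * h i) (h i) n) k j * (ψ i n j - ψ i n (j + 1))|
      ≤ (A + C) * (L * h i) := fun n hn => by
    have hn' : (n : ℝ) * (lam * h i) ≤ Ts := by
      rw [← le_div_iff₀ hτ]
      exact (Nat.le_floor_iff (div_nonneg hTs.le hτ.le)).1 (Finset.mem_range.1 hn).le
    have hv := ((U i).sumLE_viscosity hn' k).2 (s i)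
    refine (Finset.abs_sum_le_sum_abs _ _).trans ?_
    calc ∑ j ∈ s i, |D.viscosity (lam * h i) (h i) (D.sol (lam * h i) (h i) n) k j
          * (ψ i n j - ψ i n (j + 1))|
        ≤ ∑ j ∈ s i, |D.viscosity (lam * h i) (h i) (D.sol (lam * h i) (h i) n) k j|
          * (L * h i) := Finset.sum_le_sum fun j _ => by
          rw [abs_mul]; exact mul_le_mul_of_nonneg_left (hψ i n j) (abs_nonneg _)
      _ ≤ _ := by rw [← Finset.sum_mul]; exact mul_le_mul_of_nonneg_right hv (by positivity)
  have h2 : (⌊Ts / (lam * h i)⌋₊ : ℝ) * (lam * h i) ≤ Ts := by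
    rw [← le_div_iff₀ hτ]; exact Nat.floor_le (div_nonneg hTs.le hτ.le)
  have h3 : (⌊Ts / (lam * h i)⌋₊ : ℝ) * h i ≤ Ts / lam := by
    rw [le_div_iff₀ hlam]; linarith
  rw [Real.norm_eq_abs, abs_mul, abs_of_pos hh]
  calc h i * |_| ≤ h i * ∑ n ∈ Finset.range ⌊Ts / (lam * h i)⌋₊, (A + C) * (L * h i) := by
        gcongr
        exact (Finset.abs_sum_le_sum_abs _ _).trans (Finset.sum_le_sum h1)
    _ = h i * (⌊Ts / (lam * h i)⌋₊ * h i * (A + C) * L) := by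
        rw [Finset.sum_const, Finset.card_range, nsmul_eq_mul]; ring
    _ ≤ _ := by gcongr

/-- Lax–Wendroff: a limit of the discrete solutions is a weak solution. -/
theorem isWeakSolution_of_tendsto (hD : D.Assumption ρM LF) {LF' : ℝ} (B : D.Bounds ρM LF' K)
    (hlam : 0 < lam) (hTs : 0 < Ts) (hA : 0 ≤ A) (hC : 0 ≤ C)
    (U : ∀ i, D.Uniform ρM LF' lam Ts A C (h i)) (h0 : Tendsto h atTop (𝓝 0))
    (hρ : StronglyMeasurable ρ)
    (hc : ∀ᵐ p ∂(volume : Measure (ℝ × ℝ)).restrict (Ioo 0 Ts ×ˢ univ), D.ConvergesAt lam h ρ p) :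
    D.IsWeakSolution Ts ρ := by
  have hms : MeasurableSet (Ioo 0 Ts ×ˢ (univ : Set ℝ)) := measurableSet_Ioo.prod MeasurableSet.univ
  have hh : ∀ i, 0 < h i := fun i => (U i).adm.1
  have hτ : ∀ i, 0 < lam * h i := fun i => mul_pos hlam (hh i)
  have hτ0 : Tendsto (fun i => lam * h i) atTop (𝓝 0) := by simpa using h0.const_mul lam
  have hc' := hc.and (ae_restrict_mem hms)
  have h1 : ∀ i, h i ≤ 1 := fun i => ((U i).state 0 (by simpa using hTs.le)).h_le
  refine ⟨memLp_top_of_bound hρ.aestronglyMeasurable (2 * ρM) ?_, fun k φ hφ hφc hφs => ?_⟩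
  · filter_upwards [hc'] with p hp
    refine (pi_norm_le_iff_of_nonneg (by linarith [B.ρM_pos])).2 fun k => ?_
    have := hp.1.mem_densityRange U hlam (Ioo_subset_Icc_self hp.2.1) k
    rw [densityRange, mem_Icc] at this
    rw [Real.norm_eq_abs, abs_le]
    constructor <;> linarith [B.ρM_pos]
  obtain ⟨L, r, T', hL, hT', hLip, hLb, hr, hT''⟩ := exists_test_bounds hφ hφc hφs
  -- the test function on the grid, and its discrete derivatives
  let f : ℕ → ℕ → ℤ → ℝ := fun i n j => φ (n * (lam * h i), j * h i)
  let s : ℕ → Finset ℤ := fun i => Finset.Icc (-(⌈(r + 1) / h i⌉ + 1)) (⌈(r + 1) / h i⌉ + 1)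
  have big : ∀ i (j : ℤ), ⌈(r + 1) / h i⌉ < |j| → r + 1 < |j * h i| := fun i j hj => by
    have h2 : (r + 1) / h i < |(j : ℝ)| :=
      (Int.le_ceil _).trans_lt (by rw [← Int.cast_abs]; exact_mod_cast hj)
    rwa [div_lt_iff₀ (hh i), ← abs_of_pos (hh i), ← abs_mul] at h2
  have hs : ∀ i, ∀ j ∉ s i, r + 1 < |j * h i| := fun i j hj => big i j (by
    rw [Finset.mem_Icc, ← abs_le, not_le] at hj; linarith)
  have fz : ∀ i n (j : ℤ), r < |j * h i| → f i n j = 0 := fun i n j hj => hr _ _ hj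
  have fz' : ∀ i n (j c : ℤ), |c| ≤ 1 → r + 1 < |j * h i| → f i n (j + c) = 0 :=
    fun i n j c hc' hj => by
      refine fz i n _ ?_
      have e : ((j + c : ℤ) : ℝ) * h i = j * h i + c * h i := by push_cast; ring
      have hc1 : |(c : ℝ)| ≤ 1 := by exact_mod_cast hc'
      have e1 : |(c : ℝ) * h i| ≤ 1 := by
        rw [abs_mul, abs_of_pos (hh i)]
        nlinarith [abs_nonneg (c : ℝ), h1 i, hh i]
      have e2 := abs_sub_abs_le_abs_sub (j * h i : ℝ) (-(c * h i))
      rw [abs_neg, sub_neg_eq_add] at e2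
      rw [e]; linarith
  -- convergence of the grid points
  have pt : ∀ p ∈ Ioo 0 Ts ×ˢ (univ : Set ℝ), Tendsto (fun i =>
      ((⌊p.1 / (lam * h i)⌋₊ : ℝ) * (lam * h i), (cell (h i) p.2 : ℝ) * h i)) atTop (𝓝 p) :=
    fun p hp => (tendsto_floor_mul hτ hτ0 hp.1.1.le).prodMk_nhds (tendsto_cell_mul hh h0 p.2)
  have pt' : ∀ p ∈ Ioo 0 Ts ×ˢ (univ : Set ℝ), ∀ c : ℝ, Tendsto (fun i =>
      (((⌊p.1 / (lam * h i)⌋₊ : ℝ) + 1) * (lam * h i), ((cell (h i) p.2 : ℝ) + c) * h i)) atTop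
      (𝓝 p) := fun p hp c => by
    have := (pt p hp).add (hτ0.prodMk_nhds (h0.const_mul c))
    rw [mul_zero, Prod.mk_zero_zero, add_zero] at this
    refine this.congr fun i => ?_
    simp only [Prod.mk_add_mk]
    congr 1 <;> ring
  have cu : ∀ᵐ p ∂(volume : Measure (ℝ × ℝ)).restrict (Ioo 0 Ts ×ˢ univ), Tendsto (fun i =>
      D.sol (lam * h i) (h i) ⌊p.1 / (lam * h i)⌋₊ k (cell (h i) p.2)) atTop (𝓝 (ρ p k)) :=
    hc.mono fun p hp => hp.sol k
  have cF := hc'.mono fun p hp => hp.1.tendsto_halfF B U hlam (Ioo_subset_Icc_self hp.2.1) k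
  have cS := hc'.mono fun p hp => hp.1.tendsto_halfS B U hlam (Ioo_subset_Icc_self hp.2.1) k
  obtain ⟨-, t1⟩ := tendsto_sum_strip hTs hh h1 hτ hτ0 (s := s) (r := r + 1) (K₁ := 2 * K) (K₂ := L)
    (W := fun i n j => D.sol (lam * h i) (h i) n k j)
    (Φ := fun i n j => (f i (n + 1) j - f i n j) / (lam * h i))
    (f := fun p => fderiv ℝ φ p (1, 0))
    (fun i n j hn => ((U i).state n hn).abs_val_le B k j)
    (fun i n j => by
      rw [abs_div, abs_of_pos (hτ i), div_le_iff₀ (hτ i)]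
      refine (hLip _ _).trans_eq ?_
      rw [Prod.mk_sub_mk, sub_self, Prod.norm_mk, norm_zero, max_eq_left (norm_nonneg _)]
      rw [← sub_mul, Nat.cast_add, Nat.cast_one, add_sub_cancel_left, one_mul, Real.norm_eq_abs,
        abs_of_pos (hτ i)])
    (fun i n j hj => by
      rw [fz _ _ _ (by linarith), fz _ _ _ (by linarith), sub_zero, zero_div]) hs cu
    (fun p hp => by
      refine (tendsto_difference_quotient hφ (v := (1, 0)) (pt p hp) hτ0
        fun i => (hτ i).ne').congr fun i => ?_
      simp only [f, Prod.smul_mk, smul_eq_mul, Prod.mk_add_mk, mul_one, mul_zero, add_zero]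
      push_cast
      rw [add_one_mul])
  obtain ⟨i2, t2⟩ := tendsto_sum_strip hTs hh h1 hτ hτ0 (s := s) (r := r + 1)
    (K₁ := LF' * (2 * K)) (K₂ := L)
    (W := fun i n j => D.halfF (lam * h i) (h i) (D.sol (lam * h i) (h i) n) k j)
    (Φ := fun i n j => (f i (n + 1) (j + 1) - f i (n + 1) (j - 1)) / (2 * h i))
    (f := fun p => fderiv ℝ φ p (0, 1))
    (fun i n j hn => ((U i).half n hn).abs_halfF_le B hD.F_zero k j)
    (fun i n j => by
      have h2 : 0 < 2 * h i := by linarith [hh i]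
      rw [abs_div, abs_of_pos h2, div_le_iff₀ h2]
      refine (hLip _ _).trans_eq ?_
      rw [Prod.mk_sub_mk, sub_self, Prod.norm_mk, norm_zero, max_eq_right (norm_nonneg _)]
      rw [← sub_mul, Real.norm_eq_abs]
      push_cast
      rw [show (j + 1 - (j - 1) : ℝ) = 2 by ring, abs_of_pos h2])
    (fun i n j hj => by
      rw [fz' _ _ _ 1 (by norm_num) hj, sub_eq_add_neg j, fz' _ _ _ (-1) (by norm_num) hj, sub_zero,
        zero_div]) hs cF
    (fun p hp => by
      refine (tendsto_difference_quotient hφ (v := (0, 1)) (pt' p hp (-1))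
        (c := fun i => 2 * h i) (by simpa using h0.const_mul 2)
        fun i => (mul_pos two_pos (hh i)).ne').congr fun i => ?_
      simp only [f, Prod.smul_mk, smul_eq_mul, Prod.mk_add_mk, mul_one, mul_zero, add_zero]
      push_cast
      congr 4
      ring)
  obtain ⟨i3, t3⟩ := tendsto_sum_strip hTs hh h1 hτ hτ0 (s := s) (r := r + 1)
    (K₁ := K) (K₂ := L)
    (W := fun i n j => D.halfS (lam * h i) (h i) (D.sol (lam * h i) (h i) n) k j)
    (Φ := fun i n j => (f i (n + 1) (j - 1) + 2 * f i (n + 1) j + f i (n + 1) (j + 1)) / 4)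
    (f := φ)
    (fun i n j hn => B.S_le k _ (fun _ => ((U i).half n hn).memU _ _) _ (((U i).half n hn).memR _))
    (fun i n j => by
      have b := fun j => abs_le.1 (hLb (((n + 1 : ℕ) : ℝ) * (lam * h i), ((j : ℤ) : ℝ) * h i))
      have b1 := b (j - 1)
      have b2 := b j
      have b3 := b (j + 1)
      rw [abs_le]
      simp only [f]
      constructor <;> linarith [b1.1, b1.2, b2.1, b2.2, b3.1, b3.2])
    (fun i n j hj => by
      rw [fz' _ _ _ 1 (by norm_num) hj, sub_eq_add_neg j, fz' _ _ _ (-1) (by norm_num) hj,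
        fz _ _ _ (by linarith)]
      norm_num) hs cS
    (fun p hp => by
      have q := fun c => (hφ.continuous.tendsto p).comp (pt' p hp c)
      have := (((q (-1)).add ((q 0).const_mul 2)).add (q 1)).div_const 4
      rw [show (φ p + 2 * φ p + φ p) / 4 = φ p by ring] at this
      refine this.congr fun i => ?_
      simp only [f, Function.comp_apply, add_zero]
      push_cast
      rfl)
  have t4 := tendsto_viscosity hlam hTs hA hC U h0 k (ψ := fun i n j => f i (n + 1) j) hL
    (fun i n j => by
      refine (hLip _ _).trans_eq ?_
      rw [Prod.mk_sub_mk, sub_self, Prod.norm_mk, norm_zero, max_eq_right (norm_nonneg _)]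
      rw [← sub_mul, Real.norm_eq_abs]
      push_cast
      rw [show (j - (j + 1) : ℝ) = -1 by ring, neg_one_mul, abs_neg, abs_of_pos (hh i)]) s
  have t0 := tendsto_init hD hh h0 (φ := fun x => φ (0, x)) (hφ.continuous.comp (by fun_prop))
    (fun x => hLb _) (s := s) (fun i j hj => hr _ _ (by linarith [hs i j hj])) k
  have comm : ∀ p, φ p * D.S k (ρ p) (D.nonlocal ρ p) = D.S k (ρ p) (D.nonlocal ρ p) * φ p :=
    fun p => mul_comm _ _
  simp only [comm]
  have t := (((t0.add t1).add t2).add t3).add t4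
  rw [add_zero] at t
  refine ⟨i2, i3, tendsto_nhds_unique (t.congr' ?_) tendsto_const_nhds⟩
  filter_upwards [hτ0.eventually (Iio_mem_nhds (sub_pos.2 hT'))] with i hi
  have key := discrete_weak (u := fun n j => D.sol (lam * h i) (h i) n k j)
    (P := fun n j => D.viscosity (lam * h i) (h i) (D.sol (lam * h i) (h i) n) k j)
    (F := fun n j => D.halfF (lam * h i) (h i) (D.sol (lam * h i) (h i) n) k j)
    (S := fun n j => D.halfS (lam * h i) (h i) (D.sol (lam * h i) (h i) n) k j) (φ := f i)
    (M := ⌊Ts / (lam * h i)⌋₊) (L := ⌈(r + 1) / h i⌉) (hh i) hlam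
    (fun n _ j => step_sub_eq D (hh i) (D.sol (lam * h i) (h i) n) k j)
    (fun n j hj => fz _ _ _ (by linarith [big i j hj]))
    (fun j => hT'' _ _ (by
      have := Nat.lt_floor_add_one (Ts / (lam * h i))
      rw [div_lt_iff₀ (hτ i)] at this
      linarith))
  refine Eq.trans ?_ key
  simp only [f, Nat.cast_zero, zero_mul]
  rfl

end Data
end NT

end

theorem mainTheorem6 {N m : ℕ} (D : NT.Data N m) (ρM LF T lam : ℝ)
    (hD : D.Assumption ρM LF) (hT : 0 < T) (hlam : 0 < lam)
    (hCFL : lam * LF ≤ (Real.sqrt 2 - 1) / 2) :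
    ∃ Ts : ℝ, 0 < Ts ∧ Ts ≤ T ∧
      ∀ h : ℕ → ℝ, (∀ i, D.AdmissibleStep (h i)) → Tendsto h atTop (𝓝 0) →
        ∃ ψ : ℕ → ℕ, StrictMono ψ ∧ ∃ ρ : ℝ × ℝ → Fin N → ℝ,
          (∀ r : ℝ, 0 < r →
            Tendsto
              (fun i => ∫⁻ p in Ioo 0 Ts ×ˢ Icc (-r) r,
                ‖D.approx (lam * h (ψ i)) (h (ψ i)) p - ρ p‖ₑ)
              atTop (𝓝 0)) ∧
          D.IsWeakSolution Ts ρ := by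
  obtain ⟨K, B⟩ := D.exists_bounds hD
  obtain ⟨Ts, A, C, h₀, hTs, hTsT, hA, hC, hh₀, hU⟩ := NT.Data.exists_uniform hD hT hlam hCFL
  refine ⟨Ts, hTs, hTsT, fun h hadm h0 => ?_⟩
  obtain ⟨i₀, hi₀⟩ := eventually_atTop.1 (h0.eventually (Iio_mem_nhds hh₀))
  have U : ∀ i, D.Uniform ρM (max LF 0) lam Ts A C (h (i + i₀)) := fun i =>
    hU _ (hadm _) (hi₀ _ (by omega))
  have h0' : Tendsto (fun i => h (i + i₀)) atTop (𝓝 0) := h0.comp (tendsto_add_atTop_nat i₀)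
  obtain ⟨ψ, hψ, ρ, hρ, hL1, hsol, hhalf⟩ := NT.Data.exists_limit B hlam hA hC hTs U h0'
  have U' := fun i => U (ψ i)
  have hh' := h0'.comp hψ.tendsto_atTop
  refine ⟨fun i => ψ i + i₀, fun a b hab => Nat.add_lt_add_right (hψ hab) i₀, ρ, fun r _ => ?_,
    NT.Data.isWeakSolution_of_tendsto hD B hlam hTs hA hC U' hh' hρ
      (NT.Data.ae_convergesAt hD B hlam U' hh' hsol hhalf)⟩
  have hm := fun i => ((NT.Data.measurable_approx D (lam * h (ψ i + i₀)) (h (ψ i + i₀))).sub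
    hρ.measurable).enorm
  have hbox := ENNReal.Tendsto.const_mul (a := ENNReal.ofReal (1 + r ^ 2)) hL1
    (Or.inr ENNReal.ofReal_ne_top)
  rw [mul_zero] at hbox
  exact tendsto_of_tendsto_of_tendsto_of_le_of_le tendsto_const_nhds hbox (fun _ => zero_le)
    fun i => NT.setLIntegral_box_le Ts r (hm i)
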